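/- Let $k$ be an algebraically closed field and let $w$ be an integer. Set $d = w-1$ and let $A = k[T]$ be the polynomial algebra, viewed as a differential graded (DG) algebra with $T$ in homological degree $d$ (that is, cohomological degree $1-w$) and zero differential. Let $\mathsf{D}(A)$ be the derived category of DG left-$A$-modules, with suspension functor $\Sigma$, and let $\mathsf{T} = \langle k \rangle$ be the thick subcategory of $\mathsf{D}(A)$ generated by the trivial DG module $k = A/(T)$ (the smallest full triangulated subcategory which contains $k$ and is closed under isomorphisms and direct summands). A Serre functor of a $k$-linear category $\mathsf{C}$ is a $k$-linear autoequivalence $S$ of $\mathsf{C}$ together with $k$-linear isomorphisms $\mathsf{C}(X,Y) \cong \operatorname{Hom}_k(\mathsf{C}(Y,SX),k)$ which are natural in $X$ and $Y$. Then $\Sigma^w$ is a Serre functor of $\mathsf{T}$, and no other power of the suspension is: if $\Sigma^i$ is a Serre functor of $\mathsf{T}$ for an integer $i$, then $i = w$. -/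

import Mathlib

section

open CategoryTheory CochainComplex CochainComplex.HomComplex Limits

universe u v

/-- A differential graded algebra over `k`, in cohomological grading: a cochain complex with an
associative unital product of degree `0` satisfying `d (a b) = (d a) b + (-1) ^ |a| a (d b)`. -/
structure DGAlgebra (k : Type u) [Field k] where
  cx : CochainComplex (ModuleCat.{u} k) ℤ
  mul : ∀ (p q n : ℤ), p + q = n → (cx.X p →ₗ[k] cx.X q →ₗ[k] cx.X n)
  one : cx.X 0
  protected one_mul : ∀ (p : ℤ) (a : cx.X p), mul 0 p p (zero_add p) one a = a
  protected mul_one : ∀ (p : ℤ) (a : cx.X p), mul p 0 p (add_zero p) a one = a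
  protected mul_assoc : ∀ (p q r pq qr n : ℤ) (hpq : p + q = pq) (hqr : q + r = qr)
    (h : pq + r = n) (h' : p + qr = n) (a : cx.X p) (b : cx.X q) (c : cx.X r),
    mul pq r n h (mul p q pq hpq a b) c = mul p qr n h' a (mul q r qr hqr b c)
  leibniz : ∀ (p q n p' q' n' : ℤ) (_ : p + 1 = p') (_ : q + 1 = q') (h : p + q = n)
    (h₁ : p' + q = n') (h₂ : p + q' = n') (a : cx.X p) (b : cx.X q),
    (cx.d n n').hom (mul p q n h a b) =
      mul p' q n' h₁ ((cx.d p p').hom a) b + p.negOnePow • mul p q' n' h₂ a ((cx.d q q').hom b)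

namespace DGAlgebra

variable {k : Type u} [Field k]

/-- A differential graded left module over `A`: a cochain complex `M` of `k`-modules together with
a morphism of differential graded algebras from `A` to the endomorphism complex of `M`. As
`Cochain.comp` is written in diagrammatic order, `act_mul` reads `(a b) m = a (b m)`; `δ` is
`f ↦ d ∘ f - (-1) ^ |f| f ∘ d`, so that `δ_act` reads `d (a m) = (d a) m + (-1) ^ |a| a (d m)`. -/
structure LeftModule (A : DGAlgebra k) where
  cx : CochainComplex (ModuleCat.{u} k) ℤ
  act : ∀ p : ℤ, A.cx.X p →ₗ[k] Cochain cx cx p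
  act_one : act 0 A.one = Cochain.ofHom (𝟙 cx)
  act_mul : ∀ (p q n : ℤ) (h : p + q = n) (a : A.cx.X p) (b : A.cx.X q),
    act n (A.mul p q n h a b) = (act q b).comp (act p a) ((add_comm q p).trans h)
  δ_act : ∀ (p p' : ℤ) (_ : p + 1 = p') (a : A.cx.X p),
    δ p p' (act p a) = act p' ((A.cx.d p p').hom a)

namespace LeftModule

variable {A : DGAlgebra k}

/-- A morphism of DG modules: a morphism of complexes which is `A`-linear. -/
@[ext]
structure Hom (M N : A.LeftModule) where
  hom : M.cx ⟶ N.cx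
  comm : ∀ (p : ℤ) (a : A.cx.X p),
    (M.act p a).comp (Cochain.ofHom hom) (add_zero p) =
      (Cochain.ofHom hom).comp (N.act p a) (zero_add p)

attribute [simp] act_one

instance : Category A.LeftModule where
  Hom := Hom
  id M := { hom := 𝟙 _, comm := fun p a => by simp }
  comp {M N P} f g :=
    { hom := f.hom ≫ g.hom
      comm := fun p a => by
        rw [Cochain.ofHom_comp, ← Cochain.comp_assoc_of_third_is_zero_cochain, f.comm,
          Cochain.comp_assoc_of_first_is_zero_cochain, g.comm,
          Cochain.comp_assoc_of_first_is_zero_cochain] }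

variable {M N P : A.LeftModule}

@[ext]
lemma hom_ext {f g : M ⟶ N} (h : f.hom = g.hom) : f = g := Hom.ext h

@[simp] lemma id_hom : Hom.hom (𝟙 M) = 𝟙 M.cx := rfl
@[simp] lemma comp_hom (f : M ⟶ N) (g : N ⟶ P) : (f ≫ g).hom = f.hom ≫ g.hom := rfl

instance : Zero (M ⟶ N) := ⟨{ hom := 0, comm := fun p a => by simp }⟩
instance : Add (M ⟶ N) :=
  ⟨fun f g => { hom := f.hom + g.hom, comm := fun p a => by simp [f.comm, g.comm] }⟩
instance : Neg (M ⟶ N) := ⟨fun f => { hom := -f.hom, comm := fun p a => by simp [f.comm] }⟩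
instance : Sub (M ⟶ N) :=
  ⟨fun f g => { hom := f.hom - g.hom, comm := fun p a => by simp [f.comm, g.comm] }⟩
lemma ofHom_smul (r : k) (f : M.cx ⟶ N.cx) :
    Cochain.ofHom (r • f) = r • Cochain.ofHom f := by
  ext p
  simp
instance : SMul k (M ⟶ N) :=
  ⟨fun r f => { hom := r • f.hom, comm := fun p a => by simp [ofHom_smul, f.comm] }⟩
instance : SMul ℕ (M ⟶ N) where
  smul r f :=
    { hom := r • f.hom
      comm := fun p a => by
        rw [← Nat.cast_smul_eq_nsmul k]
        simp [ofHom_smul, f.comm] }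

instance : SMul ℤ (M ⟶ N) where
  smul r f :=
    { hom := r • f.hom
      comm := fun p a => by
        rw [← Int.cast_smul_eq_zsmul k]
        simp [ofHom_smul, f.comm] }

lemma hom_injective : Function.Injective (fun f : M ⟶ N => f.hom) := fun _ _ h => hom_ext h

instance : AddCommGroup (M ⟶ N) :=
  hom_injective.addCommGroup (fun f : M ⟶ N => f.hom) rfl (fun _ _ => rfl) (fun _ => rfl)
    (fun _ _ => rfl) (fun _ _ => rfl) (fun _ _ => rfl)

@[simp] lemma zero_hom : (0 : M ⟶ N).hom = 0 := rfl
@[simp] lemma add_hom (f g : M ⟶ N) : (f + g).hom = f.hom + g.hom := rfl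
@[simp] lemma neg_hom (f : M ⟶ N) : (-f).hom = -f.hom := rfl
@[simp] lemma smul_hom (r : k) (f : M ⟶ N) : (r • f).hom = r • f.hom := rfl

instance : Preadditive A.LeftModule where

instance : Module k (M ⟶ N) :=
  hom_injective.module k
    { toFun := fun f : M ⟶ N => f.hom, map_zero' := rfl, map_add' := fun _ _ => rfl }
    (fun _ _ => rfl)

instance : Linear k A.LeftModule where

/-- The underlying complex of a DG module. -/
@[simps]
def forget (A : DGAlgebra k) : A.LeftModule ⥤ CochainComplex (ModuleCat.{u} k) ℤ where
  obj M := M.cx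
  map f := f.hom

instance : (forget A).Faithful where
  map_injective h := hom_ext h

instance : (forget A).Additive where

/-- Constructor for isomorphisms of DG modules. -/
@[simps]
def isoMk (e : M.cx ≅ N.cx) (comm : ∀ (p : ℤ) (a : A.cx.X p),
    (M.act p a).comp (Cochain.ofHom e.hom) (add_zero p) =
      (Cochain.ofHom e.hom).comp (N.act p a) (zero_add p)) : M ≅ N where
  hom := { hom := e.hom, comm := comm }
  inv :=
    { hom := e.inv
      comm := fun p a => by
        refine Cochain.ext _ _ fun i j h => ?_
        have := Cochain.congr_v (comm p a) i j h
        simp only [Cochain.comp_zero_cochain_v, Cochain.ofHom_v,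
          Cochain.zero_cochain_comp_v] at this ⊢
        rw [← cancel_mono (e.hom.f j), ← cancel_epi (e.hom.f i)]
        simp [this] }
  hom_inv_id := by ext1; simp
  inv_hom_id := by ext1; simp

instance {f : M ⟶ N} [IsIso f] : IsIso f.hom := inferInstanceAs (IsIso ((forget A).map f))

lemma shift_comp {K L P : CochainComplex (ModuleCat.{u} k) ℤ} {p q r : ℤ} (y : Cochain K L p)
    (z : Cochain L P q) (h : p + q = r) (n : ℤ) :
    (y.comp z h).shift n = (y.shift n).comp (z.shift n) h := by
  refine Cochain.ext _ _ fun i j hij => ?_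
  rw [Cochain.shift_v', Cochain.comp_v _ _ _ (i + n) (i + p + n) (j + n) (by lia) (by lia),
    Cochain.comp_v _ _ _ i (i + p) j rfl (by lia), Cochain.shift_v', Cochain.shift_v']
  rfl

lemma shift_ofHom {K L : CochainComplex (ModuleCat.{u} k) ℤ} (f : K ⟶ L) (n : ℤ) :
    (Cochain.ofHom f).shift n = Cochain.ofHom (f⟦n⟧') := by
  refine Cochain.ext₀ _ _ fun i => ?_
  rw [Cochain.shift_v']
  simp

/-- The `n`-fold suspension `M⟦n⟧`: degree `i` is `M.X (i + n)`, the differential is multiplied by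
`(-1) ^ n`, and `a` acts as `(-1) ^ (n |a|) a`. -/
def shiftObj (n : ℤ) (M : A.LeftModule) : A.LeftModule where
  cx := M.cx⟦n⟧
  act p := (n * p).negOnePow • (Cochain.shiftLinearMap k M.cx M.cx p n ∘ₗ M.act p)
  act_one := by
    simp [shift_ofHom]
  act_mul p q r h a b := by
    simp only [LinearMap.smul_apply, LinearMap.comp_apply, Cochain.shiftLinearMap_apply,
      M.act_mul p q r h, shift_comp, Cochain.units_smul_comp, Cochain.comp_units_smul, smul_smul,
      ← Int.negOnePow_add, ← h]
    congr 2
    ring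
  δ_act p p' h a := by
    subst h
    simp only [LinearMap.smul_apply, LinearMap.comp_apply, Cochain.shiftLinearMap_apply,
      δ_units_smul, Cochain.δ_shift, smul_smul, ← Int.negOnePow_add, M.δ_act p _ rfl]
    congr 2
    ring

@[simp] lemma shiftObj_cx (n : ℤ) (M : A.LeftModule) : (shiftObj n M).cx = M.cx⟦n⟧ := rfl

lemma shiftObj_act (n : ℤ) (M : A.LeftModule) (p : ℤ) (a : A.cx.X p) :
    (shiftObj n M).act p a = (n * p).negOnePow • (M.act p a).shift n := rfl

section

variable {K L : CochainComplex (ModuleCat.{u} k) ℤ} {p : ℤ}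

lemma shift_comm {x : Cochain K K p} {y : Cochain L L p} {f : K ⟶ L}
    (h : x.comp (Cochain.ofHom f) (add_zero p) = (Cochain.ofHom f).comp y (zero_add p))
    (n : ℤ) (ε : ℤˣ) :
    (ε • x.shift n).comp (Cochain.ofHom (f⟦n⟧')) (add_zero p) =
      (Cochain.ofHom (f⟦n⟧')).comp (ε • y.shift n) (zero_add p) := by
  rw [← shift_ofHom, Cochain.units_smul_comp, Cochain.comp_units_smul, ← shift_comp, h, shift_comp]

lemma v_XIsoOfEq (x : Cochain K K p) (i i' j j' : ℤ) (h : i + p = j) (hi : i = i') (hj : j = j') :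
    x.v i j h ≫ (K.XIsoOfEq hj).hom = (K.XIsoOfEq hi).hom ≫ x.v i' j' (by lia) := by
  subst hi hj
  simp

lemma shift_zero_comm (x : Cochain K K p) :
    (((0 : ℤ) * p).negOnePow • x.shift 0).comp
        (Cochain.ofHom ((shiftFunctorZero (CochainComplex _ ℤ) ℤ).hom.app K)) (add_zero p) =
      (Cochain.ofHom ((shiftFunctorZero (CochainComplex _ ℤ) ℤ).hom.app K)).comp x
        (zero_add p) := by
  refine Cochain.ext _ _ fun i j h => ?_
  rw [Cochain.comp_zero_cochain_v, Cochain.zero_cochain_comp_v, Cochain.ofHom_v,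
    Cochain.ofHom_v, zero_mul, Int.negOnePow_zero, one_smul, Cochain.shift_v',
    shiftFunctorZero_hom_app_f, shiftFunctorZero_hom_app_f]
  exact v_XIsoOfEq x _ _ _ _ _ _ _

lemma shift_add_comm (x : Cochain K K p) (n m : ℤ) :
    (((n + m) * p).negOnePow • x.shift (n + m)).comp
        (Cochain.ofHom ((shiftFunctorAdd (CochainComplex _ ℤ) n m).hom.app K)) (add_zero p) =
      (Cochain.ofHom ((shiftFunctorAdd (CochainComplex _ ℤ) n m).hom.app K)).comp
        ((m * p).negOnePow • ((n * p).negOnePow • x.shift n).shift m) (zero_add p) := by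
  rw [Cochain.shift_units_smul, smul_smul, ← Int.negOnePow_add, ← add_mul,
    add_comm m n, Cochain.units_smul_comp, Cochain.comp_units_smul]
  congr 1
  refine Cochain.ext _ _ fun i j h => ?_
  rw [Cochain.comp_zero_cochain_v, Cochain.zero_cochain_comp_v, Cochain.ofHom_v,
    Cochain.ofHom_v, Cochain.shift_v',
    shiftFunctorAdd_hom_app_f, shiftFunctorAdd_hom_app_f]
  refine (v_XIsoOfEq x _ (i + m + n) _ _ _ (by ring) _).trans ?_
  refine congrArg _ ?_
  exact ((Cochain.shift_v' (x.shift n) m i j h).trans (Cochain.shift_v' x n _ _ _)).symm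

end

/-- The `n`-fold suspension functor on DG modules. -/
@[simps]
def shiftF (A : DGAlgebra k) (n : ℤ) : A.LeftModule ⥤ A.LeftModule where
  obj M := shiftObj n M
  map {M N} f :=
    { hom := f.hom⟦n⟧'
      comm := fun p a => shift_comm (f.comm p a) n _ }
  map_id M := by ext1; exact (CategoryTheory.shiftFunctor _ n).map_id M.cx
  map_comp f g := by ext1; exact (CategoryTheory.shiftFunctor _ n).map_comp f.hom g.hom

/-- The suspension by `0` is the identity. -/
def shiftZeroIso (A : DGAlgebra k) : shiftF A 0 ≅ 𝟭 _ :=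
  NatIso.ofComponents (fun M => isoMk ((shiftFunctorZero (CochainComplex _ ℤ) ℤ).app M.cx)
    (fun p a => shift_zero_comm (M.act p a)))
    (fun f => by
      ext1
      exact (shiftFunctorZero (CochainComplex (ModuleCat.{u} k) ℤ) ℤ).hom.naturality f.hom)

/-- Compatibility of suspensions with addition. -/
def shiftAddIso (A : DGAlgebra k) (n m : ℤ) : shiftF A (n + m) ≅ shiftF A n ⋙ shiftF A m :=
  NatIso.ofComponents (fun M => isoMk ((shiftFunctorAdd (CochainComplex _ ℤ) n m).app M.cx)
    (fun p a => shift_add_comm (M.act p a) n m))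
    (fun f => by
      ext1
      exact (shiftFunctorAdd (CochainComplex (ModuleCat.{u} k) ℤ) n m).hom.naturality f.hom)

lemma eqToHom_hom (h : M = N) : (eqToHom h).hom = eqToHom (congrArg LeftModule.cx h) := by
  subst h; rfl


/-- The coherence data of the shift on cochain complexes. -/
def hasShiftCore (k : Type u) [Field k] : ShiftMkCore (CochainComplex (ModuleCat.{u} k) ℤ) ℤ where
  F n := CategoryTheory.shiftFunctor _ n
  zero := shiftFunctorZero _ ℤ
  add n m := shiftFunctorAdd _ n m
  assoc_hom_app a b c X := by
    rw [shiftFunctorAdd_assoc_hom_app]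
    simp [CategoryTheory.shiftFunctorAdd']
  zero_add_hom_app n X := shiftFunctorAdd_zero_add_hom_app n X
  add_zero_hom_app n X := shiftFunctorAdd_add_zero_hom_app n X

instance : HasShift A.LeftModule ℤ := hasShiftMk _ _
  { F := shiftF A
    zero := shiftZeroIso A
    add := shiftAddIso A
    assoc_hom_app := fun a b c M => by
      ext1
      rw [comp_hom, comp_hom, comp_hom, eqToHom_hom]
      exact (hasShiftCore k).assoc_hom_app a b c M.cx
    zero_add_hom_app := fun n M => by
      ext1
      rw [comp_hom, eqToHom_hom]
      exact (hasShiftCore k).zero_add_hom_app n M.cx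
    add_zero_hom_app := fun n M => by
      ext1
      rw [comp_hom, eqToHom_hom]
      exact (hasShiftCore k).add_zero_hom_app n M.cx }

end LeftModule
end DGAlgebra

namespace LocalizationPreadditive

variable {C : Type u} [Category.{v} C] [Preadditive C] [HasFiniteProducts C] [HasBinaryBiproducts C]
  (W : MorphismProperty C) [W.ContainsIdentities] [W.IsStableUnderFiniteProducts]

open Localization.Construction

/-- The localization functor preserves binary products. -/
noncomputable def isLimitFan (Y Y' : C) :
    IsLimit (BinaryFan.mk (W.Q.map (biprod.fst : Y ⊞ Y' ⟶ Y)) (W.Q.map (biprod.snd : Y ⊞ Y' ⟶ Y'))) :=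
  mapIsLimitOfPreservesOfIsLimit W.Q _ _ (BinaryBiproduct.isLimit Y Y')

variable {W}

/-- The morphism to a binary product with given components. -/
noncomputable def lift {X : W.Localization} {Y Y' : C} (f : X ⟶ W.Q.obj Y) (g : X ⟶ W.Q.obj Y') :
    X ⟶ W.Q.obj (Y ⊞ Y') :=
  (BinaryFan.IsLimit.lift' (isLimitFan W Y Y') f g).1

@[simp]
lemma lift_fst {X : W.Localization} {Y Y' : C} (f : X ⟶ W.Q.obj Y) (g : X ⟶ W.Q.obj Y') :
    lift f g ≫ W.Q.map biprod.fst = f :=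
  (BinaryFan.IsLimit.lift' (isLimitFan W Y Y') f g).2.1

@[simp]
lemma lift_fst_assoc {X Z : W.Localization} {Y Y' : C} (f : X ⟶ W.Q.obj Y)
    (g : X ⟶ W.Q.obj Y') (h : W.Q.obj Y ⟶ Z) :
    lift f g ≫ W.Q.map biprod.fst ≫ h = f ≫ h := by
  rw [← Category.assoc, lift_fst]

@[simp]
lemma lift_snd {X : W.Localization} {Y Y' : C} (f : X ⟶ W.Q.obj Y) (g : X ⟶ W.Q.obj Y') :
    lift f g ≫ W.Q.map biprod.snd = g :=
  (BinaryFan.IsLimit.lift' (isLimitFan W Y Y') f g).2.2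

@[simp]
lemma lift_snd_assoc {X Z : W.Localization} {Y Y' : C} (f : X ⟶ W.Q.obj Y)
    (g : X ⟶ W.Q.obj Y') (h : W.Q.obj Y' ⟶ Z) :
    lift f g ≫ W.Q.map biprod.snd ≫ h = g ≫ h := by
  rw [← Category.assoc, lift_snd]

lemma hom_ext {X : W.Localization} {Y Y' : C} {f g : X ⟶ W.Q.obj (Y ⊞ Y')}
    (h₁ : f ≫ W.Q.map biprod.fst = g ≫ W.Q.map biprod.fst)
    (h₂ : f ≫ W.Q.map biprod.snd = g ≫ W.Q.map biprod.snd) : f = g :=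
  BinaryFan.IsLimit.hom_ext (isLimitFan W Y Y') h₁ h₂

lemma comp_lift {X X' : W.Localization} {Y Y' : C} (h : X' ⟶ X) (f : X ⟶ W.Q.obj Y)
    (g : X ⟶ W.Q.obj Y') : h ≫ lift f g = lift (h ≫ f) (h ≫ g) := by
  apply hom_ext <;> simp

/-- The sum of two morphisms: `(f, g) : X ⟶ Y ⊞ Y` followed by the codiagonal of `Y`. -/
noncomputable def add {X : W.Localization} {Y : C} (f g : X ⟶ W.Q.obj Y) : X ⟶ W.Q.obj Y :=
  lift f g ≫ W.Q.map (biprod.fst + biprod.snd)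

lemma comp_add {X X' : W.Localization} {Y : C} (h : X' ⟶ X) (f g : X ⟶ W.Q.obj Y) :
    h ≫ add f g = add (h ≫ f) (h ≫ g) := by
  rw [add, ← Category.assoc, comp_lift, add]

lemma map_lift {X Y Y' : C} (f : X ⟶ Y) (g : X ⟶ Y') :
    lift (W.Q.map f) (W.Q.map g) = W.Q.map (biprod.lift f g) := by
  apply hom_ext <;> simp [← Functor.map_comp]

lemma map_add {X Y : C} (f g : X ⟶ Y) : W.Q.map (f + g) = add (W.Q.map f) (W.Q.map g) := by
  rw [add, map_lift, ← Functor.map_comp]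
  simp

lemma add_map {X : W.Localization} {Y Y' : C} (f g : X ⟶ W.Q.obj Y) (h : Y ⟶ Y') :
    add f g ≫ W.Q.map h = add (f ≫ W.Q.map h) (g ≫ W.Q.map h) := by
  have : lift (f ≫ W.Q.map h) (g ≫ W.Q.map h) = lift f g ≫ W.Q.map (biprod.map h h) := by
    apply hom_ext <;> simp [← Functor.map_comp]
    all_goals simp [Functor.map_comp]
  rw [add, add, this, Category.assoc, Category.assoc, ← Functor.map_comp, ← Functor.map_comp]
  congr 2
  simp

lemma add_comm' {X : W.Localization} {Y : C} (f g : X ⟶ W.Q.obj Y) : add f g = add g f := by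
  have : lift g f = lift f g ≫ W.Q.map (biprod.lift biprod.snd biprod.fst) := by
    apply hom_ext <;> simp [← Functor.map_comp]
  rw [add, add, this, Category.assoc, ← Functor.map_comp]
  congr 2
  simp [add_comm]

lemma add_eq_map {X : W.Localization} {Y Z : C} (t : X ⟶ W.Q.obj Z) (a b : Z ⟶ Y) :
    add (t ≫ W.Q.map a) (t ≫ W.Q.map b) = t ≫ W.Q.map (a + b) := by
  rw [← comp_add, ← map_add]

lemma add_assoc' {X : W.Localization} {Y : C} (f g h : X ⟶ W.Q.obj Y) :
    add (add f g) h = add f (add g h) := by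
  let t := lift (lift f g) h
  have hf : f = t ≫ W.Q.map (biprod.fst ≫ biprod.fst) := by simp [t]
  have hg : g = t ≫ W.Q.map (biprod.fst ≫ biprod.snd) := by simp [t]
  have hh : h = t ≫ W.Q.map biprod.snd := by simp [t]
  rw [hf, hg, hh, add_eq_map, add_eq_map, add_eq_map, add_eq_map, add_assoc]

/-- The zero morphism. -/
noncomputable def zero (X : W.Localization) (Y : C) : X ⟶ W.Q.obj Y :=
  (IsTerminal.isTerminalObj W.Q _ (terminalIsTerminal (C := C))).from X ≫ W.Q.map 0

lemma comp_zero' {X X' : W.Localization} (Y : C) (h : X' ⟶ X) : h ≫ zero X Y = zero X' Y := by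
  rw [zero, ← Category.assoc]
  exact congrArg (· ≫ _) ((IsTerminal.isTerminalObj W.Q _ terminalIsTerminal).hom_ext _ _)

lemma map_zero' (X Y : C) : W.Q.map (0 : X ⟶ Y) = zero (W.Q.obj X) Y := by
  have : (0 : X ⟶ Y) = (0 : X ⟶ ⊤_ C) ≫ 0 := by simp
  rw [this, Functor.map_comp]
  exact congrArg (· ≫ _) ((IsTerminal.isTerminalObj W.Q _ terminalIsTerminal).hom_ext _ _)

lemma comp_map_zero {X : W.Localization} {Y Z : C} (t : X ⟶ W.Q.obj Z) :
    t ≫ W.Q.map (0 : Z ⟶ Y) = zero X Y := by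
  rw [map_zero', comp_zero']

lemma zero_add' {X : W.Localization} {Y : C} (f : X ⟶ W.Q.obj Y) : add (zero X Y) f = f := by
  have := add_eq_map f (0 : Y ⟶ Y) (𝟙 Y)
  rwa [comp_map_zero, zero_add, CategoryTheory.Functor.map_id, Category.comp_id] at this

lemma neg_add' {X : W.Localization} {Y : C} (f : X ⟶ W.Q.obj Y) :
    add (f ≫ W.Q.map (-𝟙 Y)) f = zero X Y := by
  have := add_eq_map f (-𝟙 Y) (𝟙 Y)
  rwa [CategoryTheory.Functor.map_id, Category.comp_id, neg_add_cancel, comp_map_zero] at this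

/-- The addition on arbitrary `Hom`-sets of the localized category. -/
noncomputable def homAdd {X Y : W.Localization} (f g : X ⟶ Y) : X ⟶ Y :=
  add (Y := Y.as.obj) f g

lemma homAdd_comp {X Y Z : W.Localization} (f g : X ⟶ Y) (φ : Y ⟶ Z) :
    homAdd f g ≫ φ = homAdd (f ≫ φ) (g ≫ φ) := by
  let P : MorphismProperty W.Localization := fun Y Z φ =>
    ∀ ⦃X : W.Localization⦄ (f g : X ⟶ Y), homAdd f g ≫ φ = homAdd (f ≫ φ) (g ≫ φ)
  have : P.IsStableUnderComposition :=
    ⟨fun φ ψ hφ hψ X f g => by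
      rw [← Category.assoc, hφ, hψ, Category.assoc, Category.assoc]⟩
  have hP : P = ⊤ := morphismProperty_eq_top' P (fun Y Z h X f g => add_map f g h)
    (fun Y Z e he X f g => by
      rw [← cancel_mono e.hom, he]
      simp)
  have : P φ := by
    rw [hP]
    trivial
  exact this f g

variable (W)

/-- The abelian group structure on `Hom`-sets of the localized category. -/
@[reducible]
noncomputable def homGroup (X Y : W.Localization) : AddCommGroup (X ⟶ Y) where
  add f g := homAdd f g
  zero := zero X Y.as.obj
  neg f := f ≫ W.Q.map (-𝟙 Y.as.obj)
  nsmul := @nsmulRec _ ⟨zero X Y.as.obj⟩ ⟨homAdd⟩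
  zsmul := @zsmulRec _ ⟨zero X Y.as.obj⟩ ⟨homAdd⟩ ⟨fun f => f ≫ W.Q.map (-𝟙 Y.as.obj)⟩
    (@nsmulRec _ ⟨zero X Y.as.obj⟩ ⟨homAdd⟩)
  add_assoc f g h := add_assoc' (Y := Y.as.obj) f g h
  zero_add f := zero_add' (Y := Y.as.obj) f
  add_zero f := (add_comm' (Y := Y.as.obj) _ _).trans (zero_add' (Y := Y.as.obj) f)
  neg_add_cancel f := neg_add' (Y := Y.as.obj) f
  add_comm f g := add_comm' (Y := Y.as.obj) f g

/-- The preadditive structure on the localized category; it is the one for which the localization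
functor is additive. -/
@[reducible]
noncomputable def preadditive : Preadditive W.Localization where
  homGroup := homGroup W
  add_comp _ _ _ f g h := homAdd_comp f g h
  comp_add _ _ Z h f g := comp_add (Y := Z.as.obj) h f g

lemma additive_Q :
    letI := preadditive W
    W.Q.Additive :=
  letI := preadditive W
  ⟨fun {_ _ f g} => map_add f g⟩

end LocalizationPreadditive

namespace DGAlgebra
variable {k : Type u} [Field k]
namespace LeftModule
variable {A : DGAlgebra k} {M N P : A.LeftModule}

instance : HasZeroObject A.LeftModule := ⟨
  { cx := HomologicalComplex.zero
    act := fun _ => 0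
    act_one := by
      rw [HomologicalComplex.isZero_zero.eq_of_src (𝟙 _) 0, Cochain.ofHom_zero]
      rfl
    act_mul := by simp
    δ_act := by simp },
  { unique_to := fun M => ⟨⟨⟨0⟩, fun f => hom_ext (HomologicalComplex.isZero_zero.eq_of_src _ _)⟩⟩
    unique_from := fun M => ⟨⟨⟨0⟩, fun f => hom_ext (HomologicalComplex.isZero_zero.eq_of_tgt _ _)⟩⟩ }⟩

noncomputable section

section
variable {K L : CochainComplex (ModuleCat.{u} k) ℤ} {p q r : ℤ}

/-- The diagonal cochain on a direct sum of complexes. -/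
def sumCochain (x : Cochain K K p) (y : Cochain L L p) : Cochain (K ⊞ L) (K ⊞ L) p :=
  (Cochain.ofHom biprod.fst).comp (x.comp (Cochain.ofHom biprod.inl) (add_zero p)) (zero_add p) +
    (Cochain.ofHom biprod.snd).comp (y.comp (Cochain.ofHom biprod.inr) (add_zero p)) (zero_add p)

lemma sumCochain_v (x : Cochain K K p) (y : Cochain L L p) (i j : ℤ) (h : i + p = j) :
    (sumCochain x y).v i j h = (biprod.fst : K ⊞ L ⟶ K).f i ≫ x.v i j h ≫ (biprod.inl : K ⟶ K ⊞ L).f j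
      + (biprod.snd : K ⊞ L ⟶ L).f i ≫ y.v i j h ≫ (biprod.inr : L ⟶ K ⊞ L).f j := by
  simp [sumCochain]

@[simp] lemma inl_sumCochain (x : Cochain K K p) (y : Cochain L L p) :
    (Cochain.ofHom biprod.inl).comp (sumCochain x y) (zero_add p) =
      x.comp (Cochain.ofHom biprod.inl) (add_zero p) := by
  rw [sumCochain, Cochain.comp_add, ← Cochain.comp_assoc_of_first_is_zero_cochain,
    ← Cochain.comp_assoc_of_first_is_zero_cochain, ← Cochain.comp_assoc_of_first_is_zero_cochain,
    ← Cochain.comp_assoc_of_first_is_zero_cochain, ← Cochain.ofHom_comp, ← Cochain.ofHom_comp]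
  simp

@[simp] lemma inr_sumCochain (x : Cochain K K p) (y : Cochain L L p) :
    (Cochain.ofHom biprod.inr).comp (sumCochain x y) (zero_add p) =
      y.comp (Cochain.ofHom biprod.inr) (add_zero p) := by
  rw [sumCochain, Cochain.comp_add, ← Cochain.comp_assoc_of_first_is_zero_cochain,
    ← Cochain.comp_assoc_of_first_is_zero_cochain, ← Cochain.comp_assoc_of_first_is_zero_cochain,
    ← Cochain.comp_assoc_of_first_is_zero_cochain, ← Cochain.ofHom_comp, ← Cochain.ofHom_comp]
  simp

@[simp] lemma sumCochain_fst (x : Cochain K K p) (y : Cochain L L p) :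
    (sumCochain x y).comp (Cochain.ofHom biprod.fst) (add_zero p) =
      (Cochain.ofHom biprod.fst).comp x (zero_add p) := by
  simp [sumCochain, ← Cochain.ofHom_comp]

@[simp] lemma sumCochain_snd (x : Cochain K K p) (y : Cochain L L p) :
    (sumCochain x y).comp (Cochain.ofHom biprod.snd) (add_zero p) =
      (Cochain.ofHom biprod.snd).comp y (zero_add p) := by
  simp [sumCochain, ← Cochain.ofHom_comp]

lemma sumCochain_comp (x : Cochain K K p) (y : Cochain L L p) (x' : Cochain K K q)
    (y' : Cochain L L q) (h : p + q = r) :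
    (sumCochain x y).comp (sumCochain x' y') h = sumCochain (x.comp x' h) (y.comp y' h) := by
  conv_lhs => rw [sumCochain]
  rw [Cochain.add_comp, Cochain.comp_assoc_of_first_is_zero_cochain,
    Cochain.comp_assoc_of_first_is_zero_cochain, Cochain.comp_assoc_of_second_is_zero_cochain,
    Cochain.comp_assoc_of_second_is_zero_cochain, inl_sumCochain, inr_sumCochain,
    ← Cochain.comp_assoc_of_third_is_zero_cochain x,
    ← Cochain.comp_assoc_of_third_is_zero_cochain y]
  rfl

lemma δ_sumCochain (x : Cochain K K p) (y : Cochain L L p) (h : p + 1 = q) :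
    δ p q (sumCochain x y) = sumCochain (δ p q x) (δ p q y) := by
  simp [sumCochain, δ_zero_cochain_comp _ _ _ h, δ_comp_zero_cochain _ _ _ h]

end

/-- The direct sum of two DG modules. -/
def directSum (M N : A.LeftModule) : A.LeftModule where
  cx := M.cx ⊞ N.cx
  act p :=
    { toFun a := sumCochain (M.act p a) (N.act p a)
      map_add' a b := by
        simp [sumCochain]
        abel
      map_smul' c a := by simp [sumCochain] }
  act_one := by
    simp [sumCochain, ← Cochain.ofHom_comp, ← Cochain.ofHom_add, biprod.total]
  act_mul p q n h a b := by
    simp [sumCochain_comp, M.act_mul p q n h, N.act_mul p q n h]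
  δ_act p q h a := by
    simp [δ_sumCochain _ _ h, M.δ_act p q h, N.δ_act p q h]

/-- The direct sum of DG modules, with its inclusions and projections. -/
def directSumBicone (M N : A.LeftModule) : BinaryBicone M N where
  pt := directSum M N
  fst := { hom := biprod.fst, comm := fun _ _ => sumCochain_fst _ _ }
  snd := { hom := biprod.snd, comm := fun _ _ => sumCochain_snd _ _ }
  inl := { hom := biprod.inl, comm := fun _ _ => (inl_sumCochain _ _).symm }
  inr := { hom := biprod.inr, comm := fun _ _ => (inr_sumCochain _ _).symm }
  inl_fst := hom_ext biprod.inl_fst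
  inl_snd := hom_ext biprod.inl_snd
  inr_fst := hom_ext biprod.inr_fst
  inr_snd := hom_ext biprod.inr_snd

instance : HasBinaryBiproducts A.LeftModule where
  has_binary_biproduct M N :=
    ⟨⟨directSumBicone M N, isBinaryBilimitOfTotal _ (hom_ext biprod.total)⟩⟩

instance : HasFiniteProducts A.LeftModule := hasFiniteProducts_of_has_binary_and_terminal

/-- The quasi-isomorphisms of DG modules. -/
def quasiIso (A : DGAlgebra k) : MorphismProperty A.LeftModule :=
  (HomologicalComplex.quasiIso (ModuleCat.{u} k) (ComplexShape.up ℤ)).inverseImage (forget A)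

instance : (quasiIso A).IsMultiplicative := by
  unfold quasiIso
  infer_instance

instance : (quasiIso A).IsCompatibleWithShift ℤ where
  condition n := by
    ext M N f
    exact MorphismProperty.IsCompatibleWithShift.iff
      (HomologicalComplex.quasiIso (ModuleCat.{u} k) (ComplexShape.up ℤ)) f.hom n

instance : (quasiIso A).IsStableUnderFiniteProducts where
  isStableUnderProductsOfShape J _ :=
    ⟨fun X₁ X₂ c₁ c₂ h₁ h₂ f hf α hα => by
      dsimp only [quasiIso, MorphismProperty.inverseImage]
      rw [HomologicalComplex.mem_quasiIso_iff, quasiIso_iff]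
      intro i
      rw [quasiIsoAt_iff_isIso_homologyMap]
      let F := forget A ⋙ HomologicalComplex.homologyFunctor (ModuleCat.{u} k) _ i
      have : F.Additive := inferInstance
      have : PreservesFiniteProducts F := inferInstance
      have : PreservesLimitsOfShape (Discrete J) F := inferInstance
      have : (MorphismProperty.isomorphisms (ModuleCat.{u} k)).IsStableUnderProductsOfShape J :=
        MorphismProperty.IsStableUnderProductsOfShape.mk _ _ fun _ _ _ _ f hf => by
          have (j : J) : IsIso (f j) := hf j
          exact inferInstanceAs (IsIso (Limits.Pi.map f))
      have := MorphismProperty.IsStableUnderLimitsOfShape.condition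
        (W := MorphismProperty.isomorphisms (ModuleCat.{u} k)) (X₁ ⋙ F) (X₂ ⋙ F) (F.mapCone c₁)
        (F.mapCone c₂) (isLimitOfPreserves F h₁) (isLimitOfPreserves F h₂)
        (Functor.whiskerRight f F) (fun j => by
          have := hf j
          dsimp only [quasiIso, MorphismProperty.inverseImage] at this
          rw [HomologicalComplex.mem_quasiIso_iff, quasiIso_iff] at this
          exact (quasiIsoAt_iff_isIso_homologyMap _ _).1 (this i)) (F.map α) (fun j => by
          exact (F.map_comp _ _).symm.trans ((congrArg F.map (hα j)).trans (F.map_comp _ _)))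
      exact this⟩


section
variable {K L : CochainComplex (ModuleCat.{u} k) ℤ} {φ : K ⟶ L} {p q r : ℤ}

/-- The cochain on the mapping cone of `φ : K ⟶ L` which is `(-1) ^ p x` on `K⟦1⟧` and `y` on
`L`. -/
def coneCochain (φ : K ⟶ L) (x : Cochain K K p) (y : Cochain L L p) :
    Cochain (mappingCone φ) (mappingCone φ) p :=
  mappingCone.descCochain φ
    (p.negOnePow • x.comp (mappingCone.inl φ) (sub_eq_add_neg p 1).symm)
    (y.comp (Cochain.ofHom (mappingCone.inr φ)) (add_zero p)) (sub_add_cancel p 1)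

lemma inl_coneCochain (x : Cochain K K p) (y : Cochain L L p) (h : -1 + p = q) :
    (mappingCone.inl φ).comp (coneCochain φ x y) h =
      p.negOnePow • x.comp (mappingCone.inl φ) ((add_comm p (-1)).trans h) := by
  obtain rfl : p - 1 = q := by lia
  exact mappingCone.inl_descCochain _ _ _ _

lemma inr_coneCochain (x : Cochain K K p) (y : Cochain L L p) :
    (Cochain.ofHom (mappingCone.inr φ)).comp (coneCochain φ x y) (zero_add p) =
      y.comp (Cochain.ofHom (mappingCone.inr φ)) (add_zero p) :=
  mappingCone.inr_descCochain _ _ _ _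

lemma cone_ext {K' : CochainComplex (ModuleCat.{u} k) ℤ} {z z' : Cochain (mappingCone φ) K' p}
    (h₁ : (mappingCone.inl φ).comp z (add_comm (-1) p) =
      (mappingCone.inl φ).comp z' (add_comm (-1) p))
    (h₂ : (Cochain.ofHom (mappingCone.inr φ)).comp z (zero_add p) =
      (Cochain.ofHom (mappingCone.inr φ)).comp z' (zero_add p)) : z = z' :=
  (mappingCone.ext_cochain_from_iff φ (p + -1) p (by lia)).2 ⟨h₁, h₂⟩

lemma coneCochain_id : coneCochain φ (Cochain.ofHom (𝟙 K)) (Cochain.ofHom (𝟙 L)) =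
    Cochain.ofHom (𝟙 _) := by
  apply cone_ext
  · rw [inl_coneCochain]
    simp
  · rw [inr_coneCochain]
    simp

lemma coneCochain_comp (x : Cochain K K p) (y : Cochain L L p) (x' : Cochain K K q)
    (y' : Cochain L L q) (h : p + q = r) :
    (coneCochain φ x y).comp (coneCochain φ x' y') h =
      coneCochain φ (x.comp x' h) (y.comp y' h) := by
  subst h
  apply cone_ext
  · rw [inl_coneCochain, ← Cochain.comp_assoc _ _ _ (show -1 + p = p - 1 by lia) _ (by lia),
      inl_coneCochain, Cochain.units_smul_comp,
      Cochain.comp_assoc _ _ _ _ (show -1 + q = q - 1 by lia) (by lia), inl_coneCochain,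
      Cochain.comp_units_smul, smul_smul, ← Int.negOnePow_add, Cochain.comp_assoc _ _ _ _ _ (by lia)]
  · rw [inr_coneCochain, ← Cochain.comp_assoc_of_first_is_zero_cochain, inr_coneCochain,
      Cochain.comp_assoc_of_second_is_zero_cochain, inr_coneCochain,
      Cochain.comp_assoc_of_third_is_zero_cochain]

lemma δ_coneCochain {x : Cochain K K p} {y : Cochain L L p}
    (e : x.comp (Cochain.ofHom φ) (add_zero p) = (Cochain.ofHom φ).comp y (zero_add p))
    (h : p + 1 = q) :
    δ p q (coneCochain φ x y) = coneCochain φ (δ p q x) (δ p q y) := by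
  have e' : x.comp ((Cochain.ofHom φ).comp (Cochain.ofHom (mappingCone.inr φ)) (add_zero 0))
      (add_zero p) = (Cochain.ofHom φ).comp (y.comp (Cochain.ofHom (mappingCone.inr φ))
        (add_zero p)) (zero_add p) := by
    rw [← Cochain.comp_assoc_of_first_is_zero_cochain, ← e,
      Cochain.comp_assoc_of_third_is_zero_cochain]
  subst h
  rw [coneCochain, mappingCone.δ_descCochain _ _ _ _ _ rfl, δ_units_smul,
    δ_comp x (mappingCone.inl φ) _ (p + 1) 0 p (by lia) rfl (by lia),
    δ_comp_zero_cochain _ _ _ rfl, mappingCone.δ_inl, Cochain.ofHom_comp, e', δ_ofHom]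
  refine (mappingCone.ext_cochain_from_iff φ p (p + 1) rfl).2 ⟨?_, ?_⟩
  · rw [inl_coneCochain]
    generalize (δ p (p + 1) x).comp (mappingCone.inl φ) _ = z
    simp [Int.negOnePow_succ]
  · rw [inr_coneCochain]
    simp

/-- The third morphism of the standard triangle of complexes attached to `φ`. -/
def coneProj (φ : K ⟶ L) : mappingCone φ ⟶ K⟦(1 : ℤ)⟧ := (mappingCone.triangle φ).mor₃

lemma inr_coneProj (φ : K ⟶ L) : mappingCone.inr φ ≫ coneProj φ = 0 :=
  mappingCone.inr_triangleδ φ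

lemma inl_v_coneProj (φ : K ⟶ L) (i j : ℤ) (h : i + (-1) = j) :
    (mappingCone.inl φ).v i j h ≫ (coneProj φ).f j =
      -(K.XIsoOfEq (show i = j + 1 by lia)).hom := by
  refine (mappingCone.inl_v_triangle_mor₃_f φ i j h).trans ?_
  rfl

lemma coneCochain_proj (x : Cochain K K p) (y : Cochain L L p) :
    (coneCochain φ x y).comp (Cochain.ofHom (coneProj φ)) (add_zero p) =
      (Cochain.ofHom (coneProj φ)).comp
        (((1 : ℤ) * p).negOnePow • x.shift 1) (zero_add p) := by
  apply cone_ext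
  · rw [← Cochain.comp_assoc_of_third_is_zero_cochain, inl_coneCochain]
    refine Cochain.ext _ _ fun i j h => ?_
    rw [Cochain.comp_zero_cochain_v, Cochain.units_smul_v,
      Cochain.comp_v _ _ _ i (j + 1) j (by lia) (by lia), Cochain.ofHom_v,
      Linear.units_smul_comp, Category.assoc, inl_v_coneProj,
      Cochain.comp_v _ _ _ i (i - 1) j (by lia) (by lia), Cochain.zero_cochain_comp_v,
      Cochain.ofHom_v, ← Category.assoc, inl_v_coneProj, Cochain.units_smul_v,
      _root_.one_mul, Cochain.shift_v']
    have key : p.negOnePow • x.v i (j + 1) (by lia) ≫ (-(K.XIsoOfEq (rfl : j + 1 = j + 1)).hom) =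
        (-(K.XIsoOfEq (show i = i - 1 + 1 by lia)).hom) ≫
          (p.negOnePow • x.v (i - 1 + 1) (j + 1) (by lia)) := by
      rw [Linear.comp_units_smul, Preadditive.comp_neg, Preadditive.neg_comp]
      exact congrArg (fun z => p.negOnePow • (-z)) (v_XIsoOfEq x _ _ _ _ _ _ _)
    exact key
  · rw [← Cochain.comp_assoc_of_third_is_zero_cochain, inr_coneCochain,
      Cochain.comp_assoc_of_third_is_zero_cochain, ← Cochain.comp_assoc_of_first_is_zero_cochain,
      ← Cochain.ofHom_comp, inr_coneProj]
    simp

end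

/-- The mapping cone of a morphism of DG modules. -/
def cone (f : M ⟶ N) : A.LeftModule where
  cx := mappingCone f.hom
  act p :=
    { toFun a := coneCochain f.hom (M.act p a) (N.act p a)
      map_add' a b := by
        apply cone_ext
        · simp [inl_coneCochain]
        · simp [inr_coneCochain]
      map_smul' c a := by
        apply cone_ext
        · simp [inl_coneCochain, smul_comm c]
        · simp [inr_coneCochain] }
  act_one := by simp [coneCochain_id]
  act_mul p q n h a b := by
    simp [coneCochain_comp, M.act_mul p q n h, N.act_mul p q n h]
  δ_act p q h a := by
    simp [δ_coneCochain (f.comm p a) h, M.δ_act p q h, N.δ_act p q h]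

/-- The standard triangle `M ⟶ N ⟶ cone f ⟶ M⟦1⟧` of DG modules. -/
def coneTriangle (f : M ⟶ N) : Pretriangulated.Triangle A.LeftModule where
  obj₁ := M
  obj₂ := N
  obj₃ := cone f
  mor₁ := f
  mor₂ := { hom := mappingCone.inr f.hom, comm := fun _ _ => (inr_coneCochain _ _).symm }
  mor₃ :=
    { hom := coneProj f.hom
      comm := fun p a => coneCochain_proj (M.act p a) (N.act p a) }

end
end LeftModule
end DGAlgebra

namespace DGAlgebra
variable {k : Type u} [Field k]

noncomputable section

/-- The derived category of DG left `A`-modules: the localization of the category of DG modules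
with respect to quasi-isomorphisms. -/
abbrev DerivedCategory (A : DGAlgebra k) := (LeftModule.quasiIso A).Localization

namespace DerivedCategory
variable {A : DGAlgebra k}

/-- The localization functor. -/
abbrev Q : A.LeftModule ⥤ A.DerivedCategory := (LeftModule.quasiIso A).Q

instance : Preadditive A.DerivedCategory :=
  LocalizationPreadditive.preadditive (LeftModule.quasiIso A)

instance : (LeftModule.quasiIso A).Q.Additive :=
  LocalizationPreadditive.additive_Q (LeftModule.quasiIso A)

/-- The distinguished triangles: those isomorphic to the image of a standard triangle. -/
def distinguishedTriangles (A : DGAlgebra k) :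
    Set (Pretriangulated.Triangle A.DerivedCategory) :=
  {T | ∃ (M N : A.LeftModule) (f : M ⟶ N),
    Nonempty (T ≅ Q.mapTriangle.obj (LeftModule.coneTriangle f))}

/-- Thick subcategories: full triangulated subcategories, closed under isomorphisms and direct
summands. -/
structure IsThick (P : ObjectProperty A.DerivedCategory) : Prop where
  of_iso : ∀ {X Y : A.DerivedCategory}, (X ≅ Y) → P X → P Y
  shift : ∀ (X : A.DerivedCategory) (n : ℤ), P X → P (X⟦n⟧)
  obj₁ : ∀ T ∈ distinguishedTriangles A, P T.obj₂ → P T.obj₃ → P T.obj₁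
  obj₂ : ∀ T ∈ distinguishedTriangles A, P T.obj₁ → P T.obj₃ → P T.obj₂
  obj₃ : ∀ T ∈ distinguishedTriangles A, P T.obj₁ → P T.obj₂ → P T.obj₃
  of_retract : ∀ {X Y : A.DerivedCategory}, Retract X Y → P Y → P X

/-- The thick subcategory generated by an object. -/
def thick (X₀ : A.DerivedCategory) : ObjectProperty A.DerivedCategory :=
  fun X => ∀ P : ObjectProperty A.DerivedCategory, IsThick P → P X₀ → P X

instance (X₀ : A.DerivedCategory) : (thick X₀).IsStableUnderShift ℤ where
  isStableUnderShiftBy n := ⟨fun X hX P hP h₀ => hP.shift X n (hX P hP h₀)⟩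

end DerivedCategory

open Polynomial

section
variable (k) (d : ℤ)

/-- The polynomials of cohomological degree `n` when `X` has homological degree `d`, that is
cohomological degree `-d`. -/
def polynomialPart (n : ℤ) : Submodule k k[X] where
  carrier := {f | ∀ j : ℕ, f.coeff j ≠ 0 → (j : ℤ) * d = -n}
  zero_mem' := by simp
  add_mem' {f g} hf hg j hj := by
    by_cases h : f.coeff j = 0
    · exact hg j (fun h' => hj (by simp [h, h']))
    · exact hf j h
  smul_mem' c f hf j hj := hf j (fun h => hj (by simp [h]))

lemma polynomialPart_mul {p q n : ℤ} (h : p + q = n) {f g : k[X]}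
    (hf : f ∈ polynomialPart k d p) (hg : g ∈ polynomialPart k d q) :
    f * g ∈ polynomialPart k d n := by
  intro j hj
  rw [coeff_mul] at hj
  obtain ⟨⟨a, b⟩, hab, hne⟩ := Finset.exists_ne_zero_of_sum_ne_zero hj
  have h₁ := hf a (left_ne_zero_of_mul hne)
  have h₂ := hg b (right_ne_zero_of_mul hne)
  rw [← Finset.HasAntidiagonal.mem_antidiagonal.1 hab]
  push_cast
  rw [add_mul, h₁, h₂]
  lia

/-- The polynomial ring in one variable of homological degree `d`, as a DG algebra with zero
differential. -/
def polynomial : DGAlgebra k where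
  cx :=
    { X n := ModuleCat.of k (polynomialPart k d n)
      d _ _ := 0 }
  mul p q n h := LinearMap.mk₂ k (fun f g => ⟨f.1 * g.1, polynomialPart_mul k d h f.2 g.2⟩)
    (fun _ _ _ => Subtype.ext (add_mul _ _ _)) (fun _ _ _ => Subtype.ext (smul_mul_assoc _ _ _))
    (fun _ _ _ => Subtype.ext (mul_add _ _ _)) (fun _ _ _ => Subtype.ext (mul_smul_comm _ _ _))
  one := ⟨1, fun j hj => by
    rw [coeff_one] at hj
    have : j = 0 := by
      by_contra h
      simp [h] at hj
    simp [this]⟩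
  one_mul p a := Subtype.ext (_root_.one_mul _)
  mul_one p a := Subtype.ext (_root_.mul_one _)
  mul_assoc _ _ _ _ _ _ _ _ _ _ a b c := Subtype.ext (_root_.mul_assoc _ _ _)
  leibniz p q _ p' q' n' _ _ _ h₁ h₂ a b := by
    refine Subtype.ext ?_
    have h : (0 : k[X]) = 0 * b.1 + p.negOnePow • (a.1 * 0) := by simp
    exact h

/-- The degree `n` part of `k` in degree `0`. -/
def residuePart (n : ℤ) : Submodule k k where
  carrier := {x | n ≠ 0 → x = 0}
  zero_mem' := by simp
  add_mem' {x y} hx hy h := by simp [hx h, hy h]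
  smul_mem' c x hx h := by simp [hx h]

lemma residuePart_mul {p q n : ℤ} (h : q + p = n) {f : k[X]} {x : k}
    (hf : f ∈ polynomialPart k d p) (hx : x ∈ residuePart k q) :
    f.coeff 0 * x ∈ residuePart k n := by
  intro hn
  by_cases h₁ : f.coeff 0 = 0
  · simp [h₁]
  · have := hf 0 h₁
    simp [hx (show q ≠ 0 by lia)]

/-- A polynomial acts on `k` through its constant coefficient. -/
def residueAct (p q n : ℤ) (h : q + p = n) (f : polynomialPart k d p) :
    residuePart k q →ₗ[k] residuePart k n where
  toFun x := ⟨f.1.coeff 0 * x.1, residuePart_mul k d h f.2 x.2⟩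
  map_add' _ _ := Subtype.ext (mul_add _ _ _)
  map_smul' _ _ := Subtype.ext (mul_smul_comm _ _ _)

/-- The complex `k` concentrated in degree `0`. -/
def residueComplex : CochainComplex (ModuleCat.{u} k) ℤ where
  X n := ModuleCat.of k (residuePart k n)
  d _ _ := 0

/-- The action of the polynomials of degree `p` on `k`. -/
def residueActLinear (p : ℤ) :
    polynomialPart k d p →ₗ[k] Cochain (residueComplex k) (residueComplex k) p where
  toFun f := Cochain.mk fun q n h => ModuleCat.ofHom (residueAct k d p q n h f)
  map_add' f g := by
    refine Cochain.ext _ _ fun q n h => ?_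
    refine ModuleCat.hom_ext (LinearMap.ext fun x => Subtype.ext ?_)
    exact (congrArg (· * x.1) (coeff_add f.1 g.1 0)).trans (add_mul _ _ _)
  map_smul' c f := by
    refine Cochain.ext _ _ fun q n h => ?_
    refine ModuleCat.hom_ext (LinearMap.ext fun x => Subtype.ext ?_)
    exact (congrArg (· * x.1) (coeff_smul c f.1 0)).trans (smul_mul_assoc _ _ _)

lemma δ_residueComplex (p q : ℤ) (z : Cochain (residueComplex k) (residueComplex k) p) :
    δ p q z = 0 := by
  by_cases h : p + 1 = q
  · refine Cochain.ext _ _ fun i j hij => ?_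
    rw [δ_v p q h z i j hij (j - 1) (i + 1) rfl rfl]
    simp only [residueComplex, Limits.comp_zero, Limits.zero_comp]
    exact (zero_add _).trans (smul_zero _)
  · exact δ_shape p q h z

/-- The trivial DG module `k`: the quotient of the polynomial DG algebra by its variable. -/
def residueModule : (polynomial k d).LeftModule where
  cx := residueComplex k
  act p := residueActLinear k d p
  act_one := by
    refine Cochain.ext₀ _ _ fun q => ?_
    refine ModuleCat.hom_ext (LinearMap.ext fun x => Subtype.ext ?_)
    exact (congrArg (· * x.1) coeff_one_zero).trans (_root_.one_mul _)
  act_mul p q r h f g := by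
    refine Cochain.ext _ _ fun i j hij => ?_
    rw [Cochain.comp_v _ _ _ i (i + q) j rfl (by lia)]
    refine ModuleCat.hom_ext (LinearMap.ext fun x => Subtype.ext ?_)
    exact (congrArg (· * x.1) (mul_coeff_zero f.1 g.1)).trans (_root_.mul_assoc _ _ _)
  δ_act p p' _ f :=
    (δ_residueComplex k p p' _).trans (map_zero (residueActLinear k d p')).symm

end

end

end DGAlgebra

/-- `S` is a Serre functor of the `k`-linear category `C`: a `k`-linear autoequivalence with
isomorphisms from `Hom (X, Y)` to the `k`-dual of `Hom (Y, S X)` which are natural in `X` and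
`Y`. -/
structure IsSerreFunctor (k : Type*) [Field k] {C : Type*} [Category C] [Preadditive C]
    [Linear k C] (S : C ⥤ C) : Prop where
  isEquivalence : S.IsEquivalence
  map_add : ∀ {X Y : C} (f g : X ⟶ Y), S.map (f + g) = S.map f + S.map g
  map_smul : ∀ {X Y : C} (r : k) (f : X ⟶ Y), S.map (r • f) = r • S.map f
  duality : ∃ η : ∀ X Y : C, (X ⟶ Y) ≃ₗ[k] Module.Dual k (Y ⟶ S.obj X),
    (∀ (X Y Y' : C) (f : X ⟶ Y) (g : Y ⟶ Y') (φ : Y' ⟶ S.obj X),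
      η X Y' (f ≫ g) φ = η X Y f (g ≫ φ)) ∧
    (∀ (X X' Y : C) (h : X' ⟶ X) (f : X ⟶ Y) (φ : Y ⟶ S.obj X'),
      η X' Y (h ≫ f) φ = η X Y f (φ ≫ S.map h))

/-- The category generated by a `w`-spherical object: the thick subcategory generated by `k` of the
derived category of the polynomial DG algebra on a variable of homological degree `w - 1`. -/
abbrev SphericalCategory (k : Type u) [Field k] (w : ℤ) :=
  (DGAlgebra.DerivedCategory.thick
    (DGAlgebra.DerivedCategory.Q.obj (DGAlgebra.residueModule k (w - 1)))).FullSubcategory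

end

section

open CategoryTheory CochainComplex CochainComplex.HomComplex Limits

universe u v

/-! Put `e = 1 - w`, the cohomological degree of `T`. Since `k[T]` is free on one generator, a DG
module over it is the same thing as a complex `M` of vector spaces with a degree `e` cocycle `τ` in
its endomorphism complex. Freeness also makes derived morphisms small. The two-term resolution of
`M` by the modules `A ⊗ M` suggests that `RHom(M, N)` is a shifted cone of the graded commutator `ad
: z ↦ [z, τ]` on the complex `Hom_k(M, N)`. A morphism in the derived category is thus the homotopy
class of a pair `(f, s)`, where `f` is a chain map and `s` is a degree `e - 1` cochain with `δ s =
ad f`. No higher homotopies occur. The category of such pairs up to homotopy is `HoCat`.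

The derived category embeds in `HoCat` fully faithfully (`derivedToHo`). Quasi-isomorphisms become
invertible because over a field they are homotopy equivalences, and a homotopy inverse can be
completed by a suitable `s`. Fullness comes from a mapping cylinder construction: the cone of a pair
`(f, s)` is an honest DG module, with `s` as an off-diagonal entry of `τ`, so every pair is a strict
map followed by the inverse of a strict quasi-isomorphism (`ho_map_roofInl`, `quasiIso_roofInr`).
Faithfulness rests on `Q_map_eq_zero_of_isNull`.

Objects of the thick subcategory generated by `k` have finite dimensional total cohomology, and each
is isomorphic in `HoCat` to its cohomology with zero differential and a transferred `τ`. Between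
such minimal objects `V`, `W`, a pair consists of an `f` in the kernel of `ad` in degree `0` and an
`s`, which matters only modulo the image of `ad` from degree `-1`. The supertrace pairing makes `ad`
adjoint to itself up to sign, so kernels of `ad` are dual to cokernels of `ad`. This exchanges the
two components, and the duality lands in the suspension by `w` because `(e - 1) + w = 0`.
Concretely, `homTrace` takes the supertrace of the `s`-component of a morphism `V ⟶ Σ^w V`. It is
cyclic (`homTrace_comm`) and nondegenerate (`exists_homTrace_ne_zero`), which is what Serre duality
requires.

For uniqueness, `k` lives in a single degree and the two components have degrees `0` and `e - 1 =
-w`, so a nonzero map from `k` to `Σ^i k` forces `i = 0` or `i = w`. If `Σ^0` were a Serre functor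
as well, duality would turn a nonzero map `k ⟶ Σ^w k` into a nonzero map `Σ^w k ⟶ Σ^0 k`, which
forces `w = 0`. -/

/-- A cochain complex with an endomorphism of degree `e` which commutes with the differential. -/
structure TwistedComplex (k : Type u) [Field k] (e : ℤ) where
  cx : CochainComplex (ModuleCat.{u} k) ℤ
  τ : Cochain cx cx e
  δ_τ : ∀ m : ℤ, δ e m τ = 0

/-! ### Complexes with an endomorphism, morphisms up to homotopy -/

namespace TwistedComplex

variable {k : Type u} [Field k] {e : ℤ} {X Y Z : TwistedComplex k e}

lemma assoc {K L M N : CochainComplex (ModuleCat.{u} k) ℤ} {a b c ab bc abc : ℤ}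
    (x : Cochain K L a) (y : Cochain L M b) (z : Cochain M N c) (h : a + b = ab) (h' : b + c = bc)
    (h₁ : ab + c = abc) (h₂ : a + bc = abc) :
    (x.comp y h).comp z h₁ = x.comp (y.comp z h') h₂ :=
  Cochain.comp_assoc x y z h h' (by lia)

/-- The graded commutator of a cochain with the given endomorphisms of its source and target. -/
def ad (X Y : TwistedComplex k e) (n m : ℤ) (h : n + e = m) (z : Cochain X.cx Y.cx n) :
    Cochain X.cx Y.cx m :=
  z.comp Y.τ h - (n * e).negOnePow • X.τ.comp z ((add_comm e n).trans h)

section ad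

variable {n m : ℤ} (h : n + e = m)

@[simp] lemma ad_zero : ad X Y n m h 0 = 0 := by simp [ad]
@[simp] lemma ad_add (z z' : Cochain X.cx Y.cx n) :
    ad X Y n m h (z + z') = ad X Y n m h z + ad X Y n m h z' := by simp [ad]; abel
@[simp] lemma ad_neg (z : Cochain X.cx Y.cx n) :
    ad X Y n m h (-z) = -ad X Y n m h z := by simp [ad]; abel
@[simp] lemma ad_sub (z z' : Cochain X.cx Y.cx n) :
    ad X Y n m h (z - z') = ad X Y n m h z - ad X Y n m h z' := by simp [ad, smul_sub]; abel
@[simp] lemma ad_smul (r : k) (z : Cochain X.cx Y.cx n) :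
    ad X Y n m h (r • z) = r • ad X Y n m h z := by simp [ad, smul_sub, smul_comm r]
@[simp] lemma ad_units_smul (r : ℤˣ) (z : Cochain X.cx Y.cx n) :
    ad X Y n m h (r • z) = r • ad X Y n m h z := by simp [ad, smul_sub, smul_comm r]

@[simp] lemma ad_id (h : 0 + e = m) : ad X X 0 m h (Cochain.ofHom (𝟙 X.cx)) = 0 := by
  obtain rfl : e = m := by lia
  simp [ad]

/-- The graded commutator is a derivation for composition. The sign sits on the first factor because
composition is diagrammatic: `τ` enters from the right and moves past `y`. -/
lemma ad_comp {n₁ n₂ m₂ m₁ : ℤ} (x : Cochain X.cx Y.cx n₁) (y : Cochain Y.cx Z.cx n₂)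
    (h₁₂ : n₁ + n₂ = n) (h₁ : n₁ + e = m₁) (h₂ : n₂ + e = m₂) :
    ad X Z n m h (x.comp y h₁₂) = x.comp (ad Y Z n₂ m₂ h₂ y) (by lia) +
      (n₂ * e).negOnePow • (ad X Y n₁ m₁ h₁ x).comp y (by lia) := by
  simp only [ad, Cochain.comp_sub, Cochain.sub_comp, smul_sub, Cochain.comp_units_smul,
    Cochain.units_smul_comp, smul_smul, ← Int.negOnePow_add]
  rw [assoc x y Z.τ h₁₂ h₂ h (by lia),
    assoc x Y.τ y h₁ ((add_comm e n₂).trans h₂) (by lia) (by lia),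
    assoc X.τ x y ((add_comm e n₁).trans h₁) h₁₂ (by lia) (by lia), ← add_mul, add_comm n₂ n₁, h₁₂]
  abel

/-- Because the `τ`'s are cocycles, `ad` is a chain map up to the sign `(-1) ^ e`. This is what
makes a pair (chain map, homotopy) a cocycle of a cone, and it dictates the sign in `IsNull`. -/
lemma δ_ad {n' m' : ℤ} (z : Cochain X.cx Y.cx n) (hn : n + 1 = n') (h' : n' + e = m') :
    δ m m' (ad X Y n m h z) = e.negOnePow • ad X Y n' m' h' (δ n n' z) := by
  subst hn h
  have hm : n + e + 1 = m' := by lia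
  simp only [ad, δ_sub, δ_units_smul]
  rw [δ_comp z Y.τ _ (n + 1) (e + 1) m' hm rfl rfl, δ_comp X.τ z _ (e + 1) (n + 1) m' hm rfl rfl,
    δ_τ, δ_τ]
  have key : (n * e).negOnePow = (e + (n + 1) * e).negOnePow := by
    rw [show e + (n + 1) * e = n * e + 2 * e by ring, Int.negOnePow_add _ (2 * e),
      Int.negOnePow_two_mul, mul_one]
  simp only [Cochain.comp_zero, Cochain.zero_comp, zero_add, smul_zero, add_zero, smul_sub,
    smul_smul, ← Int.negOnePow_add, key]

end ad

/-- A morphism of complexes together with a homotopy witnessing its compatibility with the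
endomorphisms. -/
@[ext]
structure Hom (X Y : TwistedComplex k e) where
  hom : X.cx ⟶ Y.cx
  htpy : Cochain X.cx Y.cx (e - 1)
  δ_htpy : δ (e - 1) e htpy = ad X Y 0 e (zero_add e) (Cochain.ofHom hom)

instance : Category (TwistedComplex k e) where
  Hom := Hom
  id X := { hom := 𝟙 _, htpy := 0, δ_htpy := by simp }
  comp f g :=
    { hom := f.hom ≫ g.hom
      htpy := (Cochain.ofHom f.hom).comp g.htpy (zero_add _) +
        f.htpy.comp (Cochain.ofHom g.hom) (add_zero _)
      δ_htpy := by
        rw [Cochain.ofHom_comp, ad_comp _ _ _ _ (zero_add e) (zero_add e), ← f.δ_htpy, ← g.δ_htpy,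
          δ_add, δ_ofHom_comp, δ_comp_ofHom]
        simp }
  id_comp f := by ext1 <;> simp
  comp_id f := by ext1 <;> simp
  assoc f g h := by
    ext1
    · simp
    · simp only [Cochain.ofHom_comp, Cochain.comp_add, Cochain.add_comp]
      simp [add_assoc]

@[ext]
lemma hom_ext {f g : X ⟶ Y} (h₁ : f.hom = g.hom) (h₂ : f.htpy = g.htpy) : f = g := Hom.ext h₁ h₂

@[simp] lemma id_hom : Hom.hom (𝟙 X) = 𝟙 X.cx := rfl
@[simp] lemma id_htpy : Hom.htpy (𝟙 X) = 0 := rfl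
@[simp] lemma comp_hom (f : X ⟶ Y) (g : Y ⟶ Z) : (f ≫ g).hom = f.hom ≫ g.hom := rfl
@[simp] lemma comp_htpy (f : X ⟶ Y) (g : Y ⟶ Z) :
    (f ≫ g).htpy = (Cochain.ofHom f.hom).comp g.htpy (zero_add _) +
      f.htpy.comp (Cochain.ofHom g.hom) (add_zero _) := rfl

/-- The two components of a morphism. -/
def Hom.pair (f : X ⟶ Y) : (X.cx ⟶ Y.cx) × Cochain X.cx Y.cx (e - 1) := (f.hom, f.htpy)

lemma pair_injective : Function.Injective (Hom.pair (X := X) (Y := Y)) := fun _ _ h =>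
  hom_ext (congrArg Prod.fst h) (congrArg Prod.snd h)

lemma ofHom_smul (r : k) {K L : CochainComplex (ModuleCat.{u} k) ℤ} (f : K ⟶ L) :
    Cochain.ofHom (r • f) = r • Cochain.ofHom f := by
  ext p
  simp

instance : Zero (X ⟶ Y) := ⟨{ hom := 0, htpy := 0, δ_htpy := by simp }⟩
instance : Add (X ⟶ Y) :=
  ⟨fun f g =>
    { hom := f.hom + g.hom
      htpy := f.htpy + g.htpy
      δ_htpy := by simp [f.δ_htpy, g.δ_htpy] }⟩
instance : Neg (X ⟶ Y) :=
  ⟨fun f => { hom := -f.hom, htpy := -f.htpy, δ_htpy := by simp [f.δ_htpy] }⟩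
instance : Sub (X ⟶ Y) :=
  ⟨fun f g =>
    { hom := f.hom - g.hom
      htpy := f.htpy - g.htpy
      δ_htpy := by simp [f.δ_htpy, g.δ_htpy] }⟩
instance : SMul k (X ⟶ Y) :=
  ⟨fun r f => { hom := r • f.hom, htpy := r • f.htpy, δ_htpy := by simp [ofHom_smul, f.δ_htpy] }⟩
instance : SMul ℕ (X ⟶ Y) where
  smul r f :=
    { hom := r • f.hom
      htpy := r • f.htpy
      δ_htpy := by
        rw [← Nat.cast_smul_eq_nsmul k, ← Nat.cast_smul_eq_nsmul k]
        simp [ofHom_smul, f.δ_htpy] }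
instance : SMul ℤ (X ⟶ Y) where
  smul r f :=
    { hom := r • f.hom
      htpy := r • f.htpy
      δ_htpy := by
        rw [← Int.cast_smul_eq_zsmul k, ← Int.cast_smul_eq_zsmul k]
        simp [ofHom_smul, f.δ_htpy] }

instance : AddCommGroup (X ⟶ Y) :=
  pair_injective.addCommGroup _ rfl (fun _ _ => rfl) (fun _ => rfl)
    (fun _ _ => rfl) (fun _ _ => rfl) (fun _ _ => rfl)

@[simp] lemma zero_hom : (0 : X ⟶ Y).hom = 0 := rfl
@[simp] lemma zero_htpy : (0 : X ⟶ Y).htpy = 0 := rfl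
@[simp] lemma add_hom (f g : X ⟶ Y) : (f + g).hom = f.hom + g.hom := rfl
@[simp] lemma add_htpy (f g : X ⟶ Y) : (f + g).htpy = f.htpy + g.htpy := rfl
@[simp] lemma neg_hom (f : X ⟶ Y) : (-f).hom = -f.hom := rfl
@[simp] lemma neg_htpy (f : X ⟶ Y) : (-f).htpy = -f.htpy := rfl
@[simp] lemma sub_hom (f g : X ⟶ Y) : (f - g).hom = f.hom - g.hom := rfl
@[simp] lemma sub_htpy (f g : X ⟶ Y) : (f - g).htpy = f.htpy - g.htpy := rfl
@[simp] lemma smul_hom (r : k) (f : X ⟶ Y) : (r • f).hom = r • f.hom := rfl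
@[simp] lemma smul_htpy (r : k) (f : X ⟶ Y) : (r • f).htpy = r • f.htpy := rfl

instance : Preadditive (TwistedComplex k e) where
  add_comp _ _ _ f f' g := by
    ext1
    · simp
    · simp; abel
  comp_add _ _ _ f g g' := by
    ext1
    · simp
    · simp; abel

instance : Module k (X ⟶ Y) :=
  pair_injective.module k
    { toFun := Hom.pair, map_zero' := rfl, map_add' := fun _ _ => rfl } (fun _ _ => rfl)

instance : Linear k (TwistedComplex k e) where
  smul_comp _ _ _ r f g := by ext1 <;> simp [ofHom_smul]
  comp_smul _ _ _ f r g := by ext1 <;> simp [ofHom_smul]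

/-- A morphism is null-homotopic if it is the boundary of a pair of cochains. -/
def IsNull (f : X ⟶ Y) : Prop :=
  ∃ (h : Cochain X.cx Y.cx (-1)) (g : Cochain X.cx Y.cx (e - 2)),
    Cochain.ofHom f.hom = δ (-1) 0 h ∧
      f.htpy = e.negOnePow • ad X Y (-1) (e - 1) (by lia) h + δ (e - 2) (e - 1) g

lemma IsNull.zero : IsNull (0 : X ⟶ Y) := ⟨0, 0, by simp, by simp⟩

lemma IsNull.add {f g : X ⟶ Y} (hf : IsNull f) (hg : IsNull g) : IsNull (f + g) := by
  obtain ⟨h, x, h₁, h₂⟩ := hf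
  obtain ⟨h', x', h₁', h₂'⟩ := hg
  exact ⟨h + h', x + x', by simp [h₁, h₁'], by simp [h₂, h₂']; abel⟩

lemma IsNull.smul (r : k) {f : X ⟶ Y} (hf : IsNull f) : IsNull (r • f) := by
  obtain ⟨h, x, h₁, h₂⟩ := hf
  exact ⟨r • h, r • x, by simp [ofHom_smul, h₁], by simp [h₂, smul_comm r]⟩

lemma IsNull.neg {f : X ⟶ Y} (hf : IsNull f) : IsNull (-f) := by
  obtain ⟨h, x, h₁, h₂⟩ := hf
  exact ⟨-h, -x, by simp [h₁], by simp [h₂]; abel⟩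

lemma negOnePow_smul_smul {M : Type*} [AddCommGroup M] (x : M) :
    e.negOnePow • e.negOnePow • x = x := by
  rw [smul_smul, ← Int.negOnePow_add, ← two_mul, Int.negOnePow_two_mul, one_smul]

lemma IsNull.comp_left (f : X ⟶ Y) {g : Y ⟶ Z} (hg : IsNull g) : IsNull (f ≫ g) := by
  obtain ⟨h, x, h₁, h₂⟩ := hg
  -- The correction `f.htpy.comp h` has boundary `f.htpy · δ h - (δ f.htpy) · h`. The first term is
  -- the `f.htpy · g` of the composite, and the second cancels the term `ad f · h` of the derivation
  -- rule.
  refine ⟨(Cochain.ofHom f.hom).comp h (zero_add _), (Cochain.ofHom f.hom).comp x (zero_add _) +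
    f.htpy.comp h (by lia), ?_, ?_⟩
  · rw [comp_hom, Cochain.ofHom_comp, h₁, δ_ofHom_comp]
  · rw [comp_htpy, h₁, h₂, ad_comp _ _ _ _ (zero_add e) (by lia : -1 + e = e - 1), δ_add,
      δ_ofHom_comp, ← f.δ_htpy, δ_comp f.htpy h _ e 0 (e - 1) (by lia) (by lia) (by lia)]
    simp only [Cochain.comp_add, smul_add, Cochain.comp_units_smul, neg_mul, _root_.one_mul,
      Int.negOnePow_neg, negOnePow_smul_smul, Int.negOnePow_one, Units.neg_smul, one_smul]
    abel

lemma IsNull.comp_right {f : X ⟶ Y} (hf : IsNull f) (g : Y ⟶ Z) : IsNull (f ≫ g) := by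
  obtain ⟨h, x, h₁, h₂⟩ := hf
  refine ⟨h.comp (Cochain.ofHom g.hom) (add_zero _), x.comp (Cochain.ofHom g.hom) (add_zero _) -
    e.negOnePow • h.comp g.htpy (by lia), ?_, ?_⟩
  · rw [comp_hom, Cochain.ofHom_comp, h₁, δ_comp_ofHom]
  · rw [comp_htpy, h₁, h₂, ad_comp _ _ _ _ (by lia : -1 + e = e - 1) (zero_add e), δ_sub,
      δ_comp_ofHom, ← g.δ_htpy, δ_units_smul,
      δ_comp h g.htpy _ 0 e (e - 1) (by lia) (by lia) (by lia)]
    simp only [Cochain.add_comp, smul_add, Cochain.units_smul_comp, zero_mul, Int.negOnePow_zero,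
      Int.negOnePow_sub, Int.negOnePow_one, one_smul, mul_neg, mul_one,
      Units.neg_smul, smul_neg, negOnePow_smul_smul]
    abel

/-- Two morphisms are homotopic if their difference is null-homotopic. -/
def homotopic (k : Type u) [Field k] (e : ℤ) : HomRel (TwistedComplex k e) :=
  fun _ _ f g => IsNull (f - g)

instance : Congruence (homotopic k e) where
  comp_left f g g' h := by
    simpa [homotopic] using IsNull.comp_left f h
  comp_right g h := by
    simpa [homotopic] using IsNull.comp_right h g
  equivalence :=
    { refl f := by simpa [homotopic] using IsNull.zero
      symm h := by simpa [homotopic] using IsNull.neg h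
      trans h h' := by simpa [homotopic] using IsNull.add h h' }

/-- The category of complexes with an endomorphism, with homotopy classes as morphisms. -/
abbrev HoCat (k : Type u) [Field k] (e : ℤ) := CategoryTheory.Quotient (homotopic k e)

instance : Preadditive (HoCat k e) := Quotient.preadditive _ (by
  intro _ _ f₁ f₂ g₁ g₂ h h'
  simpa [homotopic, add_sub_add_comm] using IsNull.add h h')

/-- The functor to homotopy classes. -/
abbrev ho (k : Type u) [Field k] (e : ℤ) : TwistedComplex k e ⥤ HoCat k e :=
  Quotient.functor (homotopic k e)

instance : (ho k e).Additive := Quotient.functor_additive _ _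

instance : Linear k (HoCat k e) := Quotient.linear k _ (by
  intro r _ _ f₁ f₂ h
  simpa [homotopic, smul_sub] using IsNull.smul r h)

instance : (ho k e).Linear k := Quotient.linear_functor k _ _

lemma ho_map_eq_zero_iff (f : X ⟶ Y) : (ho k e).map f = 0 ↔ IsNull f := by
  rw [← (ho k e).map_zero, Quotient.functor_map_eq_iff]
  simp [homotopic]

lemma ho_map_eq_iff (f g : X ⟶ Y) : (ho k e).map f = (ho k e).map g ↔ IsNull (f - g) :=
  Quotient.functor_map_eq_iff _ _ _

end TwistedComplex

/-! ### Homotopy equivalences are invertible; suspensions -/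

namespace TwistedComplex

variable {k : Type u} [Field k] {e : ℤ} {X Y Z : TwistedComplex k e}

/-- Such a morphism is unipotent: homotopies add under composition when the underlying maps are
identities, so changing the sign of the homotopy gives the inverse. -/
lemma isIso_of_hom_eq_id (f : X ⟶ X) (hf : f.hom = 𝟙 _) : IsIso f := by
  have h₀ : δ (e - 1) e f.htpy = 0 := by rw [f.δ_htpy, hf, ad_id]
  refine ⟨{ hom := 𝟙 _, htpy := -f.htpy, δ_htpy := by simp [h₀] }, ?_, ?_⟩ <;>
  · ext1 <;> simp [hf]

/-- Subtracting the null-homotopic morphism defined by `h` makes the underlying map equal to the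
identity, which reduces to the unipotent case. -/
lemma isIso_ho_map_of_homotopic_id (f : X ⟶ X) (h : Cochain X.cx X.cx (-1))
    (hf : Cochain.ofHom f.hom = Cochain.ofHom (𝟙 _) + δ (-1) 0 h) : IsIso ((ho k e).map f) := by
  let f' : X ⟶ X :=
    { hom := 𝟙 _
      htpy := f.htpy - e.negOnePow • ad X X (-1) (e - 1) (by lia) h
      δ_htpy := by
        rw [δ_sub, δ_units_smul, δ_ad _ _ (neg_add_cancel 1) (zero_add e), negOnePow_smul_smul,
          f.δ_htpy, hf]
        simp }
  have : IsIso f' := isIso_of_hom_eq_id f' rfl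
  have h₁ : (ho k e).map f = (ho k e).map f' := by
    rw [ho_map_eq_iff]
    refine ⟨h, 0, ?_, ?_⟩
    · rw [sub_hom, Cochain.ofHom_sub, hf]
      simp [f']
    · simp [f']
  rw [h₁]
  infer_instance

/-- A homotopy inverse of a morphism lifts to a morphism. -/
lemma exists_hom_eq (f : X ⟶ Y) (v : Y.cx ⟶ X.cx) (h : Cochain X.cx X.cx (-1))
    (h' : Cochain Y.cx Y.cx (-1))
    (hv : Cochain.ofHom (f.hom ≫ v) = Cochain.ofHom (𝟙 _) + δ (-1) 0 h)
    (hv' : Cochain.ofHom (v ≫ f.hom) = Cochain.ofHom (𝟙 _) + δ (-1) 0 h') :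
    ∃ g : Y ⟶ X, g.hom = v := by
  have hh : -1 + e = e - 1 := by lia
  -- The derivation rule for `ad (f v) = ad (δ h)` shows that `c` bounds `f · ad v`, so `v · c`
  -- bounds `v · f · ad v`. This is `ad v` up to the error `δ h' · ad v`, which the term in `h'`
  -- below removes.
  let c : Cochain X.cx X.cx (e - 1) := e.negOnePow • ad X X (-1) (e - 1) hh h -
    f.htpy.comp (Cochain.ofHom v) (add_zero _)
  let a := ad Y X 0 e (zero_add e) (Cochain.ofHom v)
  have ha : δ e (e + 1) a = 0 := by
    rw [δ_ad _ _ (zero_add 1) (add_comm 1 e), δ_ofHom, ad_zero, smul_zero]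
  have hc : δ (e - 1) e c = (Cochain.ofHom f.hom).comp a (zero_add _) := by
    have := ad_comp (zero_add e) (Cochain.ofHom f.hom) (Cochain.ofHom v) (add_zero 0) (zero_add e)
      (zero_add e)
    rw [← Cochain.ofHom_comp, hv, ad_add, ad_id, zero_add, zero_mul, Int.negOnePow_zero,
      one_smul, ← f.δ_htpy] at this
    rw [δ_sub, δ_units_smul, δ_ad _ _ (neg_add_cancel 1) (zero_add e), negOnePow_smul_smul, this,
      δ_comp_ofHom]
    simp [a]
  refine ⟨⟨v, (Cochain.ofHom v).comp c (zero_add _) - e.negOnePow • h'.comp a hh, ?_⟩, rfl⟩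
  rw [δ_sub, δ_ofHom_comp, hc, δ_units_smul, δ_comp h' a hh 0 (e + 1) e (by lia) (by lia) rfl, ha,
    ← Cochain.comp_assoc_of_first_is_zero_cochain, ← Cochain.ofHom_comp, hv', smul_add,
    negOnePow_smul_smul, Cochain.add_comp]
  simp [a]

/-- Once the homotopy inverse is lifted to some `g`, both composites have underlying map homotopic
to the identity and are invertible. No control over the homotopy component of `g` is needed. -/
theorem isIso_ho_map (f : X ⟶ Y) (v : Y.cx ⟶ X.cx) (h : Cochain X.cx X.cx (-1))
    (h' : Cochain Y.cx Y.cx (-1))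
    (hv : Cochain.ofHom (f.hom ≫ v) = Cochain.ofHom (𝟙 _) + δ (-1) 0 h)
    (hv' : Cochain.ofHom (v ≫ f.hom) = Cochain.ofHom (𝟙 _) + δ (-1) 0 h') :
    IsIso ((ho k e).map f) := by
  obtain ⟨g, rfl⟩ := exists_hom_eq f v h h' hv hv'
  have h₁ := isIso_ho_map_of_homotopic_id (f ≫ g) h hv
  have h₂ := isIso_ho_map_of_homotopic_id (g ≫ f) h' hv'
  rw [Functor.map_comp] at h₁ h₂
  have : Mono ((ho k e).map f) := mono_of_mono _ ((ho k e).map g)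
  have : IsSplitEpi ((ho k e).map f) :=
    ⟨⟨inv ((ho k e).map g ≫ (ho k e).map f) ≫ (ho k e).map g, by simp [Category.assoc]⟩⟩
  exact isIso_of_mono_of_isSplitEpi _

section shift

lemma ad_shift_aux (n m a : ℤ) (h : n + e = m) (z : Cochain X.cx Y.cx n) :
    (z.shift a).comp ((a * e).negOnePow • Y.τ.shift a) h - (n * e).negOnePow •
      ((a * e).negOnePow • X.τ.shift a).comp (z.shift a) ((add_comm e n).trans h) =
    (a * e).negOnePow • (ad X Y n m h z).shift a := by
  have hsub : (ad X Y n m h z).shift a = (z.comp Y.τ h).shift a - (n * e).negOnePow •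
      (X.τ.comp z ((add_comm e n).trans h)).shift a := by
    rw [ad, sub_eq_add_neg, Cochain.shift_add, Cochain.shift_neg, Cochain.shift_units_smul,
      sub_eq_add_neg]
  rw [hsub, DGAlgebra.LeftModule.shift_comp, DGAlgebra.LeftModule.shift_comp,
    Cochain.comp_units_smul, Cochain.units_smul_comp, smul_sub, smul_comm (n * e).negOnePow]

/-- The suspension of a complex with an endomorphism. -/
abbrev shiftObj (a : ℤ) (X : TwistedComplex k e) : TwistedComplex k e where
  cx := X.cx⟦a⟧
  τ := (a * e).negOnePow • X.τ.shift a
  δ_τ m := by rw [δ_units_smul, Cochain.δ_shift, X.δ_τ]; simp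

lemma ad_shift (n m a : ℤ) (h : n + e = m) (z : Cochain X.cx Y.cx n) :
    ad (shiftObj a X) (shiftObj a Y) n m h (z.shift a) =
      (a * e).negOnePow • (ad X Y n m h z).shift a :=
  ad_shift_aux n m a h z

/-- The suspension of a morphism. -/
abbrev shiftMap (a : ℤ) (f : X ⟶ Y) : shiftObj a X ⟶ shiftObj a Y where
  hom := f.hom⟦a⟧'
  -- The sign attached to degree `e - 1`: together with the `(-1) ^ a` produced by `Cochain.δ_shift`
  -- it gives the sign `(-1) ^ (a e)` carried by the suspended `τ`.
  htpy := (a * (e - 1)).negOnePow • f.htpy.shift a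
  δ_htpy := by
    rw [← DGAlgebra.LeftModule.shift_ofHom, ad_shift, ← f.δ_htpy, δ_units_smul, Cochain.δ_shift,
      smul_smul, ← Int.negOnePow_add]
    congr 2
    ring

lemma shiftMap_add (a : ℤ) (f g : X ⟶ Y) : shiftMap a (f + g) = shiftMap a f + shiftMap a g := by
  apply hom_ext
  · exact Functor.map_add (CategoryTheory.shiftFunctor (CochainComplex (ModuleCat.{u} k) ℤ) a)
  · simp only [shiftMap, add_htpy, Cochain.shift_add, smul_add]

lemma shiftMap_smul (a : ℤ) (r : k) (f : X ⟶ Y) : shiftMap a (r • f) = r • shiftMap a f := by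
  apply hom_ext
  · exact HomologicalComplex.hom_ext _ _ fun i => rfl
  · simp only [shiftMap, smul_htpy, Cochain.shift_smul, smul_comm r]

/-- The suspension functor. -/
def shiftF (k : Type u) [Field k] (e a : ℤ) : TwistedComplex k e ⥤ TwistedComplex k e where
  obj X := shiftObj a X
  map f := shiftMap a f
  map_id X := by
    apply hom_ext
    · exact (CategoryTheory.shiftFunctor _ a).map_id X.cx
    · simp only [id_htpy, Cochain.shift_zero, smul_zero]
  map_comp f g := by
    apply hom_ext
    · exact (CategoryTheory.shiftFunctor _ a).map_comp f.hom g.hom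
    · simp only [shiftMap, comp_htpy, Cochain.shift_add, smul_add,
        DGAlgebra.LeftModule.shift_comp, ← DGAlgebra.LeftModule.shift_ofHom,
        Cochain.comp_units_smul, Cochain.units_smul_comp]

instance (a : ℤ) : (shiftF k e a).Additive := ⟨fun {_ _ f g} => shiftMap_add a f g⟩

lemma IsNull.shiftMap {f : X ⟶ Y} (hf : IsNull f) (a : ℤ) : IsNull (shiftMap a f) := by
  obtain ⟨h, x, h₁, h₂⟩ := hf
  refine ⟨a.negOnePow • h.shift a, (a * e).negOnePow • x.shift a, ?_, ?_⟩
  · rw [← DGAlgebra.LeftModule.shift_ofHom, h₁, δ_units_smul, Cochain.δ_shift,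
      negOnePow_smul_smul]
  · dsimp only
    rw [h₂, δ_units_smul, Cochain.δ_shift, ad_units_smul, ad_shift,
      Cochain.shift_add, Cochain.shift_units_smul, smul_add]
    simp only [smul_smul, ← Int.negOnePow_add]
    congr 2
    · exact (Int.negOnePow_eq_iff _ _).2 ⟨-a, by ring⟩
    · exact (Int.negOnePow_eq_iff _ _).2 ⟨-a, by ring⟩

/-- The suspension functor on homotopy classes. -/
def hoShift (k : Type u) [Field k] (e a : ℤ) : HoCat k e ⥤ HoCat k e :=
  CategoryTheory.Quotient.lift _ (shiftF k e a ⋙ ho k e) (fun X Y f g h => by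
    have h' : IsNull (f - g) := h
    have h'' : IsNull ((shiftF k e a).map (f - g)) := h'.shiftMap a
    rw [Functor.map_sub] at h''
    exact (ho_map_eq_iff _ _).2 h'')

instance (a : ℤ) : (hoShift k e a).Additive where
  map_add {X Y f g} := by
    obtain ⟨f, rfl⟩ := (ho k e).map_surjective f
    obtain ⟨g, rfl⟩ := (ho k e).map_surjective g
    rw [← Functor.map_add]
    exact (congrArg (ho k e).map (shiftMap_add a f g)).trans (Functor.map_add _)

instance (a : ℤ) : (hoShift k e a).Linear k where
  map_smul {X Y} f r := by
    obtain ⟨f, rfl⟩ := (ho k e).map_surjective f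
    rw [← Functor.map_smul]
    exact (congrArg (ho k e).map (shiftMap_smul a r f)).trans (Functor.map_smul _ _ _)

end shift

end TwistedComplex

/-! ### Splitting complexes of vector spaces -/

namespace CochainComplex

variable {k : Type u} [Field k]

lemma exists_generalized_inverse {M N : ModuleCat.{u} k} (f : M ⟶ N) :
    ∃ s : N ⟶ M, f ≫ s ≫ f = f := by
  obtain ⟨g, hg⟩ := f.hom.rangeRestrict.exists_rightInverse_of_surjective
    (LinearMap.range_rangeRestrict _)
  obtain ⟨s, hs⟩ := g.exists_extend
  refine ⟨ModuleCat.ofHom s, ModuleCat.hom_ext (LinearMap.ext fun x => ?_)⟩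
  have h₁ := LinearMap.congr_fun hs (f.hom.rangeRestrict x)
  have h₂ := congrArg Subtype.val (LinearMap.congr_fun hg (f.hom.rangeRestrict x))
  change f.hom (s (f.hom x)) = f.hom x
  change s (f.hom x) = _ at h₁
  rw [h₁]
  exact h₂

lemma exists_section {M N : ModuleCat.{u} k} (f : M ⟶ N) [Epi f] : ∃ s : N ⟶ M, s ≫ f = 𝟙 N := by
  have : Module.Free k N := Module.Free.of_divisionRing k N
  have : Module.Projective k N := Module.Projective.of_free
  obtain ⟨g, hg⟩ := Module.projective_lifting_property f.hom LinearMap.id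
    ((ModuleCat.epi_iff_surjective f).1 inferInstance)
  exact ⟨ModuleCat.ofHom g, ModuleCat.hom_ext hg⟩

variable (K : CochainComplex (ModuleCat.{u} k) ℤ)

/-- The cohomology of a complex, as a complex with zero differential. -/
noncomputable abbrev homologyComplex : CochainComplex (ModuleCat.{u} k) ℤ where
  X n := K.homology n
  d _ _ := 0

/-- A map to the cycles that vanishes in cohomology takes values in boundaries, and on a boundary `d
y` the relation `d s d = d` says that `s` followed by `d` is the identity. -/
lemma comp_iCycles_of_comp_homologyπ {n m : ℤ} (h : m + 1 = n) (s : K.X n ⟶ K.X m)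
    (hs : K.d m n ≫ s ≫ K.d m n = K.d m n) {A : ModuleCat.{u} k} (x : A ⟶ K.cycles n)
    (hx : x ≫ K.homologyπ n = 0) :
    x ≫ K.iCycles n ≫ s ≫ K.d m n = x ≫ K.iCycles n := by
  have hm : (ComplexShape.up ℤ).prev n = m := by simp; lia
  have hex : (ShortComplex.mk (K.toCycles m n) (K.homologyπ n) (by simp)).Exact :=
    ShortComplex.exact_of_g_is_cokernel _ (K.homologyIsCokernel m n hm)
  rw [ShortComplex.moduleCat_exact_iff] at hex
  refine ModuleCat.hom_ext (LinearMap.ext fun a => ?_)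
  obtain ⟨y, hy⟩ := hex (x.hom a) (by
    exact LinearMap.congr_fun (congrArg ModuleCat.Hom.hom hx) a)
  have h₁ : (K.iCycles n).hom (x.hom a) = (K.d m n).hom y := by
    rw [← hy]
    exact LinearMap.congr_fun (congrArg ModuleCat.Hom.hom (K.toCycles_i m n)) y
  change (K.d m n).hom (s.hom ((K.iCycles n).hom (x.hom a))) = (K.iCycles n).hom (x.hom a)
  rw [h₁]
  exact LinearMap.congr_fun (congrArg ModuleCat.Hom.hom hs) y

/-- A complex of vector spaces is homotopy equivalent to its cohomology. -/
lemma exists_homotopyEquiv_homologyComplex :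
    ∃ (i : homologyComplex K ⟶ K) (r : K ⟶ homologyComplex K) (h : Cochain K K (-1)),
      i ≫ r = 𝟙 _ ∧ (∀ n, K.iCycles n ≫ r.f n = K.homologyπ n) ∧
        Cochain.ofHom (r ≫ i) = Cochain.ofHom (𝟙 _) + δ (-1) 0 h := by
  choose s hs using fun n m : ℤ => exists_generalized_inverse (K.d m n)
  choose σ hσ using fun n : ℤ => exists_section (K.homologyπ n)
  -- From `d s d = d`, the map `1 - (s d + d s)` kills boundaries and takes values in cycles. It is
  -- homotopic to the identity, but `s` is not normalised, so it need not be a projector onto a copy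
  -- of the cohomology.
  let P (n : ℤ) : K.X n ⟶ K.X n := 𝟙 _ - s n (n - 1) ≫ K.d (n - 1) n - K.d n (n + 1) ≫ s (n + 1) n
  have hP (n : ℤ) : P n ≫ K.d n (n + 1) = 0 := by
    simp [P, hs]
  have hP' (n m : ℤ) (h : m + 1 = n) : K.d m n ≫ P n = 0 := by
    obtain rfl : m = n - 1 := by lia
    simp [P, hs]
  let p (n : ℤ) : K.X n ⟶ K.cycles n := K.liftCycles (P n) (n + 1) (by simp) (hP n)
  have hp (n : ℤ) : p n ≫ K.iCycles n = P n := K.liftCycles_i _ _ _ _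
  let i : homologyComplex K ⟶ K :=
    { f n := σ n ≫ K.iCycles n
      comm' m n h := by simp }
  let r : K ⟶ homologyComplex K :=
    { f n := p n ≫ K.homologyπ n
      comm' m n h := by
        have : K.d m n ≫ p n = 0 := by
          rw [← cancel_mono (K.iCycles n), Category.assoc, hp, hP' n m h, zero_comp]
        simp [reassoc_of% this] }
  -- The defect between `P` and `r ≫ i`. It takes values in boundaries and vanishes on them, so `t ≫
  -- s` is a null-homotopy of it. This accounts for the second summand of the homotopy below.
  let t (n : ℤ) : K.X n ⟶ K.X n := p n ≫ (𝟙 _ - K.homologyπ n ≫ σ n) ≫ K.iCycles n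
  have ht (n : ℤ) : t n = P n - (r ≫ i).f n := by
    simp [t, r, i, hp]
  have h₂ (n : ℤ) : K.iCycles n ≫ p n ≫ K.homologyπ n = K.homologyπ n := by
    have : K.iCycles n ≫ p n = 𝟙 _ - (K.iCycles n ≫ s n (n - 1)) ≫ K.toCycles (n - 1) n := by
      rw [← cancel_mono (K.iCycles n), Category.assoc, hp]
      simp [P]
    rw [reassoc_of% this]
    simp
  refine ⟨i, r, -Cochain.mk (fun n m _ => s n m + t n ≫ s n m), ?_, h₂, ?_⟩
  · ext1 n
    change (σ n ≫ K.iCycles n) ≫ p n ≫ K.homologyπ n = 𝟙 _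
    rw [Category.assoc, h₂, hσ]
  · ext n
    rw [Cochain.add_v, δ_v (-1) 0 (by lia) _ n n (by lia) (n - 1) (n + 1) rfl rfl]
    have h₁ : t n ≫ s n (n - 1) ≫ K.d (n - 1) n = t n := by
      have := comp_iCycles_of_comp_homologyπ K (sub_add_cancel n 1) (s n (n - 1)) (hs _ _)
        (p n ≫ (𝟙 _ - K.homologyπ n ≫ σ n)) (by simp [hσ])
      simpa [t] using this
    have h₂ : K.d n (n + 1) ≫ t (n + 1) = 0 := by
      have : K.d n (n + 1) ≫ p (n + 1) = 0 := by
        rw [← cancel_mono (K.iCycles _), Category.assoc, hp, hP' _ _ rfl, zero_comp]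
      simp only [t, reassoc_of% this, zero_comp]
    simp only [Cochain.ofHom_v, Cochain.neg_v, Cochain.mk_v, Preadditive.neg_comp,
      Preadditive.add_comp, Category.assoc, h₁, Preadditive.comp_neg, Preadditive.comp_add,
      reassoc_of% h₂, zero_comp, add_zero, Int.negOnePow_zero, one_smul, HomologicalComplex.id_f]
    rw [ht]
    simp only [P]
    abel_nf

variable {K} in
/-- A quasi-isomorphism between complexes of vector spaces is a homotopy equivalence. -/
lemma exists_homotopyInverse_of_quasiIso {L : CochainComplex (ModuleCat.{u} k) ℤ} (u : K ⟶ L)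
    [QuasiIso u] : ∃ (v : L ⟶ K) (h : Cochain K K (-1)) (h' : Cochain L L (-1)),
      Cochain.ofHom (u ≫ v) = Cochain.ofHom (𝟙 _) + δ (-1) 0 h ∧
      Cochain.ofHom (v ≫ u) = Cochain.ofHom (𝟙 _) + δ (-1) 0 h' := by
  obtain ⟨i, r, h, hir, hr, hri⟩ := exists_homotopyEquiv_homologyComplex K
  obtain ⟨i', r', h', hir', hr', hri'⟩ := exists_homotopyEquiv_homologyComplex L
  let φ : homologyComplex K ⟶ homologyComplex L :=
    { f n := HomologicalComplex.homologyMap u n, comm' _ _ _ := by simp }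
  let ψ : homologyComplex L ⟶ homologyComplex K :=
    { f n := inv (HomologicalComplex.homologyMap u n), comm' _ _ _ := by simp }
  have hφψ : φ ≫ ψ = 𝟙 _ := by
    ext1 n
    exact IsIso.hom_inv_id (HomologicalComplex.homologyMap u n)
  have hψφ : ψ ≫ φ = 𝟙 _ := by
    ext1 n
    exact IsIso.inv_hom_id (HomologicalComplex.homologyMap u n)
  have hφ : i ≫ u ≫ r' = φ := by
    ext1 n
    have hi : i.f n ≫ K.d n (n + 1) = 0 := by
      exact (i.comm n (n + 1)).trans zero_comp
    let l := K.liftCycles (i.f n) (n + 1) (by simp) hi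
    have hl : l ≫ K.iCycles n = i.f n := K.liftCycles_i _ _ _ _
    have hl' : l ≫ K.homologyπ n = 𝟙 _ := by
      rw [← hr, reassoc_of% hl, ← HomologicalComplex.comp_f, hir, HomologicalComplex.id_f]
    change i.f n ≫ u.f n ≫ r'.f n = HomologicalComplex.homologyMap u n
    rw [← hl, Category.assoc, ← HomologicalComplex.cyclesMap_i_assoc, hr',
      ← HomologicalComplex.homologyπ_naturality, reassoc_of% hl']
  -- The inverse passes through cohomology. Since `i ≫ u ≫ r'` is the induced map on cohomology, `(r
  -- ≫ i) ≫ (u ≫ v) = r ≫ i`, and replacing `r ≫ i` by the identity up to homotopy on both sides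
  -- gives the stated homotopy for `u ≫ v`. The other composite is symmetric.
  refine ⟨r' ≫ ψ ≫ i, h - h.comp (Cochain.ofHom (u ≫ r' ≫ ψ ≫ i)) (add_zero _),
    h' - (Cochain.ofHom (r' ≫ ψ ≫ i ≫ u)).comp h' (zero_add _), ?_, ?_⟩
  · have h₁ : Cochain.ofHom (u ≫ r' ≫ ψ ≫ i) =
        (Cochain.ofHom (r ≫ i) - δ (-1) 0 h).comp (Cochain.ofHom (u ≫ r' ≫ ψ ≫ i))
          (add_zero _) := by
      rw [hri, add_sub_cancel_right, Cochain.id_comp]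
    have h₂ : (r ≫ i) ≫ (u ≫ r' ≫ ψ ≫ i) = r ≫ i := by
      rw [Category.assoc, reassoc_of% hφ, reassoc_of% hφψ]
    rw [Cochain.sub_comp, ← Cochain.ofHom_comp, h₂, hri] at h₁
    rw [δ_sub, δ_comp_ofHom, ← add_sub_assoc]
    exact h₁
  · have h₁ : Cochain.ofHom (r' ≫ ψ ≫ i ≫ u) = (Cochain.ofHom (r' ≫ ψ ≫ i ≫ u)).comp
        (Cochain.ofHom (r' ≫ i') - δ (-1) 0 h') (add_zero _) := by
      rw [hri', add_sub_cancel_right, Cochain.comp_id]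
    have h₂ : (r' ≫ ψ ≫ i ≫ u) ≫ (r' ≫ i') = r' ≫ i' := by
      simp only [Category.assoc]
      rw [reassoc_of% hφ, reassoc_of% hψφ]
    rw [Cochain.comp_sub, ← Cochain.ofHom_comp, h₂, hri'] at h₁
    rw [Category.assoc, Category.assoc, δ_sub, δ_ofHom_comp, ← add_sub_assoc]
    exact h₁

end CochainComplex

/-! ### Quasi-isomorphisms and minimal models -/

namespace TwistedComplex

variable {k : Type u} [Field k] {e : ℤ} {X Y : TwistedComplex k e}

theorem isIso_ho_map_of_quasiIso (f : X ⟶ Y) [QuasiIso f.hom] : IsIso ((ho k e).map f) := by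
  obtain ⟨v, h, h', hv, hv'⟩ := exists_homotopyInverse_of_quasiIso f.hom
  exact isIso_ho_map f v h h' hv hv'

/-- The cohomology of a complex with an endomorphism, with zero differential. -/
theorem exists_iso_homologyComplex (X : TwistedComplex k e) :
    ∃ V : TwistedComplex k e, V.cx = homologyComplex X.cx ∧
      Nonempty ((ho k e).obj X ≅ (ho k e).obj V) := by
  obtain ⟨i, r, h, hir, -, hri⟩ := exists_homotopyEquiv_homologyComplex X.cx
  let V : TwistedComplex k e :=
    { cx := homologyComplex X.cx
      -- Homotopy transfer of `τ`. It needs no higher terms: `k[T]` is free on one generator, so any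
      -- degree `e` cocycle is an admissible action.
      τ := (Cochain.ofHom i).comp (X.τ.comp (Cochain.ofHom r) (add_zero e)) (zero_add e)
      δ_τ m := by
        by_cases hm : e + 1 = m
        · subst hm
          rw [δ_ofHom_comp, δ_comp_ofHom, X.δ_τ]
          simp
        · exact δ_shape _ _ hm _ }
  have hh : -1 + e = e - 1 := by lia
  have hτ : δ e (e + 1) ((Cochain.ofHom i).comp X.τ (zero_add e)) = 0 := by
    rw [δ_ofHom_comp, X.δ_τ, Cochain.comp_zero]
  let f : V ⟶ X :=
    { hom := i
      -- The commutator of `i` is `i τ - i τ (r i) = -(i τ) δ h`, and `i τ` is a cocycle.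
      htpy := -((Cochain.ofHom i).comp X.τ (zero_add e)).comp h (by lia)
      δ_htpy := by
        have h₁ : δ (-1) 0 h = Cochain.ofHom (r ≫ i) - Cochain.ofHom (𝟙 _) := by rw [hri]; abel
        rw [δ_neg, δ_comp _ h _ (e + 1) 0 e (by lia) rfl (by lia), hτ, Cochain.zero_comp,
          smul_zero, add_zero, h₁, Cochain.comp_sub, Cochain.comp_id, neg_sub]
        simp [ad, V] }
  have := isIso_ho_map f r 0 h (by rw [hir, δ_zero, add_zero]) hri
  exact ⟨V, rfl, ⟨(asIso ((ho k e).map f)).symm⟩⟩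

end TwistedComplex

/-! ### DG modules over `k[T]` as complexes with an endomorphism -/

namespace TwistedComplex

variable {k : Type u} [Field k]

section

variable {K L : CochainComplex (ModuleCat.{u} k) ℤ} {e : ℤ}

/-- The `j`-th power of an endomorphism, as a cochain of degree `p` (meaningful for `p = j e`). -/
def pow (τ : Cochain K K e) : ℕ → ∀ p : ℤ, Cochain K K p
  | 0, p => if h : p = 0 then h ▸ Cochain.ofHom (𝟙 K) else 0
  | j + 1, p => (pow τ j (p - e)).comp τ (sub_add_cancel p e)

@[simp] lemma pow_zero (τ : Cochain K K e) : pow τ 0 0 = Cochain.ofHom (𝟙 K) := by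
  simp [pow]

lemma pow_succ (τ : Cochain K K e) (j : ℕ) (p q : ℤ) (h : q + e = p) :
    pow τ (j + 1) p = (pow τ j q).comp τ h := by
  obtain rfl : q = p - e := by lia
  rfl

@[simp] lemma pow_one (τ : Cochain K K e) : pow τ 1 e = τ := by
  rw [pow_succ τ 0 e 0 (zero_add e), pow_zero, Cochain.id_comp]

lemma pow_add (τ : Cochain K K e) (i j : ℕ) (p q n : ℤ) (hp : p = j * e) (h : p + q = n) :
    pow τ (i + j) n = (pow τ i q).comp (pow τ j p) ((add_comm q p).trans h) := by
  induction j generalizing p n with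
  | zero =>
    obtain rfl : p = 0 := by simpa using hp
    obtain rfl : q = n := by lia
    simp
  | succ j ih =>
    have hp' : p - e = j * e := by rw [hp]; push_cast; ring
    rw [← add_assoc, pow_succ τ (i + j) n (n - e) (by lia), ih (p - e) (n - e) hp' (by lia),
      pow_succ τ j p (p - e) (by lia)]
    exact assoc _ _ _ _ _ _ _

lemma δ_pow (τ : Cochain K K e) (hτ : ∀ m, δ e m τ = 0) (j : ℕ) (p m : ℤ) :
    δ p m (pow τ j p) = 0 := by
  by_cases hm : p + 1 = m
  · induction j generalizing p m with
    | zero =>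
      by_cases hp : p = 0
      · subst hp
        simp
      · simp [pow, hp]
    | succ j ih =>
      rw [pow_succ τ j p (p - e) (by lia),
        δ_comp _ _ _ (p - e + 1) (e + 1) m hm rfl rfl, hτ, ih _ _ rfl]
      simp
  · exact δ_shape _ _ hm _

lemma pow_comm {τ : Cochain K K e} {τ' : Cochain L L e} {f : K ⟶ L}
    (h : τ.comp (Cochain.ofHom f) (add_zero e) = (Cochain.ofHom f).comp τ' (zero_add e)) (j : ℕ)
    (p : ℤ) : (pow τ j p).comp (Cochain.ofHom f) (add_zero p) =
      (Cochain.ofHom f).comp (pow τ' j p) (zero_add p) := by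
  induction j generalizing p with
  | zero =>
    by_cases hp : p = 0
    · subst hp
      simp
    · simp [pow, hp]
  | succ j ih =>
    rw [pow_succ τ j p (p - e) (by lia), pow_succ τ' j p (p - e) (by lia),
      Cochain.comp_assoc_of_third_is_zero_cochain, h,
      ← Cochain.comp_assoc_of_second_is_zero_cochain, ih,
      Cochain.comp_assoc_of_first_is_zero_cochain]

end

open Polynomial DGAlgebra

noncomputable section

variable {d : ℤ}

lemma X_pow_mem_polynomialPart (j : ℕ) (p : ℤ) (h : (j : ℤ) * d = -p) :
    (X ^ j : k[X]) ∈ polynomialPart k d p := by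
  intro i hi
  rw [coeff_X_pow] at hi
  split_ifs at hi with hij
  · rw [hij, h]
  · exact absurd rfl hi

/-- A homogeneous part is spanned by the powers of `X` that lie in it. For `d ≠ 0` there is at most
one such power, while for `d = 0` degree `0` is the whole polynomial ring. Inducting on linear
combinations treats both cases at once. -/
lemma polynomialPart_induction {p : ℤ} {motive : polynomialPart k d p → Prop}
    (zero : motive 0) (add : ∀ a b, motive a → motive b → motive (a + b))
    (smul : ∀ (c : k) a, motive a → motive (c • a))
    (X_pow : ∀ (j : ℕ) (h : (j : ℤ) * d = -p), motive ⟨X ^ j, X_pow_mem_polynomialPart j p h⟩)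
    (a : polynomialPart k d p) : motive a := by
  have ha : a = ∑ j ∈ a.1.support.attach, a.1.coeff j •
      (⟨X ^ j.1, X_pow_mem_polynomialPart j.1 p (a.2 j.1 (mem_support_iff.1 j.2))⟩ :
        polynomialPart k d p) := by
    refine Subtype.ext ?_
    rw [AddSubmonoidClass.coe_finsetSum]
    conv_lhs => rw [a.1.as_sum_support_C_mul_X_pow, ← Finset.sum_attach]
    simp [smul_eq_C_mul]
  rw [ha]
  exact Finset.sum_induction _ motive add zero fun j _ =>
    smul _ _ (X_pow j.1 (a.2 j.1 (mem_support_iff.1 j.2)))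

/-- The action of the polynomials of degree `p` determined by an endomorphism. -/
def polynomialAct (Y : TwistedComplex k (-d)) (p : ℤ) :
    polynomialPart k d p →ₗ[k] Cochain Y.cx Y.cx p :=
  lsum (fun j => LinearMap.toSpanSingleton k _ (pow Y.τ j p)) ∘ₗ (polynomialPart k d p).subtype

lemma polynomialAct_X_pow (Y : TwistedComplex k (-d)) (p : ℤ) (j : ℕ)
    (h : (j : ℤ) * d = -p) :
    polynomialAct Y p ⟨X ^ j, X_pow_mem_polynomialPart j p h⟩ = pow Y.τ j p := by
  simp [polynomialAct, X_pow_eq_monomial, sum_monomial_index]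

/-- The DG module over the polynomial algebra determined by an endomorphism. -/
def toModule (Y : TwistedComplex k (-d)) : (polynomial k d).LeftModule where
  cx := Y.cx
  act p := polynomialAct Y p
  act_one := by
    have : ((polynomial k d).one : polynomialPart k d 0) =
        ⟨X ^ 0, X_pow_mem_polynomialPart 0 0 (by simp)⟩ := Subtype.ext (_root_.pow_zero X).symm
    exact (congrArg (polynomialAct Y 0) this).trans
      ((polynomialAct_X_pow Y 0 0 (by simp)).trans (pow_zero _))
  act_mul p q n h a b := by
    have key (a : polynomialPart k d p) (b : polynomialPart k d q) :
        polynomialAct Y n ⟨a.1 * b.1, polynomialPart_mul k d h a.2 b.2⟩ =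
          (polynomialAct Y q b).comp (polynomialAct Y p a) ((add_comm q p).trans h) := by
      induction a using polynomialPart_induction with
      | zero =>
        rw [map_zero, Cochain.comp_zero, ← map_zero (polynomialAct Y n)]
        exact congrArg _ (Subtype.ext (zero_mul _))
      | add a a' ha ha' =>
        rw [map_add, Cochain.comp_add, ← ha, ← ha', ← map_add]
        exact congrArg _ (Subtype.ext (add_mul _ _ _))
      | smul c a ha =>
        rw [map_smul, Cochain.comp_smul, ← ha, ← map_smul]
        exact congrArg _ (Subtype.ext (smul_mul_assoc _ _ _))
      | X_pow j hj =>
        induction b using polynomialPart_induction with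
        | zero =>
          rw [map_zero, Cochain.zero_comp, ← map_zero (polynomialAct Y n)]
          exact congrArg _ (Subtype.ext (mul_zero _))
        | add a a' ha ha' =>
          rw [map_add, Cochain.add_comp, ← ha, ← ha', ← map_add]
          exact congrArg _ (Subtype.ext (mul_add _ _ _))
        | smul c a ha =>
          rw [map_smul, Cochain.smul_comp, ← ha, ← map_smul]
          exact congrArg _ (Subtype.ext (mul_smul_comm _ _ _))
        | X_pow i hi =>
          rw [polynomialAct_X_pow Y p j hj, polynomialAct_X_pow Y q i hi,
            ← pow_add Y.τ i j p q n (by linear_combination hj) h,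
            ← polynomialAct_X_pow Y n (i + j) (by push_cast; rw [add_mul]; lia)]
          refine congrArg _ (Subtype.ext ?_)
          change (X ^ j * X ^ i : k[X]) = X ^ (i + j)
          rw [← _root_.pow_add, add_comm]
    exact key a b
  δ_act p p' h a := by
    have key (a : polynomialPart k d p) : δ p p' (polynomialAct Y p a) = 0 := by
      induction a using polynomialPart_induction with
      | zero => simp
      | add a a' ha ha' => simp [ha, ha']
      | smul c a ha => simp [ha]
      | X_pow j hj => rw [polynomialAct_X_pow Y p j hj, δ_pow _ Y.δ_τ]
    exact (key a).trans (map_zero (polynomialAct Y p')).symm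

/-- The variable, as an element of the polynomial DG algebra. -/
def polynomialX (k : Type u) [Field k] (d : ℤ) : (polynomial k d).cx.X (-d) :=
  (⟨X, by simpa using X_pow_mem_polynomialPart (k := k) 1 (-d) (by simp)⟩ :
    polynomialPart k d (-d))

/-- The complex with an endomorphism underlying a DG module over the polynomial algebra. -/
abbrev ofModule (M : (polynomial k d).LeftModule) : TwistedComplex k (-d) where
  cx := M.cx
  τ := M.act (-d) (polynomialX k d)
  δ_τ m := by
    by_cases hm : -d + 1 = m
    · rw [M.δ_act _ _ hm]
      exact map_zero (M.act m)
    · exact δ_shape _ _ hm _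

lemma act_X_pow (M : (polynomial k d).LeftModule) (p : ℤ) (j : ℕ) (h : (j : ℤ) * d = -p) :
    M.act p (⟨X ^ j, X_pow_mem_polynomialPart j p h⟩ : polynomialPart k d p) =
      pow (M.act (-d) (polynomialX k d)) j p := by
  induction j generalizing p with
  | zero =>
    obtain rfl : p = 0 := by simpa using h
    rw [pow_zero, ← M.act_one]
    exact congrArg (M.act 0) (Subtype.ext (_root_.pow_zero X))
  | succ j ih =>
    have h' : (j : ℤ) * d = -(p - -d) := by push_cast at h; linear_combination h
    rw [pow_succ _ j p (p - -d) (by lia), ← ih _ h']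
    exact (congrArg (M.act p) (Subtype.ext (_root_.pow_succ' X j))).trans
      (M.act_mul (-d) (p - -d) p (by lia) (polynomialX k d)
        (⟨X ^ j, X_pow_mem_polynomialPart j _ h'⟩ : polynomialPart k d (p - -d)))

/-- The action is determined by that of the variable, so passing to the underlying complex with
endomorphism loses nothing, and `A`-linearity of a map need only be tested on `X` (`homMk`). -/
lemma act_eq (M : (polynomial k d).LeftModule) (p : ℤ) (a : polynomialPart k d p) :
    M.act p a = polynomialAct (ofModule M) p a := by
  induction a using polynomialPart_induction with
  | zero => exact (map_zero (M.act p)).trans (map_zero _).symm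
  | add a a' ha ha' =>
    exact ((map_add (M.act p) a a').trans (congrArg₂ _ ha ha')).trans (map_add _ _ _).symm
  | smul c a ha =>
    exact ((map_smul (M.act p) c a).trans (congrArg _ ha)).trans (map_smul _ _ _).symm
  | X_pow j hj => exact (act_X_pow M p j hj).trans (polynomialAct_X_pow (ofModule M) p j hj).symm

lemma polynomialAct_comm {Y Z : TwistedComplex k (-d)} {f : Y.cx ⟶ Z.cx}
    (h : Y.τ.comp (Cochain.ofHom f) (add_zero _) = (Cochain.ofHom f).comp Z.τ (zero_add _))
    (p : ℤ) (a : polynomialPart k d p) :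
    (polynomialAct Y p a).comp (Cochain.ofHom f) (add_zero p) =
      (Cochain.ofHom f).comp (polynomialAct Z p a) (zero_add p) := by
  induction a using polynomialPart_induction with
  | zero => simp
  | add a a' ha ha' => simp [ha, ha']
  | smul c a ha => simp [ha]
  | X_pow j hj => rw [polynomialAct_X_pow Y p j hj, polynomialAct_X_pow Z p j hj, pow_comm h]

/-- A morphism of complexes which commutes with the variable is a morphism of DG modules. -/
def homMk {M N : (polynomial k d).LeftModule} (f : M.cx ⟶ N.cx)
    (h : (ofModule M).τ.comp (Cochain.ofHom f) (add_zero _) =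
      (Cochain.ofHom f).comp (ofModule N).τ (zero_add _)) : M ⟶ N where
  hom := f
  comm p a := by
    refine ((congrArg (fun z => Cochain.comp z _ _) (act_eq M p a)).trans
      (polynomialAct_comm (Y := ofModule M) (Z := ofModule N) h p a)).trans
      (congrArg (fun z => Cochain.comp _ z _) (act_eq N p a).symm)

lemma toModule_τ (Y : TwistedComplex k (-d)) : (ofModule (toModule Y)).τ = Y.τ := by
  have h : (polynomialX k d : polynomialPart k d (-d)) =
      ⟨X ^ 1, X_pow_mem_polynomialPart 1 (-d) (by simp)⟩ := Subtype.ext (_root_.pow_one X).symm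
  exact (congrArg (polynomialAct Y (-d)) h).trans
    ((polynomialAct_X_pow Y (-d) 1 (by simp)).trans (pow_one _))

/-- A morphism of DG modules as a morphism of complexes with an endomorphism. -/
abbrev ofModuleMap {M N : (polynomial k d).LeftModule} (f : M ⟶ N) : ofModule M ⟶ ofModule N where
  hom := f.hom
  htpy := 0
  δ_htpy := by simp [ad, f.comm]

/-- DG modules over the polynomial algebra as complexes with an endomorphism. -/
def ofModuleF (k : Type u) [Field k] (d : ℤ) :
    (polynomial k d).LeftModule ⥤ TwistedComplex k (-d) where
  obj M := ofModule M
  map f := ofModuleMap f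
  map_id M := rfl
  map_comp f g := by ext1 <;> simp

instance : (ofModuleF k d).Additive where
  map_add := by
    intros
    apply hom_ext
    · rfl
    · exact (add_zero (0 : Cochain _ _ _)).symm

instance : (ofModuleF k d).Linear k where
  map_smul {M N} f r := by
    apply hom_ext
    · rfl
    · exact (smul_zero (A := Cochain M.cx N.cx (-d - 1)) r).symm

end

end TwistedComplex

lemma CochainComplex.quasiIso_of_homotopyInverse {k : Type u} [Field k]
    {K L : CochainComplex (ModuleCat.{u} k) ℤ} (f : K ⟶ L) (v : L ⟶ K)
    (h : Cochain K K (-1)) (h' : Cochain L L (-1))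
    (hv : Cochain.ofHom (f ≫ v) = δ (-1) 0 h + Cochain.ofHom (𝟙 _))
    (hv' : Cochain.ofHom (v ≫ f) = δ (-1) 0 h' + Cochain.ofHom (𝟙 _)) : QuasiIso f :=
  (HomologicalComplex.mem_quasiIso_iff _).1 (homotopyEquivalences_le_quasiIso _ _ _
    ⟨{ hom := f
       inv := v
       homotopyHomInvId := (Cochain.equivHomotopy _ _).symm ⟨h, hv⟩
       homotopyInvHomId := (Cochain.equivHomotopy _ _).symm ⟨h', hv'⟩ }, rfl⟩)

/-! ### Mapping cones of homotopy-commuting morphisms -/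

namespace TwistedComplex

variable {k : Type u} [Field k]

open DGAlgebra DGAlgebra.LeftModule

noncomputable section

section

variable {e : ℤ} {X Y : TwistedComplex k e}

/-- The endomorphism of the mapping cone of a morphism. -/
def coneτ (φ : X ⟶ Y) : Cochain (mappingCone φ.hom) (mappingCone φ.hom) e :=
  mappingCone.descCochain φ.hom
    -- The homotopy is an off-diagonal entry from `X` to `Y`. It compensates for the failure of
    -- `φ.hom` to commute with `τ`, so that the endomorphism of the cone is a cocycle.
    (e.negOnePow • (X.τ.comp (mappingCone.inl φ.hom) (sub_eq_add_neg e 1).symm +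
      φ.htpy.comp (Cochain.ofHom (mappingCone.inr φ.hom)) (add_zero _)))
    (Y.τ.comp (Cochain.ofHom (mappingCone.inr φ.hom)) (add_zero _)) (sub_add_cancel e 1)

lemma inl_coneτ (φ : X ⟶ Y) (m : ℤ) (h : -1 + e = m) :
    (mappingCone.inl φ.hom).comp (coneτ φ) h =
      e.negOnePow • (X.τ.comp (mappingCone.inl φ.hom) (by lia) +
      φ.htpy.comp (Cochain.ofHom (mappingCone.inr φ.hom)) (by lia)) := by
  obtain rfl : e - 1 = m := by lia
  exact mappingCone.inl_descCochain _ _ _ _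

lemma inr_coneτ (φ : X ⟶ Y) :
    (Cochain.ofHom (mappingCone.inr φ.hom)).comp (coneτ φ) (zero_add e) =
      Y.τ.comp (Cochain.ofHom (mappingCone.inr φ.hom)) (add_zero e) :=
  mappingCone.inr_descCochain _ _ _ _

/-- A cochain on a mapping cone is determined by its two restrictions. -/
lemma mappingCone_cochain_ext {K L L' : CochainComplex (ModuleCat.{u} k) ℤ} {f : K ⟶ L} {n m : ℤ}
    (hm : -1 + n = m) {z z' : Cochain (mappingCone f) L' n}
    (h₁ : (mappingCone.inl f).comp z hm = (mappingCone.inl f).comp z' hm)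
    (h₂ : (Cochain.ofHom (mappingCone.inr f)).comp z (zero_add n) =
      (Cochain.ofHom (mappingCone.inr f)).comp z' (zero_add n)) : z = z' := by
  obtain rfl : n + -1 = m := by lia
  exact cone_ext h₁ h₂

/-- The mapping cone of a morphism. -/
def cone (φ : X ⟶ Y) : TwistedComplex k e where
  cx := mappingCone φ.hom
  τ := coneτ φ
  δ_τ m := by
    by_cases hm : e + 1 = m
    · subst hm
      apply mappingCone_cochain_ext (m := e) (by lia)
      -- The boundary of `inl · coneτ` is computed twice, by the Leibniz rule and from the explicit
      -- formula. The terms containing `δ φ.htpy` match by the defining relation of `φ`, which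
      -- isolates `inl · δ coneτ = 0`.
      · have h₁ := δ_comp (mappingCone.inl φ.hom) (coneτ φ) (by lia : -1 + e = e - 1) 0 (e + 1) e
          (by lia) (by lia) (by lia)
        rw [inl_coneτ, δ_units_smul, δ_add, δ_comp_ofHom, φ.δ_htpy,
          δ_comp X.τ (mappingCone.inl φ.hom) _ (e + 1) 0 e (by lia) (by lia) (by lia), X.δ_τ,
          mappingCone.δ_inl, Cochain.ofHom_comp, Cochain.comp_assoc_of_second_is_zero_cochain,
          inr_coneτ] at h₁
        rw [Cochain.comp_zero, ← sub_eq_iff_eq_add.2 h₁]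
        simp [ad]
      · rw [← δ_ofHom_comp, inr_coneτ, δ_comp_ofHom, Y.δ_τ]
        simp
    · exact δ_shape _ _ hm _

end

variable {d : ℤ} {M N P : (polynomial k d).LeftModule}

/-- The mapping cone, as a DG module, of a morphism of complexes which commutes with the variable
up to a given homotopy. -/
def coneModule (φ : ofModule M ⟶ ofModule N) : (polynomial k d).LeftModule := toModule (cone φ)

/-- The inclusion of the target in the mapping cone, as a morphism of complexes. -/
def coneInr (φ : ofModule M ⟶ ofModule N) : N.cx ⟶ (coneModule φ).cx := mappingCone.inr φ.hom

/-- The inclusion of the source in the mapping cone. -/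
def coneInl (φ : ofModule M ⟶ ofModule N) : Cochain M.cx (coneModule φ).cx (-1) :=
  mappingCone.inl φ.hom

lemma δ_coneInl (φ : ofModule M ⟶ ofModule N) :
    δ (-1) 0 (coneInl φ) = Cochain.ofHom (φ.hom ≫ coneInr φ) := mappingCone.δ_inl _

lemma coneInl_τ (φ : ofModule M ⟶ ofModule N) (m : ℤ) (h : -1 + -d = m) :
    (coneInl φ).comp (ofModule (coneModule φ)).τ h =
      (-d).negOnePow • ((ofModule M).τ.comp (coneInl φ) (by lia) +
      φ.htpy.comp (Cochain.ofHom (coneInr φ)) (by lia)) := by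
  exact (congrArg (fun z => Cochain.comp (coneInl φ) z h) (toModule_τ (cone φ))).trans
    (inl_coneτ φ m h)

/-- The diagonal part of the endomorphism cancels in the commutator with `inl`, leaving exactly the
off-diagonal homotopy. In particular `inl` commutes with `τ` in the graded sense when `φ` is strict.
-/
lemma ad_coneInl (φ : ofModule M ⟶ ofModule N) (m : ℤ) (h : -1 + -d = m) :
    ad (ofModule M) (ofModule (coneModule φ)) (-1) m h (coneInl φ) =
      (-d).negOnePow • φ.htpy.comp (Cochain.ofHom (coneInr φ)) (by lia) := by
  have h₁ : ((-1) * -d).negOnePow = (-d).negOnePow := (Int.negOnePow_eq_iff _ _).2 ⟨d, by ring⟩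
  have h₂ := coneInl_τ φ m h
  rw [smul_add] at h₂
  unfold ad
  rw [h₁]
  refine (congrArg (· - _) h₂).trans ?_
  exact add_sub_cancel_left (G := Cochain M.cx (coneModule φ).cx m) _ _

/-- The inclusion of the target in the mapping cone. -/
def inrModule (φ : ofModule M ⟶ ofModule N) : N ⟶ coneModule φ :=
  homMk (coneInr φ) (by
    exact (inr_coneτ φ).symm.trans
      (congrArg (fun z => Cochain.comp _ z _) (toModule_τ (cone φ))).symm)

@[simp] lemma inrModule_hom (φ : ofModule M ⟶ ofModule N) : (inrModule φ).hom = coneInr φ := rfl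

/-- The inclusion `inl` of the source bounds the composite: its boundary is the underlying map, and
its commutator with `τ` is the homotopy component. -/
lemma isNull_comp_inrModule (φ : ofModule M ⟶ ofModule N) :
    IsNull (φ ≫ ofModuleMap (inrModule φ)) := by
  refine ⟨coneInl φ, 0, ?_, ?_⟩
  · rw [δ_coneInl]
    simp
  · rw [ad_coneInl, negOnePow_smul_smul]
    simp

/-- A cochain on the mapping cone is determined by its two restrictions. -/
lemma cone_cochain_ext {φ : ofModule M ⟶ ofModule N}
    {L : CochainComplex (ModuleCat.{u} k) ℤ} {n m : ℤ} (hm : -1 + n = m)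
    {z z' : Cochain (coneModule φ).cx L n}
    (h₁ : (coneInl φ).comp z hm = (coneInl φ).comp z' hm)
    (h₂ : (Cochain.ofHom (coneInr φ)).comp z (zero_add n) =
      (Cochain.ofHom (coneInr φ)).comp z' (zero_add n)) : z = z' := by
  exact mappingCone_cochain_ext hm h₁ h₂

/-- A cochain on the mapping cone with given restrictions. -/
def coneDescCochain (φ : ofModule M ⟶ ofModule N) {L : CochainComplex (ModuleCat.{u} k) ℤ}
    {n m : ℤ} (a : Cochain M.cx L m) (b : Cochain N.cx L n) (h : m + 1 = n) :
    Cochain (coneModule φ).cx L n :=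
  mappingCone.descCochain φ.hom a b h

lemma coneInl_coneDescCochain (φ : ofModule M ⟶ ofModule N)
    {L : CochainComplex (ModuleCat.{u} k) ℤ}
    {n m : ℤ} (a : Cochain M.cx L m) (b : Cochain N.cx L n) (h : m + 1 = n) :
    (coneInl φ).comp (coneDescCochain φ a b h) (by lia) = a :=
  mappingCone.inl_descCochain _ _ _ _

lemma coneInr_coneDescCochain (φ : ofModule M ⟶ ofModule N)
    {L : CochainComplex (ModuleCat.{u} k) ℤ}
    {n m : ℤ} (a : Cochain M.cx L m) (b : Cochain N.cx L n) (h : m + 1 = n) :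
    (Cochain.ofHom (coneInr φ)).comp (coneDescCochain φ a b h) (zero_add n) = b :=
  mappingCone.inr_descCochain _ _ _ _

/-- A morphism from the mapping cone with given restrictions. -/
def coneDesc (φ : ofModule M ⟶ ofModule N) {L : CochainComplex (ModuleCat.{u} k) ℤ}
    (a : Cochain M.cx L (-1)) (b : N.cx ⟶ L) (h : δ (-1) 0 a = Cochain.ofHom (φ.hom ≫ b)) :
    (coneModule φ).cx ⟶ L :=
  mappingCone.desc φ.hom a b h

section

variable (φ : ofModule M ⟶ ofModule N) {L : CochainComplex (ModuleCat.{u} k) ℤ}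
    (a : Cochain M.cx L (-1)) (b : N.cx ⟶ L) (h : δ (-1) 0 a = Cochain.ofHom (φ.hom ≫ b))

lemma coneInl_coneDesc :
    (coneInl φ).comp (Cochain.ofHom (coneDesc φ a b h)) (add_zero _) = a :=
  mappingCone.inl_desc _ _ _ _

lemma coneInr_coneDesc : coneInr φ ≫ coneDesc φ a b h = b := mappingCone.inr_desc _ _ _ _

end

lemma isIso_Q_map_of_quasiIso (f : M ⟶ N) (hf : QuasiIso f.hom) :
    IsIso ((quasiIso (polynomial k d)).Q.map f) :=
  (quasiIso _).Q_inverts f ((HomologicalComplex.mem_quasiIso_iff _).2 hf)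

/-- The mapping cone of an identity is zero in the derived category. -/
lemma isZero_Q_cone_id (M : (polynomial k d).LeftModule) :
    IsZero ((quasiIso (polynomial k d)).Q.obj (coneModule (𝟙 (ofModule M)))) := by
  obtain ⟨z, hz⟩ := (Cochain.equivHomotopy _ _) (mappingCone.homotopyToZeroOfId M.cx)
  -- On a contractible complex the zero map is a homotopy equivalence. It therefore becomes an
  -- isomorphism after localization, which forces the object to be zero.
  have h₁ : QuasiIso (0 : mappingCone (𝟙 M.cx) ⟶ mappingCone (𝟙 M.cx)) :=
    quasiIso_of_homotopyInverse _ 0 (-z) (-z)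
      (by rw [hz]; simp) (by rw [hz]; simp)
  have : IsIso ((quasiIso (polynomial k d)).Q.map
      (0 : coneModule (𝟙 (ofModule M)) ⟶ coneModule (𝟙 (ofModule M)))) :=
    isIso_Q_map_of_quasiIso _ h₁
  rw [IsZero.iff_id_eq_zero, ← cancel_epi ((quasiIso (polynomial k d)).Q.map
      (0 : coneModule (𝟙 (ofModule M)) ⟶ coneModule (𝟙 (ofModule M))))]
  simp

/-- Morphisms which are null-homotopic through a homotopy commuting with the variable vanish in the
derived category. -/
lemma Q_map_eq_zero_of_strict (a : M ⟶ N) (h : Cochain M.cx N.cx (-1))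
    (ha : Cochain.ofHom a.hom = δ (-1) 0 h) {m : ℤ} (hm : -1 + -d = m)
    (hh : ad (ofModule M) (ofModule N) (-1) m hm h = 0) :
    (quasiIso (polynomial k d)).Q.map a = 0 := by
  subst hm
  have h₀ : δ (-1) 0 h = Cochain.ofHom (Hom.hom (𝟙 (ofModule M)) ≫ a.hom) := by
    rw [← ha]
    simp
  -- The pair `(h, a)` defines a map from the cone of the identity that restricts to `a` on `M`. It
  -- is `A`-linear because `h` commutes with the variable, so `a` factors through a zero object.
  let b : coneModule (𝟙 (ofModule M)) ⟶ N := homMk (coneDesc (𝟙 _) h a.hom h₀) (by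
    apply cone_cochain_ext (m := -1 + -d) rfl
    · rw [← Cochain.comp_assoc_of_third_is_zero_cochain, coneInl_τ,
        ← Cochain.comp_assoc_of_second_is_zero_cochain, coneInl_coneDesc]
      simp only [ad, neg_one_mul, Int.negOnePow_neg] at hh
      rw [sub_eq_zero.1 hh]
      simp only [Int.negOnePow_neg, id_htpy, Cochain.zero_comp, add_zero, Cochain.units_smul_comp,
        Cochain.comp_assoc_of_third_is_zero_cochain, coneInl_coneDesc]
    · have := (inrModule (𝟙 (ofModule M))).comm (-d) (polynomialX k d)
      rw [inrModule_hom] at this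
      rw [← Cochain.comp_assoc_of_third_is_zero_cochain, ← this,
        ← Cochain.comp_assoc_of_second_is_zero_cochain, Cochain.comp_assoc_of_third_is_zero_cochain,
        ← Cochain.ofHom_comp, coneInr_coneDesc]
      exact a.comm _ _)
  have hab : a = inrModule (𝟙 (ofModule M)) ≫ b := by
    ext1
    exact (coneInr_coneDesc _ _ _ h₀).symm
  rw [hab, Functor.map_comp,
    (isZero_Q_cone_id M).eq_of_tgt ((quasiIso (polynomial k d)).Q.map (inrModule _)) 0, zero_comp]

end

end TwistedComplex

/-! ### Strictification by mapping cylinders -/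

namespace TwistedComplex

variable {k : Type u} [Field k]

open DGAlgebra DGAlgebra.LeftModule

noncomputable section

variable {d : ℤ} {M N P U : (polynomial k d).LeftModule}

lemma ad_ofHom_hom (x : M ⟶ N) :
    ad (ofModule M) (ofModule N) 0 (-d) (zero_add _) (Cochain.ofHom x.hom) = 0 := by
  have := (ofModuleMap x).δ_htpy
  rw [δ_zero] at this
  exact this.symm

/-- The null-homotopy `x · inl` has commutator `x · ψ.htpy · inr` up to sign, which `hx` makes zero.
The homotopy is then strict and the composite already vanishes in the derived category. -/
lemma Q_map_comp_inrModule_eq_zero (x : U ⟶ M) (ψ : ofModule M ⟶ ofModule N)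
    (hx : (Cochain.ofHom x.hom).comp ψ.htpy (zero_add _) = 0) (y : U ⟶ N)
    (hy : y.hom = x.hom ≫ ψ.hom) :
    (quasiIso (polynomial k d)).Q.map (y ≫ inrModule ψ) = 0 := by
  refine Q_map_eq_zero_of_strict _ ((Cochain.ofHom x.hom).comp (coneInl ψ) (zero_add _)) ?_
    (by lia : -1 + -d = -d - 1) ?_
  · rw [δ_ofHom_comp, δ_coneInl, ← Cochain.ofHom_comp, LeftModule.comp_hom, hy, Category.assoc,
      inrModule_hom]
  · refine (ad_comp (X := ofModule U) (Y := ofModule M) (Z := ofModule (coneModule ψ)) _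
      (Cochain.ofHom x.hom) (coneInl ψ) (zero_add _) (zero_add _)
      (by lia : -1 + -d = -d - 1)).trans ?_
    rw [ad_ofHom_hom, ad_coneInl, Cochain.comp_units_smul,
      ← Cochain.comp_assoc_of_third_is_zero_cochain, hx]
    simp

section roof

variable (φ : ofModule M ⟶ ofModule N)

/-- The difference of the inclusion of `M` and of the morphism `φ`. -/
abbrev roofMap : ofModule M ⟶ ofModule (M ⊞ N) :=
  ofModuleMap biprod.inl - φ ≫ ofModuleMap biprod.inr

lemma roofMap_hom : (roofMap φ).hom =
    (biprod.inl : M ⟶ M ⊞ N).hom - φ.hom ≫ (biprod.inr : N ⟶ M ⊞ N).hom := rfl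

lemma roofMap_htpy : (roofMap φ).htpy =
    -φ.htpy.comp (Cochain.ofHom ((biprod.inr : N ⟶ M ⊞ N).hom)) (add_zero _) := by
  simp [roofMap]

/-- The target of the strictification of a morphism. -/
abbrev roof : (polynomial k d).LeftModule := coneModule (roofMap φ)

/-- The strictification of a morphism. -/
def roofInl : M ⟶ roof φ := biprod.inl ≫ inrModule (roofMap φ)

/-- The quasi-isomorphism from the target of a morphism to the target of its strictification. -/
def roofInr : N ⟶ roof φ := biprod.inr ≫ inrModule (roofMap φ)

/-- In the cone of `(1, -φ) : M ⟶ M ⊞ N` the inclusion of `M` is identified, up to homotopy, with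
`φ` followed by the inclusion of `N`. Both inclusions are strict although `φ` is not, so `φ` becomes
a fraction of DG module morphisms. -/
lemma ho_map_roofInl : (ho k (-d)).map (ofModuleMap (roofInl φ)) =
    (ho k (-d)).map φ ≫ (ho k (-d)).map (ofModuleMap (roofInr φ)) := by
  rw [← Functor.map_comp, ho_map_eq_iff]
  have h₁ : ofModuleMap (roofInl φ) =
      ofModuleMap biprod.inl ≫ ofModuleMap (inrModule (roofMap φ)) :=
    (ofModuleF k d).map_comp _ _
  have h₂ : ofModuleMap (roofInr φ) =
      ofModuleMap biprod.inr ≫ ofModuleMap (inrModule (roofMap φ)) :=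
    (ofModuleF k d).map_comp _ _
  have h := isNull_comp_inrModule (roofMap φ)
  rwa [Preadditive.sub_comp, Category.assoc, ← h₁, ← h₂] at h

/-- The identification of the two inclusions of the cylinder uses the homotopy of `φ`. After
composition with an `x` along which `φ` is strict that homotopy disappears, so the identification
holds in the derived category without appeal to faithfulness. -/
lemma Q_map_roofInl_eq (x : U ⟶ M) (y : U ⟶ N) (h : ofModuleMap x ≫ φ = ofModuleMap y) :
    (quasiIso (polynomial k d)).Q.map (x ≫ roofInl φ) =
      (quasiIso (polynomial k d)).Q.map (y ≫ roofInr φ) := by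
  have h₁ : x.hom ≫ φ.hom = y.hom := congrArg Hom.hom h
  have h₂ : (Cochain.ofHom x.hom).comp φ.htpy (zero_add _) = 0 := by
    have := congrArg Hom.htpy h
    simpa using this
  rw [← sub_eq_zero, ← Functor.map_sub, roofInl, roofInr, ← Category.assoc, ← Category.assoc,
    ← Preadditive.sub_comp]
  refine Q_map_comp_inrModule_eq_zero x _ ?_ _ ?_
  · rw [roofMap_htpy, Cochain.comp_neg, ← Cochain.comp_assoc_of_third_is_zero_cochain, h₂]
    simp
  · rw [roofMap_hom, Preadditive.comp_sub, ← Category.assoc x.hom, h₁, sub_eq_add_neg,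
      sub_eq_add_neg]
    rfl

/-- The cone cancels the copy of `M` in `M ⊞ N` against the suspended one, leaving `N`. Being a
quasi-isomorphism concerns complexes only, so the retraction and the contraction need not respect
the variable. -/
lemma quasiIso_roofInr : QuasiIso (roofInr φ).hom := by
  let p₁ : (M ⊞ N).cx ⟶ M.cx := (biprod.fst : M ⊞ N ⟶ M).hom
  let p₂ : (M ⊞ N).cx ⟶ N.cx := (biprod.snd : M ⊞ N ⟶ N).hom
  let i₁ : M.cx ⟶ (M ⊞ N).cx := (biprod.inl : M ⟶ M ⊞ N).hom
  let i₂ : N.cx ⟶ (M ⊞ N).cx := (biprod.inr : N ⟶ M ⊞ N).hom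
  have h₁₁ : i₁ ≫ p₁ = 𝟙 _ := congrArg LeftModule.Hom.hom (biprod.inl_fst (X := M) (Y := N))
  have h₁₂ : i₁ ≫ p₂ = 0 := congrArg LeftModule.Hom.hom (biprod.inl_snd (X := M) (Y := N))
  have h₂₁ : i₂ ≫ p₁ = 0 := congrArg LeftModule.Hom.hom (biprod.inr_fst (X := M) (Y := N))
  have h₂₂ : i₂ ≫ p₂ = 𝟙 _ := congrArg LeftModule.Hom.hom (biprod.inr_snd (X := M) (Y := N))
  have htot : p₁ ≫ i₁ + p₂ ≫ i₂ = 𝟙 _ :=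
    congrArg LeftModule.Hom.hom (biprod.total (X := M) (Y := N))
  let ψ := roofMap φ
  have hψ : ψ.hom = i₁ - φ.hom ≫ i₂ := rfl
  have hd : δ (-1) 0 (0 : Cochain M.cx N.cx (-1)) =
      Cochain.ofHom (ψ.hom ≫ (p₁ ≫ φ.hom + p₂)) := by
    rw [hψ]
    simp [reassoc_of% h₁₁, reassoc_of% h₂₁, h₁₂, h₂₂]
  -- The map `(φ, 1)` on `M ⊞ N` kills the image of `(1, -φ)`, so it extends by zero to the cone.
  let v := coneDesc ψ 0 (p₁ ≫ φ.hom + p₂) hd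
  -- The contraction sends the summand `M` of `M ⊞ N` back to the suspended copy of `M`.
  let z : Cochain (roof φ).cx (roof φ).cx (-1) := coneDescCochain ψ 0
    (-(Cochain.ofHom p₁).comp (coneInl ψ) (zero_add (-1))) (by lia : (-2 : ℤ) + 1 = -1)
  have hz₁ : (coneInl ψ).comp z (by lia : (-1 : ℤ) + -1 = -2) = 0 :=
    coneInl_coneDescCochain _ _ _ _
  have hz₂ : (Cochain.ofHom (coneInr ψ)).comp z (zero_add _) =
    -(Cochain.ofHom p₁).comp (coneInl ψ) (zero_add (-1)) := coneInr_coneDescCochain _ _ _ _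
  have hv₁ : (coneInl ψ).comp (Cochain.ofHom v) (add_zero _) = 0 := coneInl_coneDesc _ _ _ _
  have hv₂ : coneInr ψ ≫ v = p₁ ≫ φ.hom + p₂ := coneInr_coneDesc _ _ _ _
  have hq : (roofInr φ).hom = i₂ ≫ coneInr ψ := rfl
  refine quasiIso_of_homotopyInverse _ v 0 z ?_ ?_
  · rw [hq, Category.assoc, hv₂, Preadditive.comp_add, reassoc_of% h₂₁, h₂₂]
    simp
  · rw [hq]
    apply cone_cochain_ext (φ := ψ) (m := -1) (by lia)
    · have h₁ := δ_comp (coneInl ψ) z (by lia : (-1 : ℤ) + -1 = -2) 0 0 (-1)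
        (by lia) (by lia) (by lia)
      rw [hz₁, δ_zero, δ_coneInl, Cochain.ofHom_comp, Cochain.comp_assoc_of_second_is_zero_cochain,
        hz₂, Int.negOnePow_neg, Int.negOnePow_one, Cochain.comp_neg,
        ← Cochain.comp_assoc_of_first_is_zero_cochain, ← Cochain.ofHom_comp, hψ,
        Preadditive.sub_comp, h₁₁, Category.assoc, h₂₁] at h₁
      rw [Cochain.comp_add, Cochain.ofHom_comp, ← Cochain.comp_assoc_of_third_is_zero_cochain, hv₁]
      have h₃ : (coneInl ψ).comp (δ (-1) 0 z) (add_zero _) + coneInl ψ = 0 := by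
        simpa using h₁.symm
      rw [Cochain.comp_id, h₃, Cochain.zero_comp]
    · rw [Cochain.comp_add, ← δ_ofHom_comp, hz₂, δ_neg, δ_ofHom_comp, δ_coneInl,
        ← Cochain.ofHom_comp, ← Cochain.ofHom_comp, ← Cochain.ofHom_comp, ← Category.assoc, hv₂,
        Category.comp_id, hψ, ← Cochain.ofHom_neg, ← Cochain.ofHom_add]
      congr 1
      have : (p₁ ≫ i₁ + p₂ ≫ i₂) ≫ coneInr ψ = coneInr ψ := by rw [htot, Category.id_comp]
      refine Eq.trans ?_ (congrArg (-p₁ ≫ (i₁ - φ.hom ≫ i₂) ≫ coneInr ψ + ·) this)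
      simp only [Preadditive.add_comp, Preadditive.sub_comp, Preadditive.comp_sub, Category.assoc]
      abel

end roof

/-- Morphisms of DG modules which are null-homotopic vanish in the derived category. -/
theorem Q_map_eq_zero_of_isNull (a : M ⟶ N) (ha : IsNull (ofModuleMap a)) :
    (quasiIso (polynomial k d)).Q.map a = 0 := by
  obtain ⟨h, g, h₁, h₂⟩ := ha
  have hd : δ (-1) 0 h = Cochain.ofHom ((ofModuleMap a).hom ≫ 𝟙 N.cx) := by
    rw [Category.comp_id]
    exact h₁.symm
  let C := coneModule (ofModuleMap a)
  -- A null-homotopy of `a` amounts to a retraction of `N ⟶ cone a`: `h` gives the underlying chain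
  -- map, and `g`, placed on the suspended copy of `M`, gives the homotopy making it compatible with
  -- `τ`.
  let r : C.cx ⟶ N.cx := coneDesc (ofModuleMap a) h (𝟙 _) hd
  have hr₁ : (coneInl (ofModuleMap a)).comp (Cochain.ofHom r) (add_zero _) = h :=
    coneInl_coneDesc _ _ _ _
  have hr₂ : coneInr (ofModuleMap a) ≫ r = 𝟙 _ := coneInr_coneDesc _ _ _ _
  let t : Cochain C.cx N.cx (-d - 1) := coneDescCochain (ofModuleMap a) (-((-d).negOnePow • g)) 0
    (by lia : -d - 2 + 1 = -d - 1)
  have ht₁ : (coneInl (ofModuleMap a)).comp t (by lia) = -((-d).negOnePow • g) :=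
    coneInl_coneDescCochain _ _ _ _
  have ht₂ : (Cochain.ofHom (coneInr (ofModuleMap a))).comp t (zero_add _) = 0 :=
    coneInr_coneDescCochain _ _ _ _
  have hρ : δ (-d - 1) (-d) t = ad (ofModule C) (ofModule N) 0 (-d) (zero_add _)
      (Cochain.ofHom r) := by
    apply cone_cochain_ext (φ := ofModuleMap a) (m := -d - 1) (by lia)
    · have e₁ := ad_comp (X := ofModule M) (Y := ofModule C) (Z := ofModule N)
        (by lia : -1 + -d = -d - 1)
        (coneInl (ofModuleMap a)) (Cochain.ofHom r) (add_zero _) (by lia : -1 + -d = -d - 1)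
        (zero_add _)
      have e₂ := δ_comp (coneInl (ofModuleMap a)) t (by lia : -1 + (-d - 1) = -d - 2) 0 (-d)
        (-d - 1) (by lia) (by lia) (by lia)
      rw [ht₁, δ_coneInl, Cochain.ofHom_comp, Cochain.comp_assoc_of_second_is_zero_cochain,
        ht₂, Cochain.comp_zero, smul_zero, add_zero] at e₂
      rw [hr₁, ad_coneInl, Cochain.zero_comp, smul_zero, Cochain.zero_comp, smul_zero,
        add_zero] at e₁
      rw [← e₁, ← e₂, δ_neg, δ_units_smul, neg_eq_iff_add_eq_zero]
      have e₃ := congrArg ((-d).negOnePow • ·) h₂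
      dsimp only at e₃
      rw [smul_zero, smul_add, negOnePow_smul_smul, add_comm] at e₃
      exact e₃.symm
    · have e₁ := ad_comp (X := ofModule N) (Y := ofModule C) (Z := ofModule N) (zero_add _)
        (Cochain.ofHom (coneInr (ofModuleMap a))) (Cochain.ofHom r) (add_zero _) (zero_add _)
        (zero_add _)
      have e₂ : ad (ofModule N) (ofModule C) 0 (-d) (zero_add _)
        (Cochain.ofHom (coneInr (ofModuleMap a))) = 0 := ad_ofHom_hom (inrModule (ofModuleMap a))
      rw [e₂, ← Cochain.ofHom_comp, hr₂, Cochain.zero_comp, smul_zero, add_zero] at e₁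
      rw [← δ_ofHom_comp, ht₂, δ_zero, ← e₁]
      exact (ad_id (X := ofModule N) _).symm
  let ρ : ofModule C ⟶ ofModule N := { hom := r, htpy := t, δ_htpy := hρ }
  let ι : N ⟶ C := inrModule (ofModuleMap a)
  have hιρ : ofModuleMap ι ≫ ρ = ofModuleMap (𝟙 N) := by
    apply hom_ext
    · exact hr₂
    · refine Eq.trans ?_ ht₂
      exact (congrArg (_ + ·) (Cochain.zero_comp _ _)).trans (add_zero _)
  -- The retraction `ρ` is only a homotopy morphism, so it has no image under `Q`. Strictifying it
  -- still makes `Q ι` a monomorphism, and `a ≫ ι` vanishes by a strict homotopy, hence so does `a`.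
  have h₃ := Q_map_roofInl_eq ρ ι (𝟙 N) hιρ
  have h₄ : IsIso ((quasiIso (polynomial k d)).Q.map (roofInr ρ)) :=
    isIso_Q_map_of_quasiIso _ (quasiIso_roofInr ρ)
  rw [Category.id_comp, Functor.map_comp] at h₃
  have h₅ : Mono ((quasiIso (polynomial k d)).Q.map ι) := by
    have : Mono ((quasiIso (polynomial k d)).Q.map ι ≫
      (quasiIso (polynomial k d)).Q.map (roofInl ρ)) := by rw [h₃]; infer_instance
    exact mono_of_mono _ ((quasiIso (polynomial k d)).Q.map (roofInl ρ))
  rw [← cancel_mono ((quasiIso (polynomial k d)).Q.map ι), zero_comp, ← Functor.map_comp]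
  exact Q_map_comp_inrModule_eq_zero (𝟙 M) (ofModuleMap a) (by simp) a (by simp)

end

end TwistedComplex

/-! ### The derived category embeds in homotopy classes -/

namespace TwistedComplex

variable {k : Type u} [Field k]

open DGAlgebra DGAlgebra.LeftModule

noncomputable section

/-- DG modules over the polynomial algebra and homotopy classes of morphisms of complexes with an
endomorphism. -/
abbrev toHo (k : Type u) [Field k] (d : ℤ) : (polynomial k d).LeftModule ⥤ HoCat k (-d) :=
  ofModuleF k d ⋙ ho k (-d)

variable {d : ℤ} {M N P U : (polynomial k d).LeftModule}

lemma isIso_toHo_map (f : M ⟶ N) (hf : QuasiIso f.hom) : IsIso ((toHo k d).map f) :=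
  have : QuasiIso (ofModuleMap f).hom := hf
  isIso_ho_map_of_quasiIso (ofModuleMap f)

lemma quasiIso_of_mem {f : M ⟶ N} (hf : quasiIso (polynomial k d) f) : QuasiIso f.hom :=
  (HomologicalComplex.mem_quasiIso_iff _).1 hf

lemma Q_map_eq_of_toHo_map_eq {f g : M ⟶ N} (h : (toHo k d).map f = (toHo k d).map g) :
    (quasiIso (polynomial k d)).Q.map f = (quasiIso (polynomial k d)).Q.map g := by
  have h₁ : IsNull (ofModuleMap f - ofModuleMap g) := (ho_map_eq_iff _ _).1 h
  have h₂ : ofModuleMap f - ofModuleMap g = ofModuleMap (f - g) :=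
    ((ofModuleF k d).map_sub).symm
  rw [h₂] at h₁
  rw [← sub_eq_zero, ← Functor.map_sub]
  exact Q_map_eq_zero_of_isNull _ h₁

/-- The homotopy class of a morphism. -/
def hoMap (φ : ofModule M ⟶ ofModule N) : (toHo k d).obj M ⟶ (toHo k d).obj N :=
  (ho k (-d)).map φ

lemma hoMap_surjective (β : (toHo k d).obj M ⟶ (toHo k d).obj N) :
    ∃ φ : ofModule M ⟶ ofModule N, hoMap φ = β :=
  (ho k (-d)).map_surjective (X := ofModule M) (Y := ofModule N) β

lemma toHo_map_roofInl (φ : ofModule M ⟶ ofModule N) :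
    (toHo k d).map (roofInl φ) = hoMap φ ≫ (toHo k d).map (roofInr φ) :=
  ho_map_roofInl φ

lemma exists_Q_obj_eq (X : (polynomial k d).DerivedCategory) :
    ∃ M, (quasiIso (polynomial k d)).Q.obj M = X :=
  (Localization.Construction.objEquiv (quasiIso (polynomial k d))).surjective X

lemma Q_obj_injective {M N : (polynomial k d).LeftModule}
    (h : (quasiIso (polynomial k d)).Q.obj M = (quasiIso (polynomial k d)).Q.obj N) : M = N :=
  (Localization.Construction.objEquiv (quasiIso (polynomial k d))).injective h

lemma toHo_map_comp_roof {X : (polynomial k d).LeftModule} (q : X ⟶ M) (s : X ⟶ N)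
    (hq : QuasiIso q.hom) : ∃ φ : ofModule M ⟶ ofModule N,
      (toHo k d).map q ≫ hoMap φ = (toHo k d).map s := by
  have := isIso_toHo_map q hq
  obtain ⟨φ, hφ⟩ := hoMap_surjective (inv ((toHo k d).map q) ≫ (toHo k d).map s)
  exact ⟨φ, by rw [hφ, IsIso.hom_inv_id_assoc]⟩

/-- Every morphism of the derived category is a left fraction. -/
lemma exists_fraction
    (α : (quasiIso (polynomial k d)).Q.obj M ⟶ (quasiIso (polynomial k d)).Q.obj N) :
    ∃ (Z : (polynomial k d).LeftModule) (s : M ⟶ Z) (q : N ⟶ Z),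
      QuasiIso q.hom ∧ α ≫ (quasiIso (polynomial k d)).Q.map q =
        (quasiIso (polynomial k d)).Q.map s := by
  -- Every morphism of the localization is a composite of images of morphisms and formal inverses,
  -- so it suffices that fractions contain these and are closed under composition. Quantifying over
  -- representatives with `eqToHom` states this for arbitrary objects.
  let P : MorphismProperty (polynomial k d).DerivedCategory := fun X Y α =>
    ∀ (M N : (polynomial k d).LeftModule) (hM : (quasiIso (polynomial k d)).Q.obj M = X)
      (hN : (quasiIso (polynomial k d)).Q.obj N = Y),
    ∃ (Z : (polynomial k d).LeftModule) (s : M ⟶ Z) (q : N ⟶ Z),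
      QuasiIso q.hom ∧ (eqToHom hM ≫ α ≫ eqToHom hN.symm) ≫ (quasiIso (polynomial k d)).Q.map q =
        (quasiIso (polynomial k d)).Q.map s
  have : P.IsStableUnderComposition := ⟨by
    intro X Y Y' α β hα hβ M N hM hN
    obtain ⟨U, rfl⟩ := exists_Q_obj_eq Y
    subst hM hN
    obtain ⟨Z, s, q, hq, h⟩ := hα M U rfl rfl
    obtain ⟨Z', s', q', hq', h'⟩ := hβ U N rfl rfl
    -- The Ore condition: `q` is invertible in `HoCat`, so `q⁻¹ s'` is the class of a pair `φ`, and
    -- the cylinder of `φ` completes the square by strict morphisms.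
    obtain ⟨φ, hφ⟩ := toHo_map_comp_roof q s' hq
    have := quasiIso_roofInr φ
    have h₁ : (quasiIso (polynomial k d)).Q.map (q ≫ roofInl φ) =
        (quasiIso (polynomial k d)).Q.map (s' ≫ roofInr φ) := by
      apply Q_map_eq_of_toHo_map_eq
      rw [Functor.map_comp, Functor.map_comp, toHo_map_roofInl, ← hφ]
      exact (Category.assoc _ _ _).symm
    refine ⟨roof φ, s ≫ roofInl φ, q' ≫ roofInr φ, ?_, ?_⟩
    · rw [LeftModule.comp_hom]
      infer_instance
    · simp only [eqToHom_refl, Category.id_comp, Category.comp_id] at h h' ⊢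
      rw [Functor.map_comp, Functor.map_comp, ← h, Category.assoc, Category.assoc,
        ← Functor.map_comp _ q, h₁, Functor.map_comp, ← h', Category.assoc]⟩
  have hP : P = ⊤ := Localization.Construction.morphismProperty_eq_top P
    (fun X Y f M N hM hN => by
      obtain rfl := Q_obj_injective hM
      obtain rfl := Q_obj_injective hN
      refine ⟨N, f, 𝟙 N, ?_, by simp⟩
      exact inferInstanceAs (QuasiIso (𝟙 N.cx)))
    (fun X Y w hw M N hM hN => by
      obtain rfl := Q_obj_injective hM
      obtain rfl := Q_obj_injective hN
      refine ⟨M, 𝟙 M, w, quasiIso_of_mem hw, ?_⟩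
      simp only [eqToHom_refl, Category.id_comp, Category.comp_id]
      exact (Localization.Construction.wIso w hw).inv_hom_id.trans
        ((quasiIso (polynomial k d)).Q.map_id M).symm)
  have h : P α := by
    rw [hP]
    trivial
  obtain ⟨Z, s, q, hq, h⟩ := h M N rfl rfl
  exact ⟨Z, s, q, hq, by simpa using h⟩

lemma toHo_inverts (k : Type u) [Field k] (d : ℤ) :
    (quasiIso (polynomial k d)).IsInvertedBy (toHo k d) :=
  fun _ _ f hf => isIso_toHo_map f (quasiIso_of_mem hf)

/-- The embedding of the derived category of the polynomial algebra in the category of homotopy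
classes of morphisms of complexes with an endomorphism. -/
def derivedToHo (k : Type u) [Field k] (d : ℤ) :
    (polynomial k d).DerivedCategory ⥤ HoCat k (-d) :=
  Localization.Construction.lift (toHo k d) (toHo_inverts k d)

/-- The compatibility of `derivedToHo` with the localization functor. -/
def derivedToHoIso (k : Type u) [Field k] (d : ℤ) :
    (quasiIso (polynomial k d)).Q ⋙ derivedToHo k d ≅ toHo k d :=
  eqToIso (Localization.Construction.fac (toHo k d) (toHo_inverts k d))

instance : Localization.Lifting (quasiIso (polynomial k d)).Q (quasiIso (polynomial k d))
    (toHo k d) (derivedToHo k d) :=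
  ⟨derivedToHoIso k d⟩

lemma derivedToHo_map (f : M ⟶ N) :
    (derivedToHo k d).map ((quasiIso (polynomial k d)).Q.map f) =
      (derivedToHoIso k d).hom.app M ≫ (toHo k d).map f ≫ (derivedToHoIso k d).inv.app N := by
  rw [← NatTrans.naturality_assoc, Iso.hom_inv_id_app, Category.comp_id, Functor.comp_map]

instance : (derivedToHo k d).Additive where
  map_add {X Y f g} := by
    obtain ⟨M, rfl⟩ := exists_Q_obj_eq X
    obtain ⟨N, rfl⟩ := exists_Q_obj_eq Y
    let q := LocalizationPreadditive.lift f g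
    have hf : q ≫ (quasiIso (polynomial k d)).Q.map biprod.fst = f :=
      LocalizationPreadditive.lift_fst _ _
    have hg : q ≫ (quasiIso (polynomial k d)).Q.map biprod.snd = g :=
      LocalizationPreadditive.lift_snd _ _
    -- True by definition of the addition on the localized category.
    have hfg : f + g = q ≫ (quasiIso (polynomial k d)).Q.map (biprod.fst + biprod.snd) := rfl
    rw [hfg, ← hf, ← hg, Functor.map_comp, Functor.map_comp, Functor.map_comp, derivedToHo_map,
      derivedToHo_map, derivedToHo_map, Functor.map_add]
    simp only [Preadditive.add_comp, Preadditive.comp_add]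

instance : (derivedToHo k d).Linear k :=
  (Localization.functor_linear_iff (quasiIso (polynomial k d)).Q (quasiIso (polynomial k d)) k
    (toHo k d) (derivedToHo k d)).1 inferInstance

/-- A class of pairs is hit by the fraction given by the two legs of its cylinder. -/
instance : (derivedToHo k d).Full where
  map_surjective {X Y} β := by
    obtain ⟨M, rfl⟩ := exists_Q_obj_eq X
    obtain ⟨N, rfl⟩ := exists_Q_obj_eq Y
    obtain ⟨φ, hφ⟩ := hoMap_surjective
      ((derivedToHoIso k d).inv.app M ≫ β ≫ (derivedToHoIso k d).hom.app N)
    have := isIso_Q_map_of_quasiIso _ (quasiIso_roofInr φ)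
    have h₁ := isIso_toHo_map _ (quasiIso_roofInr φ)
    refine ⟨(quasiIso (polynomial k d)).Q.map (roofInl φ) ≫
      inv ((quasiIso (polynomial k d)).Q.map (roofInr φ)), ?_⟩
    have h₂ : (toHo k d).map (roofInl φ) = ((derivedToHoIso k d).inv.app M ≫ β ≫
      (derivedToHoIso k d).hom.app N) ≫ (toHo k d).map (roofInr φ) := by
      rw [← hφ]
      exact toHo_map_roofInl φ
    rw [Functor.map_comp, Functor.map_inv, IsIso.comp_inv_eq, derivedToHo_map, derivedToHo_map, h₂]
    simp

/-- Writing the difference of two morphisms as a fraction reduces to a morphism of DG modules with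
null-homotopic image, which vanishes by `Q_map_eq_zero_of_isNull`. -/
instance : (derivedToHo k d).Faithful where
  map_injective {X Y α β} h := by
    obtain ⟨M, rfl⟩ := exists_Q_obj_eq X
    obtain ⟨N, rfl⟩ := exists_Q_obj_eq Y
    obtain ⟨Z, s, q, hq, hs⟩ := exists_fraction (α - β)
    have := isIso_Q_map_of_quasiIso _ hq
    have h₁ : (toHo k d).map s = (toHo k d).map 0 := by
      have h₂ : (derivedToHo k d).map ((quasiIso (polynomial k d)).Q.map s) = 0 := by
        rw [← hs, Functor.map_comp, Functor.map_sub, h, sub_self, zero_comp]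
      rw [derivedToHo_map] at h₂
      rw [← cancel_mono ((derivedToHoIso k d).inv.app Z),
        ← cancel_epi ((derivedToHoIso k d).hom.app M), h₂]
      simp
    rw [← sub_eq_zero, ← cancel_mono ((quasiIso (polynomial k d)).Q.map q), zero_comp, hs,
      Q_map_eq_of_toHo_map_eq h₁, Functor.map_zero]

/-- Compatibility of the passage to homotopy classes with suspensions. -/
def shiftToHoIso (k : Type u) [Field k] (d n : ℤ) :
    CategoryTheory.shiftFunctor (polynomial k d).LeftModule n ⋙ toHo k d ≅
      toHo k d ⋙ hoShift k (-d) n :=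
  NatIso.ofComponents (fun M => Iso.refl _) (fun {M N} f => by
    refine (Category.comp_id _).trans (Eq.trans ?_ (Category.id_comp _).symm)
    refine congrArg (ho k (-d)).map ?_
    apply hom_ext
    · rfl
    · exact ((congrArg ((n * (-d - 1)).negOnePow • ·) (Cochain.shift_zero M.cx N.cx _ n)).trans
        (smul_zero _)).symm)

/-- Compatibility of the embedding of the derived category with suspensions. -/
def shiftDerivedToHoIso (k : Type u) [Field k] (d n : ℤ) :
    CategoryTheory.shiftFunctor (polynomial k d).DerivedCategory n ⋙ derivedToHo k d ≅
      derivedToHo k d ⋙ hoShift k (-d) n :=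
  Localization.liftNatIso (quasiIso (polynomial k d)).Q (quasiIso (polynomial k d))
    ((quasiIso (polynomial k d)).Q ⋙ CategoryTheory.shiftFunctor _ n ⋙ derivedToHo k d)
    ((quasiIso (polynomial k d)).Q ⋙ derivedToHo k d ⋙ hoShift k (-d) n) _ _
    (Functor.isoWhiskerRight ((quasiIso (polynomial k d)).Q.commShiftIso n).symm
        (derivedToHo k d) ≪≫ Functor.associator _ _ _ ≪≫
      Functor.isoWhiskerLeft (CategoryTheory.shiftFunctor _ n) (derivedToHoIso k d) ≪≫
      shiftToHoIso k d n ≪≫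
      Functor.isoWhiskerRight (derivedToHoIso k d).symm (hoShift k (-d) n))

end

end TwistedComplex

/-! ### Complexes with finite dimensional cohomology -/

namespace CochainComplex

variable {k : Type u} [Field k]

/-- A complex has finite cohomology if its total cohomology is finite dimensional. -/
structure HasFiniteHomology (K : CochainComplex (ModuleCat.{u} k) ℤ) : Prop where
  finite (i : ℤ) : Module.Finite k (K.homology i)
  finite_support : {i | Nontrivial (K.homology i)}.Finite

variable {K L M : CochainComplex (ModuleCat.{u} k) ℤ}

lemma HasFiniteHomology.of_mono (hL : HasFiniteHomology L)
    (f : ∀ i, K.homology i ⟶ L.homology i) (hf : ∀ i, Mono (f i)) : HasFiniteHomology K where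
  finite i := by
    have := hL.finite i
    exact Module.Finite.of_injective (f i).hom ((ModuleCat.mono_iff_injective _).1 (hf i))
  finite_support := hL.finite_support.subset fun i hi => by
    have : Nontrivial (K.homology i) := hi
    exact ((ModuleCat.mono_iff_injective _).1 (hf i)).nontrivial

lemma HasFiniteHomology.shift (hK : HasFiniteHomology K) (n : ℤ) :
    HasFiniteHomology (K⟦n⟧) := by
  have e (i : ℤ) : (K⟦n⟧).homology i ≅ K.homology (n + i) :=
    (ShiftSequence.shiftIso (ModuleCat.{u} k) n i (n + i) rfl).app K
  constructor
  · intro i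
    have := hK.finite (n + i)
    exact Module.Finite.of_injective (e i).hom.hom
      ((ModuleCat.mono_iff_injective _).1 inferInstance)
  · refine (hK.finite_support.preimage (f := (n + ·)) (add_right_injective n).injOn).subset ?_
    intro i hi
    have : Nontrivial ((K⟦n⟧).homology i) := hi
    exact ((ModuleCat.mono_iff_injective (e i).hom).1 inferInstance).nontrivial

/-- The middle term of an exact sequence is finite dimensional, or zero, when the outer terms are.
The offsets `a` and `b` let the same argument serve all three positions of the long exact sequence
of a cone. -/
lemma HasFiniteHomology.of_exact (hK : HasFiniteHomology K) (hM : HasFiniteHomology M) (a b : ℤ)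
    (h : ∀ i, ∃ S : ShortComplex (ModuleCat.{u} k), S.Exact ∧ Nonempty (S.X₁ ≅ K.homology (i + a)) ∧
      Nonempty (S.X₂ ≅ L.homology i) ∧ Nonempty (S.X₃ ≅ M.homology (i + b))) :
    HasFiniteHomology L := by
  constructor
  · intro i
    obtain ⟨S, hS, ⟨e₁⟩, ⟨e₂⟩, ⟨e₃⟩⟩ := h i
    have := hK.finite (i + a)
    have := hM.finite (i + b)
    have := Module.Finite.equiv e₁.toLinearEquiv.symm
    have := Module.Finite.equiv e₃.toLinearEquiv.symm
    have : IsNoetherian k S.X₂ :=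
      isNoetherian_of_range_eq_ker S.f.hom S.g.hom hS.moduleCat_range_eq_ker
    exact Module.Finite.equiv e₂.toLinearEquiv
  · refine ((hK.finite_support.preimage (f := (· + a)) (add_left_injective a).injOn).union
      (hM.finite_support.preimage (f := (· + b)) (add_left_injective b).injOn)).subset ?_
    intro i hi
    obtain ⟨S, hS, ⟨e₁⟩, ⟨e₂⟩, ⟨e₃⟩⟩ := h i
    by_contra hc
    simp only [Set.mem_union, Set.mem_preimage, Set.mem_ofPred_eq, not_or,
      not_nontrivial_iff_subsingleton] at hc
    obtain ⟨h₁, h₃⟩ := hc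
    have : Subsingleton S.X₁ := e₁.toLinearEquiv.toEquiv.subsingleton
    have : Subsingleton S.X₃ := e₃.toLinearEquiv.toEquiv.subsingleton
    have h₂ := hS.isZero_X₂ ((ModuleCat.isZero_of_subsingleton S.X₁).eq_of_src _ _)
      ((ModuleCat.isZero_of_subsingleton S.X₃).eq_of_tgt _ _)
    have := ModuleCat.subsingleton_of_isZero h₂
    have : Subsingleton (L.homology i) := e₂.toLinearEquiv.symm.toEquiv.subsingleton
    exact not_nontrivial _ hi

section

variable (f : K ⟶ L)

open HomotopyCategory

/-- The long exact sequence of a mapping cone. -/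
lemma exact_mappingCone (i : ℤ) :
    (∃ S : ShortComplex (ModuleCat.{u} k), S.Exact ∧ Nonempty (S.X₁ ≅ K.homology i) ∧
      Nonempty (S.X₂ ≅ L.homology i) ∧ Nonempty (S.X₃ ≅ (mappingCone f).homology i)) ∧
    (∃ S : ShortComplex (ModuleCat.{u} k), S.Exact ∧ Nonempty (S.X₁ ≅ L.homology i) ∧
      Nonempty (S.X₂ ≅ (mappingCone f).homology i) ∧ Nonempty (S.X₃ ≅ K.homology (i + 1))) ∧
    (∃ S : ShortComplex (ModuleCat.{u} k), S.Exact ∧ Nonempty (S.X₁ ≅ (mappingCone f).homology i) ∧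
      Nonempty (S.X₂ ≅ K.homology (i + 1)) ∧ Nonempty (S.X₃ ≅ L.homology (i + 1))) := by
  let F := HomotopyCategory.homologyFunctor (ModuleCat.{u} k) (ComplexShape.up ℤ) 0
  have hT := HomotopyCategory.mappingCone_triangleh_distinguished f
  have e (K : CochainComplex (ModuleCat.{u} k) ℤ) (n : ℤ) :
      (F.shift n).obj ((HomotopyCategory.quotient _ _).obj K) ≅ K.homology n :=
    (homologyFunctorFactors (ModuleCat.{u} k) (ComplexShape.up ℤ) n).app K
  exact ⟨⟨_, F.homologySequence_exact₂ _ hT i, ⟨e _ _⟩, ⟨e _ _⟩, ⟨e _ _⟩⟩,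
    ⟨_, F.homologySequence_exact₃ _ hT i _ rfl, ⟨e _ _⟩, ⟨e _ _⟩, ⟨e _ _⟩⟩,
    ⟨_, F.homologySequence_exact₁ _ hT i _ rfl, ⟨e _ _⟩, ⟨e _ _⟩, ⟨e _ _⟩⟩⟩

lemma HasFiniteHomology.of_mappingCone₂ (hK : HasFiniteHomology K)
    (hM : HasFiniteHomology (mappingCone f)) : HasFiniteHomology L :=
  .of_exact hK hM 0 0 fun i => by
    simpa using (exact_mappingCone f i).1

lemma HasFiniteHomology.of_mappingCone₃ (hK : HasFiniteHomology K)
    (hL : HasFiniteHomology L) : HasFiniteHomology (mappingCone f) :=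
  .of_exact hL hK 0 1 fun i => by
    simpa using (exact_mappingCone f i).2.1

lemma HasFiniteHomology.of_mappingCone₁ (hL : HasFiniteHomology L)
    (hM : HasFiniteHomology (mappingCone f)) : HasFiniteHomology K :=
  .of_exact hM hL (-1) 0 fun i => by
    obtain ⟨j, rfl⟩ : ∃ j, i = j + 1 := ⟨i - 1, by lia⟩
    simpa using (exact_mappingCone f j).2.2

end

end CochainComplex

/-! ### Finite cohomology on the thick subcategory generated by `k` -/

namespace DGAlgebra

variable {k : Type u} [Field k] {A : DGAlgebra k}

open LeftModule DGAlgebra.DerivedCategory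

noncomputable section

/-- The cohomology of objects of the derived category. -/
def homologyFunctor (A : DGAlgebra k) (i : ℤ) : A.DerivedCategory ⥤ ModuleCat.{u} k :=
  Localization.Construction.lift
    (forget A ⋙ HomologicalComplex.homologyFunctor (ModuleCat.{u} k) (ComplexShape.up ℤ) i)
    (fun M N f hf => by
      have : QuasiIso f.hom := (HomologicalComplex.mem_quasiIso_iff _).1 hf
      exact inferInstanceAs (IsIso (HomologicalComplex.homologyMap f.hom i)))

/-- The compatibility of the cohomology with the localization functor. -/
def homologyFunctorIso (A : DGAlgebra k) (i : ℤ) :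
    (LeftModule.quasiIso A).Q ⋙ homologyFunctor A i ≅
      forget A ⋙ HomologicalComplex.homologyFunctor (ModuleCat.{u} k) (ComplexShape.up ℤ) i :=
  eqToIso (Localization.Construction.fac _ _)

/-- The objects of the derived category with finite dimensional total cohomology. -/
def hasFiniteHomology (A : DGAlgebra k) : ObjectProperty A.DerivedCategory := fun X =>
  ∀ (M : A.LeftModule), ((LeftModule.quasiIso A).Q.obj M ≅ X) → HasFiniteHomology M.cx

/-- Cohomology is a functor on the derived category, and functors preserve retracts. -/
lemma hasFiniteHomology_of_retract {X : A.DerivedCategory} {M : A.LeftModule}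
    (r : Retract X ((LeftModule.quasiIso A).Q.obj M)) (hM : HasFiniteHomology M.cx) :
    hasFiniteHomology A X := by
  intro N e
  let r' (i : ℤ) : Retract (N.cx.homology i) (M.cx.homology i) :=
    ((Retract.ofIso ((homologyFunctorIso A i).app N).symm).trans
      (((Retract.ofIso e).trans r).map (homologyFunctor A i))).trans
        (Retract.ofIso ((homologyFunctorIso A i).app M))
  exact hM.of_mono (fun i => (r' i).i) (fun i => inferInstance)

lemma hasFiniteHomology_Q_obj {M : A.LeftModule} (hM : HasFiniteHomology M.cx) :
    hasFiniteHomology A ((LeftModule.quasiIso A).Q.obj M) :=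
  hasFiniteHomology_of_retract (Retract.refl _) hM

lemma hasFiniteHomology_Q_obj_iff (M : A.LeftModule) :
    hasFiniteHomology A ((LeftModule.quasiIso A).Q.obj M) ↔ HasFiniteHomology M.cx :=
  ⟨fun h => h M (Iso.refl _), hasFiniteHomology_Q_obj⟩

lemma hasFiniteHomology_of_iso {X Y : A.DerivedCategory} (e : X ≅ Y)
    (h : hasFiniteHomology A X) : hasFiniteHomology A Y :=
  fun M e' => h M (e' ≪≫ e.symm)

theorem isThick_hasFiniteHomology (A : DGAlgebra k) : IsThick (hasFiniteHomology A) where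
  of_iso e h := hasFiniteHomology_of_iso e h
  shift X n h := by
    obtain ⟨M, rfl⟩ := (Localization.Construction.objEquiv (LeftModule.quasiIso A)).surjective X
    refine hasFiniteHomology_of_iso (((LeftModule.quasiIso A).Q.commShiftIso n).app M)
      (hasFiniteHomology_Q_obj ?_)
    exact (h M (Iso.refl _)).shift n
  obj₁ T := by
    rintro ⟨M, N, f, ⟨e⟩⟩ h₂ h₃
    refine hasFiniteHomology_of_iso (Pretriangulated.Triangle.π₁.mapIso e).symm
      (hasFiniteHomology_Q_obj (M := M) ?_)
    exact .of_mappingCone₁ f.hom (h₂ N (Pretriangulated.Triangle.π₂.mapIso e).symm)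
      (h₃ (LeftModule.cone f) (Pretriangulated.Triangle.π₃.mapIso e).symm)
  obj₂ T := by
    rintro ⟨M, N, f, ⟨e⟩⟩ h₁ h₃
    refine hasFiniteHomology_of_iso (Pretriangulated.Triangle.π₂.mapIso e).symm
      (hasFiniteHomology_Q_obj (M := N) ?_)
    exact .of_mappingCone₂ f.hom (h₁ M (Pretriangulated.Triangle.π₁.mapIso e).symm)
      (h₃ (LeftModule.cone f) (Pretriangulated.Triangle.π₃.mapIso e).symm)
  obj₃ T := by
    rintro ⟨M, N, f, ⟨e⟩⟩ h₁ h₂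
    refine hasFiniteHomology_of_iso (Pretriangulated.Triangle.π₃.mapIso e).symm
      (hasFiniteHomology_Q_obj (M := LeftModule.cone f) ?_)
    exact .of_mappingCone₃ f.hom (h₁ M (Pretriangulated.Triangle.π₁.mapIso e).symm)
      (h₂ N (Pretriangulated.Triangle.π₂.mapIso e).symm)
  of_retract {X Y} r h := by
    obtain ⟨M, rfl⟩ := (Localization.Construction.objEquiv (LeftModule.quasiIso A)).surjective Y
    exact hasFiniteHomology_of_retract r (h M (Iso.refl _))

lemma hasFiniteHomology_residueModule (k : Type u) [Field k] (d : ℤ) :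
    HasFiniteHomology (residueModule k d).cx := by
  have e (i : ℤ) : ((residueModule k d).cx).homology i ≅ ModuleCat.of k (residuePart k i) := by
    exact (ShortComplex.HomologyData.ofZeros (((residueModule k d).cx).sc i)
      rfl rfl).left.homologyIso
  constructor
  · intro i
    exact Module.Finite.equiv (e i).toLinearEquiv.symm
  · refine (Set.finite_singleton (0 : ℤ)).subset fun i hi => ?_
    have : Nontrivial (((residueModule k d).cx).homology i) := hi
    have := (e i).toLinearEquiv.symm.toEquiv.nontrivial
    by_contra h
    obtain ⟨x, hx⟩ := exists_ne (0 : residuePart k i)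
    exact hx (Subtype.ext (x.2 h))

/-- Finite cohomology defines a thick subcategory containing `k`. This inclusion is enough: the
duality argument uses only finite dimensional cohomology of the objects. -/
lemma hasFiniteHomology_of_thick {k : Type u} [Field k] {d : ℤ}
    {X : (polynomial k d).DerivedCategory}
    (h : thick (DerivedCategory.Q.obj (residueModule k d)) X) :
    hasFiniteHomology (polynomial k d) X :=
  h _ (isThick_hasFiniteHomology _) (hasFiniteHomology_Q_obj (hasFiniteHomology_residueModule k d))

end

end DGAlgebra

/-! ### Minimal complexes and the supertrace -/

namespace CochainComplex

variable {k : Type u} [Field k]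

/-- A complex is finite and minimal if it is finite dimensional with zero differential. -/
structure IsFiniteMinimal (K : CochainComplex (ModuleCat.{u} k) ℤ) : Prop where
  d_eq_zero (i j : ℤ) : K.d i j = 0
  finite (i : ℤ) : Module.Finite k (K.X i)
  finite_support : {i | Nontrivial (K.X i)}.Finite

lemma HasFiniteHomology.isFiniteMinimal {K : CochainComplex (ModuleCat.{u} k) ℤ}
    (hK : HasFiniteHomology K) : IsFiniteMinimal (homologyComplex K) where
  d_eq_zero _ _ := rfl
  finite := hK.finite
  finite_support := hK.finite_support

section

variable {K L M : CochainComplex (ModuleCat.{u} k) ℤ} {n m a nm : ℤ}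

lemma comp_shift_rightUnshift (x : Cochain K (L⟦a⟧) n) (y : Cochain L M m) (h : n + m = nm)
    (n' : ℤ) (hn' : n + a = n') (nm' : ℤ) (hnm' : nm + a = nm') :
    (x.comp (y.shift a) h).rightUnshift nm' hnm' =
      (x.rightUnshift n' hn').comp y (by lia) := by
  refine Cochain.ext _ _ fun p q hpq => ?_
  obtain ⟨r, rfl⟩ : ∃ r, q = r + a := ⟨q - a, by lia⟩
  rw [Cochain.rightUnshift_v _ _ _ _ _ _ r (by lia),
    Cochain.comp_v _ _ _ p (p + n) r rfl (by lia), Cochain.shift_v',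
    Cochain.comp_v _ _ _ p (p + n + a) (r + a) (by lia) (by lia),
    Cochain.rightUnshift_v _ _ _ _ _ _ (p + n) rfl]
  simp
  exact congrArg (· ≫ _) (Category.comp_id _).symm

lemma δ_eq_zero_of_d_eq_zero (hK : ∀ i j, K.d i j = 0) (hL : ∀ i j, L.d i j = 0)
    (z : Cochain K L n) (m : ℤ) : δ n m z = 0 := by
  by_cases h : n + 1 = m
  · refine Cochain.ext _ _ fun i j hij => ?_
    rw [δ_v n m h z i j hij (j - 1) (i + 1) rfl rfl]
    simp [hK, hL]
  · exact δ_shape _ _ h _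

lemma IsFiniteMinimal.shift_d (hK : IsFiniteMinimal K) (a i j : ℤ) : (K⟦a⟧).d i j = 0 := by
  have h : a.negOnePow • K.d (i + a) (j + a) = 0 := by rw [hK.d_eq_zero, smul_zero]
  exact h

/-- A cochain is determined by its components in the finitely many degrees where the source is
nonzero. -/
lemma IsFiniteMinimal.finite_cochain (hK : IsFiniteMinimal K) (hL : IsFiniteMinimal L) (n : ℤ) :
    Module.Finite k (Cochain K L n) := by
  have := hK.finite
  have := hL.finite
  let S := hK.finite_support.toFinset
  let f : Cochain K L n →ₗ[k] ∀ i : S, (K.X i.1 →ₗ[k] L.X (i.1 + n)) :=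
    { toFun z i := (z.v i.1 (i.1 + n) rfl).hom
      map_add' _ _ := by ext; simp
      map_smul' _ _ := by ext; simp }
  refine Module.Finite.of_injective f fun x y h => ?_
  refine Cochain.ext _ _ fun i j hij => ?_
  subst hij
  by_cases hi : i ∈ S
  · exact ModuleCat.hom_ext (congrFun h ⟨i, hi⟩)
  · have : Subsingleton (K.X i) := by
      rw [← not_nontrivial_iff_subsingleton]
      simpa [S] using hi
    exact (ModuleCat.isZero_of_subsingleton (K.X i)).eq_of_src _ _

end

noncomputable section

variable {K L M : CochainComplex (ModuleCat.{u} k) ℤ}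

/-- The alternating sum of the traces of an endomorphism of degree `0`. -/
def supertrace (hK : IsFiniteMinimal K) : Cochain K K 0 →ₗ[k] k where
  toFun z := ∑ i ∈ hK.finite_support.toFinset,
    i.negOnePow • LinearMap.trace k (K.X i) (z.v i i (add_zero i)).hom
  map_add' x y := by simp [Finset.sum_add_distrib]
  map_smul' r x := by simp [Finset.mul_sum, mul_smul_comm]

lemma support_trace_subset (hK : IsFiniteMinimal K) (z : Cochain K K 0) :
    (Function.support fun i : ℤ =>
      i.negOnePow • LinearMap.trace k (K.X i) (z.v i i (add_zero i)).hom) ⊆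
        hK.finite_support.toFinset := by
  intro i hi
  by_contra h
  have : Subsingleton (K.X i) := by
    rw [← not_nontrivial_iff_subsingleton]
    simpa using h
  apply hi
  have : (z.v i i (add_zero i)).hom = 0 := LinearMap.ext fun x => Subsingleton.elim _ _
  simp [this]

/-- Summing over all integers frees the formula from the support of `K`, so that traces on different
complexes can be compared by translating the index. -/
lemma supertrace_eq_finsum (hK : IsFiniteMinimal K) (z : Cochain K K 0) : supertrace hK z =
    ∑ᶠ i : ℤ, i.negOnePow • LinearMap.trace k (K.X i) (z.v i i (add_zero i)).hom :=
  (finsum_eq_sum_of_support_subset _ (support_trace_subset hK z)).symm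

/-- Degree `i` of `K` is matched with degree `i + p` of `L`, and the ordinary trace is cyclic. The
sign `(-1) ^ p` compares the weights `(-1) ^ i` and `(-1) ^ (i + p)`. -/
lemma supertrace_comp_comm (hK : IsFiniteMinimal K) (hL : IsFiniteMinimal L) {p q : ℤ}
    (x : Cochain K L p) (y : Cochain L K q) (h : p + q = 0) (h' : q + p = 0) :
    supertrace hK (x.comp y h) = p.negOnePow • supertrace hL (y.comp x h') := by
  have := hK.finite
  have := hL.finite
  rw [supertrace_eq_finsum, supertrace_eq_finsum,
    smul_finsum' _ ((Finset.finite_toSet _).subset (support_trace_subset hL _)),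
    ← finsum_comp_equiv (Equiv.addRight p)
    (f := fun i : ℤ => p.negOnePow • i.negOnePow • _)]
  refine finsum_congr fun i => ?_
  rw [Equiv.coe_addRight, Cochain.comp_v _ _ _ i (i + p) i rfl (by lia),
    Cochain.comp_v _ _ _ (i + p) i (i + p) (by lia) rfl, smul_smul, ← Int.negOnePow_add,
    ModuleCat.hom_comp, ModuleCat.hom_comp, LinearMap.trace_comp_comm']
  congr 1
  exact (Int.negOnePow_eq_iff _ _).2 ⟨-p, by ring⟩

/-- A rank one map suffices: if `f v ≠ 0` and `ψ (f v) ≠ 0`, then `g = ψ(-) v` gives trace `ψ (f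
v)`. -/
lemma exists_trace_comp_ne_zero {V W : Type*} [AddCommGroup V] [Module k V] [AddCommGroup W]
    [Module k W] [Module.Finite k V] (f : V →ₗ[k] W) (hf : f ≠ 0) :
    ∃ g : W →ₗ[k] V, LinearMap.trace k V (g ∘ₗ f) ≠ 0 := by
  obtain ⟨v, hv⟩ : ∃ v, f v ≠ 0 := by
    by_contra! h
    exact hf (LinearMap.ext h)
  obtain ⟨ψ, hψ⟩ : ∃ ψ : Module.Dual k W, ψ (f v) ≠ 0 := by
    by_contra! h
    exact hv ((Module.forall_dual_apply_eq_zero_iff k _).1 h)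
  refine ⟨LinearMap.toSpanSingleton k V v ∘ₗ ψ, ?_⟩
  rw [LinearMap.comp_assoc, LinearMap.trace_comp_comm']
  have : (ψ ∘ₗ f) ∘ₗ LinearMap.toSpanSingleton k V v = ψ (f v) • LinearMap.id := by
    ext
    simp
  rw [this, map_smul, LinearMap.trace_id]
  simpa using hψ

lemma exists_supertrace_comp_ne_zero (hK : IsFiniteMinimal K) {p q : ℤ} (x : Cochain K L p)
    (hx : x ≠ 0) (h : p + q = 0) : ∃ y : Cochain L K q, supertrace hK (x.comp y h) ≠ 0 := by
  have := hK.finite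
  obtain ⟨i, j, hij, hne⟩ : ∃ (i j : ℤ) (hij : i + p = j), x.v i j hij ≠ 0 := by
    by_contra! hc
    exact hx (Cochain.ext _ _ fun i j hij => by rw [hc, Cochain.zero_v])
  obtain ⟨g, hg⟩ := exists_trace_comp_ne_zero (x.v i j hij).hom
    (fun h => hne (ModuleCat.hom_ext h))
  refine ⟨Cochain.single (ModuleCat.ofHom g) q, ?_⟩
  rw [supertrace_eq_finsum, finsum_eq_single _ i]
  · rw [Cochain.comp_v _ _ _ i j i hij (by lia), Cochain.single_v]
    intro h
    rw [smul_eq_zero_iff_eq] at h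
    exact hg h
  · intro i' hi'
    rw [Cochain.comp_v _ _ _ i' (i' + p) i' rfl (by lia), Cochain.single_v_eq_zero _ _ _ _ _
      (by lia)]
    simp

/-- The trace pairing. -/
def tracePairing (hK : IsFiniteMinimal K) (L : CochainComplex (ModuleCat.{u} k) ℤ) {p q : ℤ}
    (h : p + q = 0) : Cochain K L p →ₗ[k] Cochain L K q →ₗ[k] k :=
  LinearMap.mk₂ k (fun x y => supertrace hK (x.comp y h)) (fun _ _ _ => by simp)
    (fun _ _ _ => by simp) (fun _ _ _ => by simp) (fun _ _ _ => by simp)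

/-- Cochain spaces are finite dimensional, so nondegeneracy on both sides is enough. The second side
follows from the first by cyclicity. -/
lemma isPerfPair_tracePairing (hK : IsFiniteMinimal K) (hL : IsFiniteMinimal L) {p q : ℤ}
    (h : p + q = 0) : (tracePairing hK L h).IsPerfPair := by
  have := hK.finite_cochain hL p
  refine LinearMap.IsPerfPair.of_injective ?_ ?_
  · refine (injective_iff_map_eq_zero _).2 fun x hx => ?_
    by_contra hne
    obtain ⟨y, hy⟩ := exists_supertrace_comp_ne_zero hK x hne h
    exact hy (LinearMap.congr_fun hx y)
  · refine (injective_iff_map_eq_zero _).2 fun y hy => ?_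
    by_contra hne
    obtain ⟨x, hx⟩ := exists_supertrace_comp_ne_zero hL y hne ((add_comm q p).trans h)
    apply hx
    rw [supertrace_comp_comm hL hK y x _ h]
    have : supertrace hK (x.comp y h) = 0 := LinearMap.congr_fun hy x
    rw [this, smul_zero]

end

end CochainComplex

/-! ### The trace form on morphisms to the suspension -/

namespace TwistedComplex

variable {k : Type u} [Field k] {e w : ℤ} {U V W : TwistedComplex k e}

noncomputable section

/-- Cochains with values in a suspension, as cochains of another degree. -/
def unshift (U V : TwistedComplex k e) (w n n' : ℤ) (h : n + w = n') :
    Cochain U.cx (shiftObj w V).cx n ≃ₗ[k] Cochain U.cx V.cx n' :=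
  (Cochain.rightShiftLinearEquiv k U.cx V.cx n' w n h).symm

section

variable {n n' m m' p : ℤ}

lemma unshift_units_smul (h : n + w = n') (r : ℤˣ) (x : Cochain U.cx (shiftObj w V).cx n) :
    unshift U V w n n' h (r • x) = r • unshift U V w n n' h x :=
  Cochain.rightUnshift_units_smul x n' h r

lemma unshift_comp (x : Cochain U.cx V.cx n) (y : Cochain V.cx (shiftObj w W).cx m)
    (h : n + m = p) (p' : ℤ) (hp : p + w = p') (hm : m + w = m') :
    unshift U W w p p' hp (x.comp y h) = x.comp (unshift V W w m m' hm y) (by lia) :=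
  Cochain.rightUnshift_comp x y h p' hp m' hm

lemma unshift_comp_shift (x : Cochain U.cx (shiftObj w V).cx n) (y : Cochain V.cx W.cx m)
    (h : n + m = p) (p' : ℤ) (hp : p + w = p') (hn : n + w = n') :
    unshift U W w p p' hp (Cochain.comp (K := (shiftObj w W).cx) x (y.shift w) h) =
      (unshift U V w n n' hn x).comp y (by lia) :=
  comp_shift_rightUnshift x y h n' hn p' hp

/-- The sign `(-1) ^ (w e)` comes from the suspended endomorphism, so `unshift` turns `ad` into a
commutator twisted by that sign. -/
lemma unshift_ad (x : Cochain U.cx (shiftObj w V).cx n) (h : n + e = m) (hn : n + w = n')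
    (hm : m + w = m') : unshift U V w m m' hm (ad U (shiftObj w V) n m h x) =
      (w * e).negOnePow • (unshift U V w n n' hn x).comp V.τ (by lia) -
        (n * e).negOnePow • U.τ.comp (unshift U V w n n' hn x) (by lia) := by
  unfold ad
  rw [map_sub, unshift_units_smul, unshift_comp (V := U) _ _ _ _ _ hn]
  congr 1
  refine (congrArg _ (Cochain.comp_units_smul x (w * e).negOnePow (V.τ.shift w) h)).trans ?_
  rw [unshift_units_smul]
  congr 1
  exact unshift_comp_shift (V := V) x V.τ h m' hm hn

end

lemma δ_eq_zero_of_isFiniteMinimal (hU : IsFiniteMinimal U.cx) (hV : IsFiniteMinimal V.cx)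
    (a n m : ℤ) (z : Cochain U.cx (shiftObj a V).cx n) : δ n m z = 0 :=
  δ_eq_zero_of_d_eq_zero hU.d_eq_zero (hV.shift_d a) z m

/-- The trace of a morphism from a finite minimal complex to its suspension. -/
def homTrace (hV : IsFiniteMinimal V.cx) (hw : e - 1 + w = 0) : (V ⟶ shiftObj w V) →ₗ[k] k where
  -- The homotopy has degree `e - 1` with values in the suspension by `w`, that is, degree `e - 1 +
  -- w = 0` with values in `V`. This is the relation that singles out `w`.
  toFun f := supertrace hV (unshift V V w (e - 1) 0 hw f.htpy)
  map_add' f g := by rw [add_htpy, map_add, map_add]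
  map_smul' r f := by rw [smul_htpy, map_smul, map_smul, RingHom.id_apply]

lemma homTrace_apply (hV : IsFiniteMinimal V.cx) (hw : e - 1 + w = 0) (f : V ⟶ shiftObj w V) :
    homTrace hV hw f = supertrace hV (unshift V V w (e - 1) 0 hw f.htpy) := rfl

lemma supertrace_units_smul {K : CochainComplex (ModuleCat.{u} k) ℤ} (hK : IsFiniteMinimal K)
    (r : ℤˣ) (z : Cochain K K 0) : supertrace hK (r • z) = r • supertrace hK z := by
  obtain rfl | rfl := Int.units_eq_one_or r <;> simp

/-- Differentials vanish, so a null-homotopic morphism has a commutator with `τ` as homotopy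
component, and the supertrace of this commutator is zero by cyclicity. The signs agree because `w =
1 - e` and `e (e - 1)` is even. -/
lemma IsNull.homTrace_eq_zero (hV : IsFiniteMinimal V.cx) (hw : e - 1 + w = 0)
    {f : V ⟶ shiftObj w V} (hf : IsNull f) : homTrace hV hw f = 0 := by
  obtain ⟨h, g, -, hg⟩ := hf
  rw [homTrace_apply, hg, δ_eq_zero_of_isFiniteMinimal hV hV, add_zero, unshift_units_smul,
    unshift_ad (n' := -1 + w) _ _ rfl, supertrace_units_smul, map_sub, supertrace_units_smul,
    supertrace_units_smul, supertrace_comp_comm hV hV _ V.τ _ (by lia), smul_smul,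
    ← Int.negOnePow_add]
  have : (w * e + (-1 + w)).negOnePow = (-1 * e).negOnePow := by
    refine (Int.negOnePow_eq_iff _ _).2 ?_
    obtain rfl : w = 1 - e := by lia
    rw [show (1 - e) * e + (-1 + (1 - e)) - -1 * e = -(e * (e - 1)) by ring]
    exact (Int.even_mul_pred_self e).neg
  rw [this, sub_self, smul_zero]

lemma homTrace_comp (hV : IsFiniteMinimal V.cx) (hw : e - 1 + w = 0)
    (f : V ⟶ W) (φ : W ⟶ shiftObj w V) : homTrace hV hw (f ≫ φ) =
      supertrace hV ((Cochain.ofHom f.hom).comp (unshift W V w (e - 1) 0 hw φ.htpy)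
        (add_zero 0)) +
      supertrace hV (f.htpy.comp (unshift W V w 0 w (zero_add w) (Cochain.ofHom φ.hom)) hw) := by
  rw [homTrace_apply, comp_htpy, map_add, map_add, unshift_comp, unshift_comp]

lemma homTrace_comp_shiftMap (hV : IsFiniteMinimal V.cx) (hw : e - 1 + w = 0)
    (f : W ⟶ V) (φ : V ⟶ shiftObj w W) : homTrace hV hw (φ ≫ shiftMap w f) =
      (w * (e - 1)).negOnePow • supertrace hV
        ((unshift V W w 0 w (zero_add w) (Cochain.ofHom φ.hom)).comp f.htpy (by lia)) +
      supertrace hV ((unshift V W w (e - 1) 0 hw φ.htpy).comp (Cochain.ofHom f.hom)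
        (add_zero 0)) := by
  rw [homTrace_apply, comp_htpy, map_add, map_add]
  congr 1
  · rw [← supertrace_units_smul]
    refine congrArg _ ?_
    refine (congrArg _ (Cochain.comp_units_smul (Cochain.ofHom φ.hom)
      (w * (e - 1)).negOnePow (f.htpy.shift w) _)).trans ?_
    rw [unshift_units_smul]
    congr 1
    exact unshift_comp_shift (V := W) _ _ _ _ _ _
  · refine congrArg _ ?_
    have := unshift_comp_shift (V := W) φ.htpy (Cochain.ofHom f.hom) (add_zero _) 0 hw hw
    rw [DGAlgebra.LeftModule.shift_ofHom] at this
    exact this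

/-- Cyclicity of the supertrace exchanges the two summands of the traces. The sign `(-1) ^ (e - 1)`
from moving `f.htpy` equals the sign `(-1) ^ (w (e - 1))` of the suspended homotopy, again because
`w = 1 - e`. -/
lemma homTrace_comm (hV : IsFiniteMinimal V.cx) (hW : IsFiniteMinimal W.cx) (hw : e - 1 + w = 0)
    (f : V ⟶ W) (φ : W ⟶ shiftObj w V) :
    homTrace hV hw (f ≫ φ) = homTrace hW hw (φ ≫ shiftMap w f) := by
  rw [homTrace_comp, homTrace_comp_shiftMap, supertrace_comp_comm hV hW _ _ _ (add_zero 0),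
    supertrace_comp_comm hV hW f.htpy _ _ (by lia), add_comm, Int.negOnePow_zero, one_smul]
  congr 2
  refine (Int.negOnePow_eq_iff _ _).2 ?_
  obtain rfl : w = 1 - e := by lia
  have := Int.even_mul_pred_self e
  convert this using 1
  ring

lemma isNull_of_hom_eq_zero (hV : IsFiniteMinimal V.cx) (hW : IsFiniteMinimal W.cx) {f : V ⟶ W}
    (hf : f.hom = 0) (h : Cochain V.cx W.cx (-1))
    (hh : f.htpy = ad V W (-1) (e - 1) (by lia) h) : IsNull f := by
  refine ⟨e.negOnePow • h, 0, ?_, ?_⟩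
  · rw [δ_eq_zero_of_d_eq_zero hV.d_eq_zero hW.d_eq_zero, hf, Cochain.ofHom_zero]
  · rw [ad_units_smul, negOnePow_smul_smul, hh, δ_zero, add_zero]

/-- A morphism to a suspension with zero homotopy. -/
lemma exists_hom_of_comm (hV : IsFiniteMinimal V.cx) (hW : IsFiniteMinimal W.cx)
    (hw : e - 1 + w = 0) (z : Cochain W.cx V.cx w)
    (hz : z.comp V.τ rfl = W.τ.comp z (add_comm e w)) :
    ∃ φ : W ⟶ shiftObj w V, φ.htpy = 0 ∧
      unshift W V w 0 w (zero_add w) (Cochain.ofHom φ.hom) = z := by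
  let y := (unshift W V w 0 w (zero_add w)).symm z
  let c : Cocycle W.cx (shiftObj w V).cx 0 :=
    Cocycle.mk y 1 rfl (δ_eq_zero_of_isFiniteMinimal hW hV w 0 1 y)
  have hc : Cochain.ofHom (Cocycle.homOf c) = y := Cocycle.cochain_ofHom_homOf_eq_coe c
  have hy : unshift W V w 0 w (zero_add w) y = z := LinearEquiv.apply_symm_apply _ _
  refine ⟨⟨Cocycle.homOf c, 0, ?_⟩, rfl, ?_⟩
  · rw [δ_zero, hc]
    symm
    apply (unshift W V w e (e + w) rfl).injective
    rw [map_zero, unshift_ad _ _ (zero_add w), hy, zero_mul, Int.negOnePow_zero, one_smul]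
    -- For `w = 1 - e` the sign on the suspended `τ` is trivial, so compatibility with it is the
    -- unsigned relation `hz`.
    have h₁ : (w * e).negOnePow = 1 := by
      refine Int.negOnePow_even _ ?_
      obtain rfl : w = 1 - e := by lia
      rw [show (1 - e) * e = -(e * (e - 1)) by ring]
      exact (Int.even_mul_pred_self e).neg
    rw [h₁, one_smul, sub_eq_zero]
    have : w + e = e + w := add_comm _ _
    have key (m : ℤ) (h : w + e = m) : z.comp V.τ h = W.τ.comp z ((add_comm e w).trans h) := by
      subst h
      exact hz
    exact key _ _
  · rw [hc, hy]

/-- A nonzero underlying map is detected by a `φ` having only a homotopy component. If the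
underlying map vanishes, the class lives in the cokernel of `ad`, and it is detected by a `φ` having
only an underlying map, because that cokernel is dual to a kernel of `ad`. -/
theorem exists_homTrace_ne_zero (hV : IsFiniteMinimal V.cx) (hW : IsFiniteMinimal W.cx)
    (hw : e - 1 + w = 0) (f : V ⟶ W) (hf : ¬ IsNull f) :
    ∃ φ : W ⟶ shiftObj w V, homTrace hV hw (f ≫ φ) ≠ 0 := by
  by_cases h₀ : f.hom = 0
  · let A : Cochain V.cx W.cx (-1) →ₗ[k] Cochain V.cx W.cx (e - 1) :=
      { toFun := ad V W (-1) (e - 1) (by lia)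
        map_add' := by simp
        map_smul' := by simp }
    have h₁ : f.htpy ∉ LinearMap.range A := by
      rintro ⟨h, hh⟩
      exact hf (isNull_of_hom_eq_zero hV hW h₀ h hh.symm)
    obtain ⟨ℓ, hℓ, hA⟩ := Submodule.exists_le_ker_of_notMem h₁
    -- The functional `ℓ` separates `f.htpy` from the image of `ad`; the trace pairing represents it
    -- by a cochain `z` of degree `w`.
    have := isPerfPair_tracePairing hV hW hw
    obtain ⟨z, rfl⟩ := (LinearMap.IsPerfPair.bijective_right
      (tracePairing hV W.cx hw)).surjective ℓ
    have hz : z.comp V.τ rfl = W.τ.comp z (add_comm e w) := by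
      rw [← sub_eq_zero]
      by_contra hne
      -- Adjointness of `ad`: pairing the commutator of `z` and `τ` with `h` equals, up to sign,
      -- pairing `z` with `ad h`, and this is zero because `ℓ` kills the image of `ad`. So `z`
      -- commutes with `τ` and underlies a morphism.
      obtain ⟨h, hh⟩ := exists_supertrace_comp_ne_zero hW _ hne (by lia : w + e + -1 = 0)
      apply hh
      have h₂ : supertrace hV ((A h).comp z hw) = 0 := hA ⟨h, rfl⟩
      rw [supertrace_comp_comm hW hV _ _ _ (by lia)]
      suffices supertrace hV (h.comp (z.comp V.τ rfl - W.τ.comp z (add_comm e w)) (by lia)) = 0 by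
        rw [this, smul_zero]
      have h₃ : (A h).comp z hw = h.comp (W.τ.comp z (add_comm e w)) (by lia) -
          (-1 * e).negOnePow • V.τ.comp (h.comp z (by lia : -1 + w = -e)) (by lia) := by
        change (ad V W (-1) (e - 1) _ h).comp z hw = _
        rw [ad, Cochain.sub_comp, Cochain.units_smul_comp, assoc, assoc]
      rw [h₃, map_sub, supertrace_units_smul, supertrace_comp_comm hV hV V.τ _ _ (by lia), smul_smul,
        ← Int.negOnePow_add, show -1 * e + e = 0 by lia, Int.negOnePow_zero, one_smul,
        assoc h z V.τ _ rfl _ (by lia)] at h₂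
      rw [Cochain.comp_sub, map_sub, ← neg_sub, h₂, neg_zero]
    obtain ⟨φ, -, hφ⟩ := exists_hom_of_comm hV hW hw z hz
    refine ⟨φ, ?_⟩
    rw [homTrace_comp, h₀, hφ, Cochain.ofHom_zero, Cochain.zero_comp, map_zero, zero_add]
    exact hℓ
  · obtain ⟨y, hy⟩ := exists_supertrace_comp_ne_zero hV (Cochain.ofHom f.hom)
      (fun h => h₀ (Cochain.ofHom_injective (h.trans (Cochain.ofHom_zero _ _).symm))) (add_zero 0)
    let φ : W ⟶ shiftObj w V :=
      { hom := 0
        htpy := (unshift W V w (e - 1) 0 hw).symm y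
        δ_htpy := by
          rw [δ_eq_zero_of_isFiniteMinimal hW hV, Cochain.ofHom_zero, ad_zero] }
    refine ⟨φ, ?_⟩
    rw [homTrace_comp]
    have h₁ : unshift W V w (e - 1) 0 hw φ.htpy = y := LinearEquiv.apply_symm_apply _ _
    have h₂ : Cochain.ofHom φ.hom = 0 := Cochain.ofHom_zero _ _
    rw [h₁, h₂, map_zero, Cochain.comp_zero, map_zero, add_zero]
    exact hy

end

end TwistedComplex

/-! ### From trace forms to Serre functors -/

section

variable {k : Type*} [Field k] {C E : Type*} [Category C] [Category E] [Preadditive C]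
  [Preadditive E] [Linear k C] [Linear k E]

/-- A fully faithful functor to a category with nondegenerate trace forms gives Serre duality. -/
theorem isSerreFunctor_of_trace (F : C ⥤ E) [F.Full] [F.Faithful] [F.Additive] [F.Linear k]
    (S : C ⥤ C) [S.IsEquivalence] (S' : E ⥤ E) [S'.Additive] [S'.Linear k]
    (σ : S ⋙ F ≅ F ⋙ S') (obj : C → E) (α : ∀ X, F.obj X ≅ obj X)
    (t : ∀ X, (obj X ⟶ S'.obj (obj X)) →ₗ[k] k)
    (comm : ∀ (X Y : C) (f : obj X ⟶ obj Y) (φ : obj Y ⟶ S'.obj (obj X)),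
      t X (f ≫ φ) = t Y (φ ≫ S'.map f))
    (nondeg : ∀ (X Y : C) (f : obj X ⟶ obj Y), f ≠ 0 →
      ∃ φ : obj Y ⟶ S'.obj (obj X), t X (f ≫ φ) ≠ 0)
    (fin : ∀ X Y, Module.Finite k (obj X ⟶ obj Y)) : IsSerreFunctor k S := by
  have hS {X Y : C} (f : X ⟶ Y) : F.map (S.map f) = σ.hom.app X ≫ S'.map (F.map f) ≫
      σ.inv.app Y := by
    have := σ.hom.naturality f
    simp only [Functor.comp_map] at this
    rw [← reassoc_of% this, Iso.hom_inv_id_app]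
    exact (Category.comp_id _).symm
  let τ (X Y : C) : (Y ⟶ S.obj X) →ₗ[k] (obj Y ⟶ S'.obj (obj X)) :=
    { toFun φ := (α Y).inv ≫ F.map φ ≫ σ.hom.app X ≫ S'.map (α X).hom
      map_add' := by simp
      map_smul' := by simp }
  let ρ (X Y : C) : (X ⟶ Y) →ₗ[k] (obj X ⟶ obj Y) :=
    { toFun f := (α X).inv ≫ F.map f ≫ (α Y).hom
      map_add' := by simp
      map_smul' := by simp }
  have hρ (X Y : C) : Function.Injective (ρ X Y) := fun f g h => by
    have h' : (α X).inv ≫ F.map f ≫ (α Y).hom = (α X).inv ≫ F.map g ≫ (α Y).hom := h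
    rw [cancel_epi, cancel_mono] at h'
    exact F.map_injective h'
  have hτ (X Y : C) : Function.Surjective (τ X Y) := fun ψ => by
    obtain ⟨φ, hφ⟩ := F.map_surjective
      ((α Y).hom ≫ ψ ≫ S'.map (α X).inv ≫ σ.inv.app X)
    refine ⟨φ, ?_⟩
    change (α Y).inv ≫ F.map φ ≫ σ.hom.app X ≫ S'.map (α X).hom = ψ
    rw [hφ]
    have : S'.map (α X).inv ≫ S'.map (α X).hom = 𝟙 _ := by
      rw [← S'.map_comp, Iso.inv_hom_id, S'.map_id]
    simp [this]
  have hρτ {X Y Z : C} (f : X ⟶ Y) (φ : Y ⟶ S.obj Z) : τ Z X (f ≫ φ) = ρ X Y f ≫ τ Z Y φ := by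
    simp [τ, ρ]
  have hτρ {X Y Z : C} (φ : X ⟶ S.obj Y) (f : Y ⟶ Z) :
      τ Z X (φ ≫ S.map f) = τ Y X φ ≫ S'.map (ρ Y Z f) := by
    have h₁ : S'.map (α Y).hom ≫ S'.map (α Y).inv = 𝟙 _ := by
      rw [← S'.map_comp, Iso.hom_inv_id, S'.map_id]
    have h₂ : σ.inv.app Z ≫ σ.hom.app Z = 𝟙 _ := σ.inv_hom_id_app Z
    simp [τ, ρ, hS, reassoc_of% h₁, reassoc_of% h₂]
  -- The trace form transported to `C` along the chosen models of the objects. The comparison `hτρ`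
  -- between `S` and `S'` makes it cyclic and nondegenerate there.
  let s (X : C) : (X ⟶ S.obj X) →ₗ[k] k := t X ∘ₗ τ X X
  have hs {X Y : C} (f : X ⟶ Y) (φ : Y ⟶ S.obj X) : s X (f ≫ φ) = s Y (φ ≫ S.map f) := by
    change t X (τ X X _) = t Y (τ Y Y _)
    rw [hρτ, hτρ, comm]
  have hnd {X Y : C} (f : X ⟶ Y) (hf : f ≠ 0) : ∃ φ : Y ⟶ S.obj X, s X (f ≫ φ) ≠ 0 := by
    obtain ⟨ψ, hψ⟩ := nondeg X Y (ρ X Y f) (fun h => hf (hρ X Y (h.trans (map_zero _).symm)))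
    obtain ⟨φ, rfl⟩ := hτ X Y ψ
    exact ⟨φ, by rwa [← hρτ] at hψ⟩
  let p (X Y : C) : (X ⟶ Y) →ₗ[k] (Y ⟶ S.obj X) →ₗ[k] k :=
    LinearMap.mk₂ k (fun f φ => s X (f ≫ φ)) (by simp) (by simp) (by simp) (by simp)
  have hp (X Y : C) : (p X Y).IsPerfPair := by
    have := fin X Y
    have : Module.Finite k (X ⟶ Y) := Module.Finite.of_injective (ρ X Y) (hρ X Y)
    refine LinearMap.IsPerfPair.of_injective ?_ ?_
    · refine (injective_iff_map_eq_zero _).2 fun f hf => ?_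
      by_contra hne
      obtain ⟨φ, hφ⟩ := hnd f hne
      exact hφ (LinearMap.congr_fun hf φ)
    · refine (injective_iff_map_eq_zero _).2 fun φ hφ => ?_
      by_contra hne
      -- Nondegeneracy in the second variable comes from the first: `φ` is detected by some `ψ`
      -- between values of `S`, fullness of `S` writes `ψ = S f`, and cyclicity moves `f` to the
      -- front.
      obtain ⟨ψ, hψ⟩ := hnd φ hne
      obtain ⟨f, rfl⟩ := S.map_surjective ψ
      rw [← hs] at hψ
      exact hψ (LinearMap.congr_fun hφ f)
  refine ⟨inferInstance, fun f g => ?_, fun r f => ?_, fun X Y =>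
    LinearEquiv.ofBijective (p X Y) (hp X Y).bijective_left, ?_, ?_⟩
  -- Additivity and linearity of `S` are inherited from `S'` through the faithful functor `F`.
  · apply F.map_injective
    simp [hS]
  · apply F.map_injective
    simp [hS]
  · intro X Y Y' f g φ
    exact congrArg (s X) (Category.assoc f g φ)
  · intro X X' Y h f φ
    change s X' ((h ≫ f) ≫ φ) = s X (f ≫ φ ≫ S.map h)
    rw [Category.assoc, hs, Category.assoc]

end

/-! ### The trace form on homotopy classes -/

namespace TwistedComplex

variable {k : Type u} [Field k] {e w : ℤ} {U V W : TwistedComplex k e}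

noncomputable section

/-- The homotopy class of a morphism to a suspension. -/
def hoToShift (φ : W ⟶ shiftObj w V) :
    (ho k e).obj W ⟶ (hoShift k e w).obj ((ho k e).obj V) := (ho k e).map φ

lemma hoToShift_surjective
    (β : (ho k e).obj W ⟶ (hoShift k e w).obj ((ho k e).obj V)) :
    ∃ φ : W ⟶ shiftObj w V, hoToShift φ = β :=
  (ho k e).map_surjective (X := W) (Y := shiftObj w V) β

lemma hoToShift_eq_iff (φ ψ : W ⟶ shiftObj w V) :
    hoToShift φ = hoToShift ψ ↔ IsNull (φ - ψ) := ho_map_eq_iff φ ψ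

lemma hoToShift_add (φ ψ : W ⟶ shiftObj w V) :
    hoToShift (φ + ψ) = hoToShift φ + hoToShift ψ := (ho k e).map_add

lemma hoToShift_smul (r : k) (φ : W ⟶ shiftObj w V) :
    hoToShift (r • φ) = r • hoToShift φ := (ho k e).map_smul _ _

lemma ho_map_comp_hoToShift (f : U ⟶ W) (φ : W ⟶ shiftObj w V) :
    (ho k e).map f ≫ hoToShift φ = hoToShift (f ≫ φ) := ((ho k e).map_comp f φ).symm

lemma hoToShift_comp_map (φ : U ⟶ shiftObj w V) (f : V ⟶ W) :
    hoToShift φ ≫ (hoShift k e w).map ((ho k e).map f) = hoToShift (φ ≫ shiftMap w f) :=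
  ((ho k e).map_comp φ (shiftMap w f)).symm

/-- The trace of a homotopy class of morphisms. -/
def hoTraceFun (hV : IsFiniteMinimal V.cx) (hw : e - 1 + w = 0)
    (β : (ho k e).obj V ⟶ (hoShift k e w).obj ((ho k e).obj V)) : k :=
  homTrace hV hw (hoToShift_surjective β).choose

/-- The value does not depend on the chosen representative, since the trace vanishes on
null-homotopic morphisms. -/
lemma hoTraceFun_hoToShift (hV : IsFiniteMinimal V.cx) (hw : e - 1 + w = 0)
    (φ : V ⟶ shiftObj w V) : hoTraceFun hV hw (hoToShift φ) = homTrace hV hw φ := by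
  have h := (hoToShift_surjective (hoToShift φ)).choose_spec
  rw [hoToShift_eq_iff] at h
  rw [hoTraceFun, ← sub_eq_zero, ← map_sub]
  exact h.homTrace_eq_zero hV hw

/-- The trace on homotopy classes of morphisms from a finite minimal complex to its suspension. -/
def hoTrace (hV : IsFiniteMinimal V.cx) (hw : e - 1 + w = 0) :
    ((ho k e).obj V ⟶ (hoShift k e w).obj ((ho k e).obj V)) →ₗ[k] k where
  toFun := hoTraceFun hV hw
  map_add' x y := by
    obtain ⟨x, rfl⟩ := hoToShift_surjective x
    obtain ⟨y, rfl⟩ := hoToShift_surjective y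
    rw [← hoToShift_add]
    simp only [hoTraceFun_hoToShift, map_add]
  map_smul' r x := by
    obtain ⟨x, rfl⟩ := hoToShift_surjective x
    rw [← hoToShift_smul]
    simp only [hoTraceFun_hoToShift, map_smul, RingHom.id_apply]

lemma hoTrace_hoToShift (hV : IsFiniteMinimal V.cx) (hw : e - 1 + w = 0)
    (φ : V ⟶ shiftObj w V) : hoTrace hV hw (hoToShift φ) = homTrace hV hw φ :=
  hoTraceFun_hoToShift hV hw φ

lemma finite_ho_hom (hV : IsFiniteMinimal V.cx) (hW : IsFiniteMinimal W.cx) :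
    Module.Finite k ((ho k e).obj V ⟶ (ho k e).obj W) := by
  have := hV.finite_cochain hW 0
  have := hV.finite_cochain hW (e - 1)
  let f : (V ⟶ W) →ₗ[k] Cochain V.cx W.cx 0 × Cochain V.cx W.cx (e - 1) :=
    { toFun g := (Cochain.ofHom g.hom, g.htpy)
      map_add' := by simp
      map_smul' := by simp [ofHom_smul] }
  have : Module.Finite k (V ⟶ W) := Module.Finite.of_injective f fun g g' h =>
    hom_ext (Cochain.ofHom_injective (congrArg Prod.fst h)) (congrArg Prod.snd h)
  exact Module.Finite.of_surjective ((ho k e).mapLinearMap k) (ho k e).map_surjective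

end

end TwistedComplex

/-! ### `Σ^w` is a Serre functor -/

namespace SphericalCategory

open TwistedComplex DGAlgebra

variable (k : Type u) [Field k] (w : ℤ)

noncomputable section

/-- The embedding in the category of homotopy classes of morphisms of complexes with an
endomorphism. -/
abbrev toHo : SphericalCategory k w ⥤ HoCat k (-(w - 1)) :=
  ObjectProperty.ι _ ⋙ derivedToHo k (w - 1)

/-- The compatibility of the embedding with suspensions. -/
def shiftToHoIso (n : ℤ) : CategoryTheory.shiftFunctor (SphericalCategory k w) n ⋙ toHo k w ≅
    toHo k w ⋙ hoShift k (-(w - 1)) n :=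
  (Functor.associator _ _ _).symm ≪≫
    Functor.isoWhiskerRight ((ObjectProperty.ι _).commShiftIso n) (derivedToHo k (w - 1)) ≪≫
    Functor.associator _ _ _ ≪≫
    Functor.isoWhiskerLeft _ (shiftDerivedToHoIso k (w - 1) n)

variable {k w}

/-- The objects are represented by finite minimal complexes. -/
lemma exists_iso (X : SphericalCategory k w) : ∃ V : TwistedComplex k (-(w - 1)),
    IsFiniteMinimal V.cx ∧ Nonempty ((toHo k w).obj X ≅ (ho k _).obj V) := by
  obtain ⟨X, hX⟩ := X
  obtain ⟨M, rfl⟩ := exists_Q_obj_eq X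
  have hM := (hasFiniteHomology_Q_obj_iff M).1 (hasFiniteHomology_of_thick hX)
  obtain ⟨V, hV, ⟨α⟩⟩ := exists_iso_homologyComplex (ofModule M)
  refine ⟨V, ?_, ⟨(derivedToHoIso k (w - 1)).app M ≪≫ α⟩⟩
  rw [hV]
  exact hM.isFiniteMinimal

/-- A minimal model is chosen for each object independently. No functoriality of the models is
needed, because the abstract criterion conjugates by the chosen isomorphisms. -/
theorem isSerreFunctor_shiftFunctor :
    IsSerreFunctor k (CategoryTheory.shiftFunctor (SphericalCategory k w) w) := by
  choose V hV α using exists_iso (k := k) (w := w)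
  have hw : -(w - 1) - 1 + w = 0 := by lia
  refine isSerreFunctor_of_trace (toHo k w) _ (hoShift k (-(w - 1)) w) (shiftToHoIso k w w)
    (fun X => (ho k _).obj (V X)) (fun X => (α X).some) (fun X => hoTrace (hV X) hw)
    (fun X Y f φ => ?_) (fun X Y f hf => ?_) (fun X Y => finite_ho_hom (hV X) (hV Y))
  · obtain ⟨f, rfl⟩ := (ho k _).map_surjective f
    obtain ⟨φ, rfl⟩ := hoToShift_surjective φ
    rw [ho_map_comp_hoToShift, hoToShift_comp_map, hoTrace_hoToShift, hoTrace_hoToShift,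
      homTrace_comm (hV X) (hV Y)]
  · obtain ⟨f, rfl⟩ := (ho k _).map_surjective f
    rw [Ne, ho_map_eq_zero_iff] at hf
    obtain ⟨φ, hφ⟩ := exists_homTrace_ne_zero (hV X) (hV Y) hw f hf
    refine ⟨hoToShift φ, ?_⟩
    rwa [ho_map_comp_hoToShift, hoTrace_hoToShift]

end

end SphericalCategory

/-! ### No other power of the suspension is a Serre functor -/

namespace TwistedComplex

variable {k : Type u} [Field k] {e : ℤ} {V W : TwistedComplex k e}

lemma cochain_eq_zero {K L : CochainComplex (ModuleCat.{u} k) ℤ} {p q n : ℤ}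
    (hK : ∀ i, i ≠ p → IsZero (K.X i)) (hL : ∀ i, i ≠ q → IsZero (L.X i)) (h : p + n ≠ q)
    (z : Cochain K L n) : z = 0 := by
  refine Cochain.ext _ _ fun i j hij => ?_
  by_cases hi : i = p
  · exact (hL j (by lia)).eq_of_tgt _ _
  · exact (hK i hi).eq_of_src _ _

/-- The two components of a morphism have degrees `0` and `e - 1`. For complexes concentrated in one
degree, one of them must join the two degrees. -/
lemma eq_of_ho_hom_ne_zero {p q : ℤ} (hV : ∀ i, i ≠ p → IsZero (V.cx.X i))
    (hW : ∀ i, i ≠ q → IsZero (W.cx.X i)) (f : (ho k e).obj V ⟶ (ho k e).obj W) (hf : f ≠ 0) :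
    q = p ∨ q = p + (e - 1) := by
  by_contra! h
  obtain ⟨f, rfl⟩ := (ho k e).map_surjective f
  apply hf
  have : f = 0 := by
    apply hom_ext
    · apply Cochain.ofHom_injective
      rw [zero_hom, Cochain.ofHom_zero]
      exact cochain_eq_zero (n := 0) hV hW (by lia) _
    · exact cochain_eq_zero (n := e - 1) hV hW (by lia) _
  rw [this, Functor.map_zero]

lemma isZero_shift_X {K : CochainComplex (ModuleCat.{u} k) ℤ} {p : ℤ}
    (hK : ∀ i, i ≠ p → IsZero (K.X i)) (a : ℤ) : ∀ i, i ≠ p - a → IsZero ((K⟦a⟧).X i) :=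
  fun i hi => hK (i + a) (by lia)

end TwistedComplex

namespace SphericalCategory

open TwistedComplex DGAlgebra

variable (k : Type u) [Field k] (w : ℤ)

/-- The generator. -/
noncomputable def generator : SphericalCategory k w :=
  ⟨DGAlgebra.DerivedCategory.Q.obj (residueModule k (w - 1)), fun _ _ h => h⟩

/-- The trivial module as a complex with an endomorphism. -/
noncomputable abbrev residue : TwistedComplex k (-(w - 1)) := ofModule (residueModule k (w - 1))

/-- The generator is represented by the trivial module. -/
noncomputable def generatorIso : (toHo k w).obj (generator k w) ≅ (ho k _).obj (residue k w) :=
  (derivedToHoIso k (w - 1)).app (residueModule k (w - 1))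

/-- The suspensions of the generator are represented by the suspensions of the trivial module. -/
noncomputable def shiftGeneratorIso (a : ℤ) :
    (toHo k w).obj ((generator k w)⟦a⟧) ≅ (ho k _).obj (shiftObj a (residue k w)) :=
  (shiftToHoIso k w a).app (generator k w) ≪≫
    (hoShift k (-(w - 1)) a).mapIso (generatorIso k w)

lemma isZero_residue_X : ∀ i, i ≠ 0 → IsZero ((residue k w).cx.X i) := fun i hi => by
  have : Subsingleton (residuePart k i) :=
    ⟨fun x y => Subtype.ext ((x.2 hi).trans (y.2 hi).symm)⟩
  exact ModuleCat.isZero_of_subsingleton (ModuleCat.of k (residuePart k i))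

variable {k w}

lemma map_conj_ne_zero {X Y : SphericalCategory k w} {X' Y' : HoCat k (-(w - 1))}
    (α : (toHo k w).obj X ≅ X') (β : (toHo k w).obj Y ≅ Y') {f : X ⟶ Y} (hf : f ≠ 0) :
    α.inv ≫ (toHo k w).map f ≫ β.hom ≠ 0 := by
  intro h
  apply hf
  apply (toHo k w).map_injective
  rw [Functor.map_zero, ← cancel_epi α.inv, ← cancel_mono β.hom, Category.assoc, h, comp_zero,
    zero_comp]

/-- Here `k` sits in degree `0`, its suspension by `i` in degree `-i`, and `e - 1 = -w`. -/
lemma eq_or_eq_of_hom_shift_ne_zero {i : ℤ} (f : generator k w ⟶ (generator k w)⟦i⟧)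
    (hf : f ≠ 0) : i = 0 ∨ i = w := by
  have := eq_of_ho_hom_ne_zero (isZero_residue_X k w)
    (isZero_shift_X (isZero_residue_X k w) i) _
    (map_conj_ne_zero (generatorIso k w) (shiftGeneratorIso k w i) hf)
  lia

/-- The degrees are `-w` and `0`, so the degree criterion reads `0 = -w` or `0 = -2 w`. -/
lemma eq_zero_of_hom_shift_ne_zero (f : (generator k w)⟦w⟧ ⟶ (generator k w)⟦(0 : ℤ)⟧)
    (hf : f ≠ 0) : w = 0 := by
  have := eq_of_ho_hom_ne_zero (isZero_shift_X (isZero_residue_X k w) w)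
    (isZero_shift_X (isZero_residue_X k w) 0) _
    (map_conj_ne_zero (shiftGeneratorIso k w w) (shiftGeneratorIso k w 0) hf)
  lia

/-- On a complex with zero differential a null-homotopic morphism has zero underlying map, and the
identity of `k` is not zero. -/
lemma id_generator_ne_zero : 𝟙 (generator k w) ≠ 0 := by
  intro h
  have h₁ : 𝟙 ((ho k _).obj (residue k w)) = 0 := by
    rw [← (generatorIso k w).inv_hom_id, ← Category.id_comp (generatorIso k w).hom,
      ← (toHo k w).map_id, h, Functor.map_zero, zero_comp, comp_zero]
  rw [← (ho k _).map_id, ho_map_eq_zero_iff] at h₁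
  obtain ⟨z, -, hz, -⟩ := h₁
  rw [δ_eq_zero_of_d_eq_zero (fun _ _ => rfl) (fun _ _ => rfl)] at hz
  have h₂ : 𝟙 (residueComplex k) = 0 :=
    Cochain.ofHom_injective (hz.trans (Cochain.ofHom_zero _ _).symm)
  have h₃ : (⟨1, fun h => absurd rfl h⟩ : residuePart k 0) = 0 :=
    LinearMap.congr_fun (congrArg (fun f => ModuleCat.Hom.hom (HomologicalComplex.Hom.f f 0)) h₂)
      (⟨1, fun h => absurd rfl h⟩ : residuePart k 0)
  exact one_ne_zero (congrArg Subtype.val h₃)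

lemma exists_hom_ne_zero {S : SphericalCategory k w ⥤ SphericalCategory k w}
    (hS : IsSerreFunctor k S) {X Y : SphericalCategory k w} (f : X ⟶ Y) (hf : f ≠ 0) :
    ∃ φ : Y ⟶ S.obj X, φ ≠ 0 := by
  obtain ⟨η, -⟩ := hS.duality
  by_contra! h
  apply hf
  apply (η X Y).injective
  rw [map_zero]
  refine LinearMap.ext fun φ => ?_
  rw [h φ, map_zero, map_zero]

theorem eq_of_isSerreFunctor_shiftFunctor {i : ℤ}
    (hi : IsSerreFunctor k (CategoryTheory.shiftFunctor (SphericalCategory k w) i)) : i = w := by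
  obtain ⟨f, hf⟩ := exists_hom_ne_zero hi _ id_generator_ne_zero
  obtain rfl | rfl := eq_or_eq_of_hom_shift_ne_zero f hf
  -- The case `i = 0`. Duality for `Σ^w` applied to the identity of `k` gives a nonzero `k ⟶ Σ^w k`,
  -- and the supposed duality for `Σ^0` turns it into a nonzero `Σ^w k ⟶ Σ^0 k`, so `w = 0`.
  · obtain ⟨g, hg⟩ := exists_hom_ne_zero isSerreFunctor_shiftFunctor _
      (id_generator_ne_zero (k := k) (w := w))
    obtain ⟨h, hh⟩ := exists_hom_ne_zero hi g hg
    exact (eq_zero_of_hom_shift_ne_zero h hh).symm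
  · rfl

end SphericalCategory

end

theorem mainTheorem2 (k : Type*) [Field k] [IsAlgClosed k] (w : ℤ) :
    IsSerreFunctor k (CategoryTheory.shiftFunctor (SphericalCategory k w) w) ∧
      ∀ i : ℤ, IsSerreFunctor k (CategoryTheory.shiftFunctor (SphericalCategory k w) i) → i = w :=
  ⟨SphericalCategory.isSerreFunctor_shiftFunctor,
    fun _ => SphericalCategory.eq_of_isSerreFunctor_shiftFunctor⟩
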